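/- Let $\mathfrak g$ be a finite-dimensional simple complex Lie algebra with Cartan subalgebra $\mathfrak h$ and a fixed base of simple roots with simple coroots $h_i$ ($i\in I$). Let $Q^+\subset\mathfrak h^*$ be the $\mathbb Z_{\ge 0}$-span of the simple roots, $P^+$ the set of dominant integral weights, and write $\mu\le\lambda$ iff $\lambda-\mu\in Q^+$. Let $R^+$ be the set of positive roots, $\mathfrak n^+=\bigoplus_{\alpha\in R^+}\mathfrak g_\alpha$, and let $x_i^-$ span the root space $\mathfrak g_{-\alpha_i}$. For $\mu\in P^+$ let $V(\mu)$ be the $\mathfrak g$-module generated by $v_\mu$ with relations $\mathfrak n^+v_\mu=0$, $hv_\mu=\mu(h)v_\mu$, $(x_i^-)^{\mu(h_i)+1}v_\mu=0$. Let $A$ be a finitely generated commutative associative unital $\mathbb C$-algebra, $\mathfrak g\otimes A$ the Lie algebra with bracket $[x\otimes a,y\otimes b]=[x,y]\otimes ab$, and $U(\cdot)$ the universal enveloping algebra; $\mathfrak g$ acts on $\mathfrak g\otimes A$-modules through $x\mapsto x\otimes 1$. Fix $\lambda\in P^+$. * $\mathcal I_A^\lambda$ is the category of $\mathfrak g\otimes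 A$-modules $V$ that are locally finite-dimensional over $\mathfrak g$ and whose weights $\mu\in\mathfrak h^*$ (those with $V_\mu=\{v: hv=\mu(h)v\ \forall h\in\mathfrak h\}\neq0$) all lie in $\lambda-Q^+$. * Let $P_A=U(\mathfrak g\otimes A)\otimes_{U(\mathfrak g)}V(\lambda)$. The global Weyl module is $W_A(\lambda)=P_A\big/\sum_{\mu\not\le\lambda}U(\mathfrak g\otimes A)(P_A)_\mu$, with generator $w_\lambda$ the image of $1\otimes v_\lambda$. Put $\mathbf A_\lambda=U(\mathfrak h\otimes A)/\{u: uw_\lambda=0\}$; it acts on $W_A(\lambda)$ on the right by $(uw_\lambda)y=uyw_\lambda$. * For $V\in\mathcal I_A^\lambda$ let $\mathbf R_A^\lambda V$ be $V_\lambda$ with the $\mathbf A_\lambda$-action induced by $U(\mathfrak h\otimes A)$. For an $\mathbf A_\lambda$-module $M$ let $\mathbf W_A^\lambda M=W_A(\lambda)\otimes_{\mathbf A_\lambda}M$, and let $\mathbf V_A^\lambda M$ be the quotient of $\mathbf W_A^\lambda M$ by the sum of its proper submodules (its unique irreducible quotient, when $M$ is irreducible). * $\Xi$ is the set of finitely supported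 maps $\xi:\max A\to P^+$, with $\operatorname{wt}\xi=\sum_S\xi(S)$, and $\Xi_\lambda=\{\xi\in\Xi:\operatorname{wt}\xi=\lambda\}$. For $\xi\in\Xi$ let $\mathcal V_\xi=\bigotimes_{S\in\operatorname{supp}\xi}V(\xi(S))$, where $x\otimes a$ acts by $$(x\otimes a)(v_1\otimes\cdots\otimes v_r)=\sum_{k=1}^r\operatorname{ev}_{S_k}(a)\,v_1\otimes\cdots\otimes xv_k\otimes\cdots\otimes v_r,\qquad \operatorname{ev}_S:A\to A/S=\mathbb C,$$ with $S_1,\dots,S_r$ an enumeration of $\operatorname{supp}\xi$. **Proposition.** For every $\xi\in\Xi_\lambda$ the module $\mathcal V_\xi$ is an object of $\mathcal I_A^\lambda$; put $M_\xi=\mathbf R_A^\lambda\mathcal V_\xi$. Then: 1. $\xi\mapsto M_\xi$ induces a bijection from $\Xi_\lambda$ onto the set of isomorphism classes of irreducible $\mathbf A_\lambda$-modules. 2. $\xi\mapsto\mathcal V_\xi$ induces a bijection from $\Xi_\lambda$ onto the set of isomorphism classes of irreducible objects $V$ of $\mathcal I_A^\lambda$ with $V_\lambda\ne0$ (i.e.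 of highest weight $\lambda$). Without the condition $V_\lambda\neq 0$: $\xi\mapsto\mathcal V_\xi$ induces a bijection from $\{\xi\in\Xi:\operatorname{wt}\xi\le\lambda\}$ onto the set of isomorphism classes of all irreducible objects of $\mathcal I_A^\lambda$. 3. $\mathcal V_\xi\cong\mathbf V_A^\lambda M_\xi$ as $\mathfrak g\otimes A$-modules for every $\xi\in\Xi_\lambda$. -/

import Mathlib

open scoped TensorProduct
open LieAlgebra LieAlgebra.IsKilling Module

universe u v w

noncomputable section

namespace WeylFunctor

attribute [local instance 100] LieRing.ofAssociativeRing

/-! ### Universal enveloping algebras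

Modules over a Lie algebra `L` are modules over its universal enveloping algebra `U(L)`.
The current algebra `𝔤 ⊗ A` is written `A ⊗[ℂ] g`, with bracket `[a ⊗ x, b ⊗ y] = ab ⊗ [x, y]`. -/

/-- `U(L)` for a complex Lie algebra `L`. -/
abbrev U (L : Type*) [LieRing L] [LieAlgebra ℂ L] := UniversalEnvelopingAlgebra ℂ L

/-- The action of an element `x` of a Lie algebra on a module is the action of `iota x ∈ U(L)`. -/
abbrev iota {L : Type*} [LieRing L] [LieAlgebra ℂ L] : L →ₗ⁅ℂ⁆ U L :=
  UniversalEnvelopingAlgebra.ι ℂ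

/-- The algebra homomorphism `U(L) → U(L')` induced by a Lie algebra homomorphism. -/
def mapU {L L' : Type*} [LieRing L] [LieAlgebra ℂ L] [LieRing L'] [LieAlgebra ℂ L']
    (f : L →ₗ⁅ℂ⁆ L') : U L →ₐ[ℂ] U L' :=
  UniversalEnvelopingAlgebra.lift ℂ (iota.comp f)

theorem mapU_iota {L L' : Type*} [LieRing L] [LieAlgebra ℂ L] [LieRing L'] [LieAlgebra ℂ L']
    (f : L →ₗ⁅ℂ⁆ L') (x : L) : mapU f (iota x) = iota (f x) :=
  UniversalEnvelopingAlgebra.lift_ι_apply ℂ _ x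

/-- An induction principle for `U(L)`. -/
theorem U_induction {L : Type*} [LieRing L] [LieAlgebra ℂ L] (p : U L → Prop)
    (hC : ∀ c : ℂ, p (algebraMap ℂ (U L) c)) (hi : ∀ x : L, p (iota x))
    (hadd : ∀ a b, p a → p b → p (a + b)) (hmul : ∀ a b, p a → p b → p (a * b)) (y : U L) :
    p y := by
  let s : Subalgebra ℂ (U L) :=
    { carrier := {y | p y}
      mul_mem' := fun ha hb => hmul _ _ ha hb
      add_mem' := fun ha hb => hadd _ _ ha hb
      algebraMap_mem' := hC }
  let f : L →ₗ⁅ℂ⁆ s :=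
    { toFun := fun x => ⟨iota x, hi x⟩
      map_add' := fun a b => Subtype.ext (map_add iota a b)
      map_smul' := fun c a => Subtype.ext (map_smul iota c a)
      map_lie' := fun {a b} => Subtype.ext (LieHom.map_lie iota a b) }
  have h : s.val.comp (UniversalEnvelopingAlgebra.lift ℂ f) = AlgHom.id ℂ (U L) := by
    apply UniversalEnvelopingAlgebra.hom_ext
    ext x
    simp [f]
  have h2 := DFunLike.congr_fun h y
  have h3 : ((UniversalEnvelopingAlgebra.lift ℂ f y : s) : U L) = y := h2
  rw [← h3]
  exact (UniversalEnvelopingAlgebra.lift ℂ f y).2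

/-- The enveloping algebra of an abelian Lie algebra is commutative. -/
theorem U_comm {L : Type*} [LieRing L] [LieAlgebra ℂ L] (hL : ∀ x y : L, ⁅x, y⁆ = 0)
    (a b : U L) : a * b = b * a := by
  have key : ∀ x y : L, (iota x : U L) * iota y = iota y * iota x := by
    intro x y
    have := LieHom.map_lie (iota : L →ₗ⁅ℂ⁆ U L) x y
    rw [hL, map_zero, LieRing.of_associative_ring_bracket] at this
    exact (sub_eq_zero.mp this.symm)
  have h1 : ∀ (x : L) (b : U L), iota x * b = b * iota x := by
    intro x b
    induction b using U_induction with
    | hC c => exact (Algebra.commutes c _).symm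
    | hi y => exact key x y
    | hadd a b ha hb => rw [mul_add, add_mul, ha, hb]
    | hmul a b ha hb => rw [← mul_assoc, ha, mul_assoc, hb, mul_assoc]
  induction a using U_induction with
  | hC c => exact Algebra.commutes c _
  | hi x => exact h1 x b
  | hadd a a' ha hb => rw [mul_add, add_mul, ha, hb]
  | hmul a a' ha hb => rw [mul_assoc, hb, ← mul_assoc, ha, mul_assoc]

/-! ### Weights -/

section Weights

variable {g : Type v} [LieRing g] [LieAlgebra ℂ g] [FiniteDimensional ℂ g] [IsSimple ℂ g]
  {H : LieSubalgebra ℂ g} [H.IsCartanSubalgebra]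

/-- The positive root cone `Q⁺`: the `ℤ₊`-span of the simple roots in `𝔥*`. -/
def posCone (b : (rootSystem H).Base) : AddSubmonoid (Dual ℂ H) :=
  AddSubmonoid.closure ((rootSystem H).root '' b.support)

/-- The dominant integral weights `P⁺`: the weights `μ ∈ 𝔥*` with `μ(h_i) ∈ ℤ₊` for all simple
coroots `h_i`. -/
def domWeights (b : (rootSystem H).Base) : AddSubmonoid (Dual ℂ H) where
  carrier := {μ | ∀ i ∈ b.support, ∃ n : ℕ, μ ((rootSystem H).coroot i) = n}
  zero_mem' := fun _ _ => ⟨0, by simp⟩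
  add_mem' := by
    intro μ ν hμ hν i hi
    obtain ⟨m, hm⟩ := hμ i hi
    obtain ⟨n, hn⟩ := hν i hi
    exact ⟨m + n, by simp only [LinearMap.add_apply, hm, hn]; push_cast; rfl⟩

/-- The left ideal of `U(𝔤)` generated by `𝔫⁺`, the elements `h - μ(h)` for `h ∈ 𝔥`, and the
elements `(x_i⁻)^{μ(h_i) + 1}`. -/
def simpleRel (b : (rootSystem H).Base) (μ : domWeights b) : Submodule (U g) (U g) :=
  Submodule.span (U g)
    ({y | ∃ α : H.root, (rootSystem H).root α ∈ posCone b ∧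
        ∃ x ∈ rootSpace H (α.1 : H → ℂ), y = iota x} ∪
      {y | ∃ h : H, y = iota (h : g) - algebraMap ℂ (U g) (μ.1 h)} ∪
      {y | ∃ i ∈ b.support, ∃ x ∈ rootSpace H (-(i.1 : H → ℂ)), ∃ n : ℕ,
        μ.1 ((rootSystem H).coroot i) = n ∧ y = iota x ^ (n + 1)})

/-- The `𝔤`-module `V(μ)`, `μ ∈ P⁺`, generated by `v_μ` with the relations
`𝔫⁺ v_μ = 0`, `h v_μ = μ(h) v_μ`, `(x_i⁻)^{μ(h_i) + 1} v_μ = 0`. -/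
abbrev SimpleMod (b : (rootSystem H).Base) (μ : domWeights b) : Type v :=
  U g ⧸ simpleRel b μ

/-- The generator `v_μ` of `V(μ)`. -/
def simpleGen (b : (rootSystem H).Base) (μ : domWeights b) : SimpleMod b μ :=
  Submodule.Quotient.mk 1

end Weights

/-! ### Modules for the current algebra -/

section Current

variable (A : Type u) [CommRing A] [Algebra ℂ A]
variable {g : Type v} [LieRing g] [LieAlgebra ℂ g]

/-- The inclusion `𝔤 → 𝔤 ⊗ A`, `x ↦ x ⊗ 1`. -/
def oneTensor : g →ₗ⁅ℂ⁆ A ⊗[ℂ] g where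
  toFun x := 1 ⊗ₜ x
  map_add' x y := TensorProduct.tmul_add _ _ _
  map_smul' c x := TensorProduct.tmul_smul _ _ _
  map_lie' {x y} := by simp

/-- The inclusion `𝔥 ⊗ A → 𝔤 ⊗ A` for a subalgebra `𝔥` of `𝔤`. -/
def inclCartan (H : LieSubalgebra ℂ g) : A ⊗[ℂ] H →ₗ⁅ℂ⁆ A ⊗[ℂ] g :=
  ExtendScalars.map (AlgHom.id ℂ A) H.incl

/-- The homomorphism `U(𝔥 ⊗ A) → U(𝔤 ⊗ A)`. -/
abbrev inclU (H : LieSubalgebra ℂ g) : U (A ⊗[ℂ] H) →ₐ[ℂ] U (A ⊗[ℂ] g) :=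
  mapU (inclCartan A H)

variable (H : LieSubalgebra ℂ g)
variable (V : Type w) [AddCommGroup V] [Module ℂ V] [Module (U (A ⊗[ℂ] g)) V]
  [IsScalarTower ℂ (U (A ⊗[ℂ] g)) V]

/-- The weight space `V_μ = {v | h v = μ(h) v for all h ∈ 𝔥}` of a `𝔤 ⊗ A`-module. -/
def wtSpace (μ : Dual ℂ H) : Submodule ℂ V where
  carrier := {v | ∀ h : H, (iota (oneTensor A (h : g)) : U (A ⊗[ℂ] g)) • v = μ h • v}
  zero_mem' := fun h => by simp
  add_mem' := fun ha hb h => by rw [smul_add, smul_add, ha h, hb h]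
  smul_mem' := fun c v hv h => by rw [smul_comm, hv h, smul_comm]

/-- A `𝔤 ⊗ A`-module is an object of `𝓘_A` if it is locally finite-dimensional as a `𝔤`-module:
every element lies in a finite-dimensional `𝔤`-submodule. -/
def IsLocFin : Prop :=
  ∀ v : V, ∃ N : Submodule ℂ V, v ∈ N ∧ FiniteDimensional ℂ N ∧
    ∀ x : g, ∀ n ∈ N, (iota (oneTensor A x) : U (A ⊗[ℂ] g)) • n ∈ N

/-- An `𝔰𝔩₂`-computation in a locally finite-dimensional module. -/
theorem sl2_pow_zero (hV : IsLocFin A (g := g) V) {h e f : g}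
    (t : IsSl2Triple h e f) (v : V) (n : ℕ)
    (hh : (iota (oneTensor A h) : U (A ⊗[ℂ] g)) • v = (n : ℂ) • v)
    (he : (iota (oneTensor A e) : U (A ⊗[ℂ] g)) • v = 0) :
    (iota (oneTensor A f) : U (A ⊗[ℂ] g)) ^ (n + 1) • v = 0 := by
  obtain ⟨N, hvN, hfin, hst⟩ := hV v
  by_cases hv0 : v = 0
  · rw [hv0, smul_zero]
  let act : g →ₗ⁅ℂ⁆ Module.End ℂ N :=
    { toFun := fun x =>
        { toFun := fun n => ⟨(iota (oneTensor A x) : U (A ⊗[ℂ] g)) • (n : V), hst x n n.2⟩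
          map_add' := fun a b => Subtype.ext (smul_add _ _ _)
          map_smul' := fun c a => Subtype.ext (smul_comm _ _ _) }
      map_add' := fun x y => by
        ext m
        simp [add_smul]
      map_smul' := fun c x => by
        ext m
        simp
      map_lie' := fun {x y} => by
        ext m
        have h1 : (iota (oneTensor A ⁅x, y⁆) : U (A ⊗[ℂ] g)) =
            iota (oneTensor A x) * iota (oneTensor A y) -
              iota (oneTensor A y) * iota (oneTensor A x) := by
          rw [LieHom.map_lie, LieHom.map_lie, LieRing.of_associative_ring_bracket]
        simp only [LinearMap.coe_mk, AddHom.coe_mk, h1, sub_smul, mul_smul,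
          LieRing.of_associative_ring_bracket, LinearMap.sub_apply, Module.End.mul_apply,
          Submodule.coe_sub] }
  let _ : LieRingModule g N := LieRingModule.compLieHom N act
  have _ : LieModule ℂ g N := LieModule.compLieHom N act
  have hact : ∀ (x : g) (m : N), ((⁅x, m⁆ : N) : V) =
      (iota (oneTensor A x) : U (A ⊗[ℂ] g)) • (m : V) := fun x m => rfl
  have P : t.HasPrimitiveVectorWith (⟨v, hvN⟩ : N) (n : ℂ) :=
    { ne_zero := fun h => hv0 (congrArg Subtype.val h)
      lie_h := Subtype.ext (by rw [hact]; exact hh)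
      lie_e := Subtype.ext (by rw [hact]; exact he) }
  have h0 := P.pow_toEnd_f_eq_zero_of_eq_nat rfl
  have hp : ∀ k : ℕ, ((((LieModule.toEnd ℂ g N f) ^ k) ⟨v, hvN⟩ : N) : V) =
      (iota (oneTensor A f) : U (A ⊗[ℂ] g)) ^ k • v := by
    intro k
    induction k with
    | zero => simp
    | succ k ih =>
      rw [pow_succ', Module.End.mul_apply, LieModule.toEnd_apply_apply, hact, ih, pow_succ',
        mul_smul]
  rw [← hp, h0]
  rfl

end Current

section Category

variable (A : Type u) [CommRing A] [Algebra ℂ A]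
variable {g : Type v} [LieRing g] [LieAlgebra ℂ g] [FiniteDimensional ℂ g] [IsSimple ℂ g]
  {H : LieSubalgebra ℂ g} [H.IsCartanSubalgebra] (b : (rootSystem H).Base) (lam : domWeights b)

/-- `V` is an object of `𝓘_A^λ`: it lies in `𝓘_A` and `wt V ⊆ λ - Q⁺`. -/
structure IsObj (V : Type w) [AddCommGroup V] [Module ℂ V] [Module (U (A ⊗[ℂ] g)) V]
    [IsScalarTower ℂ (U (A ⊗[ℂ] g)) V] : Prop where
  locFin : IsLocFin A (g := g) V
  wt_le : ∀ μ : Dual ℂ H, wtSpace A H V μ ≠ ⊥ → lam.1 - μ ∈ posCone b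

/-! ### Global Weyl modules -/

/-- The relations `u y ⊗ v = u ⊗ y v`, `y ∈ U(𝔤)`, defining `U(𝔤 ⊗ A) ⊗_{U(𝔤)} V(λ)` as a quotient
of `U(𝔤 ⊗ A) ⊗_ℂ V(λ)`. -/
def inducedRel : Submodule (U (A ⊗[ℂ] g)) (U (A ⊗[ℂ] g) ⊗[ℂ] SimpleMod b lam) :=
  Submodule.span (U (A ⊗[ℂ] g))
    {t | ∃ (x : U (A ⊗[ℂ] g)) (y : U g) (v : SimpleMod b lam),
      t = (x * mapU (oneTensor A) y) ⊗ₜ[ℂ] v - x ⊗ₜ[ℂ] (y • v)}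

/-- The `𝔤 ⊗ A`-module `P_A(V(λ)) = U(𝔤 ⊗ A) ⊗_{U(𝔤)} V(λ)`. -/
abbrev Induced : Type (max u v) :=
  (U (A ⊗[ℂ] g) ⊗[ℂ] SimpleMod b lam) ⧸ inducedRel A b lam

/-- The submodule `∑_{μ ≰ λ} U(𝔤 ⊗ A) P_A(V(λ))_μ` of `P_A(V(λ))`. -/
def truncRel : Submodule (U (A ⊗[ℂ] g)) (Induced A b lam) :=
  Submodule.span (U (A ⊗[ℂ] g))
    {p | ∃ μ : Dual ℂ H, lam.1 - μ ∉ posCone b ∧ p ∈ wtSpace A H (Induced A b lam) μ}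

/-- The global Weyl module `W_A(λ) = P_A(V(λ))^λ`, the maximal quotient of `P_A(V(λ))` all of whose
weights are in `λ - Q⁺`. -/
abbrev GlobalWeyl : Type (max u v) := Induced A b lam ⧸ truncRel A b lam

/-- The generator `w_λ` of `W_A(λ)`, the image of `1 ⊗ v_λ`. -/
def weylGen : GlobalWeyl A b lam :=
  Submodule.Quotient.mk (Submodule.Quotient.mk (1 ⊗ₜ simpleGen b lam))

/-! ### The algebra `𝐀_λ` -/

/-- The ideal `Ann_{𝔥 ⊗ A}(w_λ) = {y ∈ U(𝔥 ⊗ A) | y w_λ = 0}`. -/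
def annIdeal : Ideal (U (A ⊗[ℂ] H)) where
  carrier := {y | inclU A H y • weylGen A b lam = 0}
  zero_mem' := by simp
  add_mem' := fun {x y} hx hy => by
    simp only [Set.mem_ofPred_eq] at hx hy ⊢
    rw [map_add, add_smul, hx, hy, add_zero]
  smul_mem' := fun c x hx => by
    simp only [Set.mem_ofPred_eq] at hx ⊢
    rw [smul_eq_mul, map_mul, mul_smul, hx, smul_zero]

theorem cur_abelian {K : Type v} [LieRing K] [LieAlgebra ℂ K] (hK : ∀ x y : K, ⁅x, y⁆ = 0)
    (x y : A ⊗[ℂ] K) : ⁅x, y⁆ = 0 := by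
  induction x using TensorProduct.induction_on with
  | zero => exact zero_lie y
  | add x x' hx hx' => rw [add_lie, hx, hx', add_zero]
  | tmul a h =>
    induction y using TensorProduct.induction_on with
    | zero => exact lie_zero _
    | add x x' hx hx' => rw [lie_add, hx, hx', add_zero]
    | tmul a' h' => rw [ExtendScalars.bracket_tmul, hK, TensorProduct.tmul_zero]

theorem cartanU_comm (x y : U (A ⊗[ℂ] H)) : x * y = y * x :=
  U_comm (cur_abelian A fun a c => trivial_lie_zero H H a c) x y

instance : (annIdeal A b lam).IsTwoSided where
  mul_mem_of_left {x} y hx := by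
    rw [cartanU_comm A x y]
    exact Ideal.mul_mem_left _ _ hx

/-- The algebra `𝐀_λ = U(𝔥 ⊗ A) / Ann_{𝔥 ⊗ A}(w_λ)`. -/
abbrev Alam : Type (max u v) := U (A ⊗[ℂ] H) ⧸ annIdeal A b lam


/-! ### The weight space `V_λ` of `V ∈ 𝓘_A^λ` as an `𝐀_λ`-module -/

section Universal

/-- The cone `Q⁺` is pointed. -/
theorem posCone_pointed {x : Dual ℂ H} (hx : x ∈ posCone b) (hx' : -x ∈ posCone b) : x = 0 := by
  let F : Dual ℂ H →ₗ[ℂ] ℂ := b.toWeightBasis.constr ℂ fun _ => (1 : ℂ)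
  have hF : ∀ y ∈ posCone b, ∃ n : ℕ, F y = n ∧ (n = 0 → y = 0) := by
    intro y hy
    induction hy using AddSubmonoid.closure_induction with
    | mem y hy =>
      obtain ⟨i, hi, rfl⟩ := hy
      refine ⟨1, ?_, fun h => absurd h one_ne_zero⟩
      have := b.toWeightBasis.constr_basis ℂ (fun _ => (1 : ℂ)) ⟨i, hi⟩
      rw [b.toWeightBasis_apply] at this
      simpa only [Nat.cast_one] using this
    | zero => exact ⟨0, by simp, fun _ => rfl⟩
    | add y z _ _ hy hz =>
      obtain ⟨m, hm, hm0⟩ := hy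
      obtain ⟨n, hn, hn0⟩ := hz
      refine ⟨m + n, by rw [map_add, hm, hn]; push_cast; rfl, fun h => ?_⟩
      rw [hm0 (by omega), hn0 (by omega), add_zero]
  obtain ⟨m, hm, hm0⟩ := hF x hx
  obtain ⟨n, hn, -⟩ := hF _ hx'
  apply hm0
  rw [map_neg, hm] at hn
  have : ((m + n : ℕ) : ℂ) = 0 := by push_cast; rw [← hn]; ring
  have := Nat.cast_eq_zero.mp this
  omega

variable {A b lam}
variable {V : Type w} [AddCommGroup V] [Module ℂ V] [Module (U (A ⊗[ℂ] g)) V]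
    [IsScalarTower ℂ (U (A ⊗[ℂ] g)) V]

theorem nPlus_kill (hV : IsObj A b lam V) {v : V} (hv : v ∈ wtSpace A H V lam.1)
    {α : H.root} (hα : (rootSystem H).root α ∈ posCone b) {x : g}
    (hx : x ∈ rootSpace H (α.1 : H → ℂ)) :
    (iota (oneTensor A x) : U (A ⊗[ℂ] g)) • v = 0 := by
  by_contra hne
  have hmem : (iota (oneTensor A x) : U (A ⊗[ℂ] g)) • v ∈
      wtSpace A H V (lam.1 + (rootSystem H).root α) := by
    intro h
    have h1 : (iota (oneTensor A (h : g)) : U (A ⊗[ℂ] g)) * iota (oneTensor A x) =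
        iota (oneTensor A x) * iota (oneTensor A (h : g)) +
          (α.1 h) • iota (oneTensor A x) := by
      have h2 : ⁅(h : g), x⁆ = α.1 h • x := lie_eq_smul_of_mem_rootSpace hx h
      have h3 := LieHom.map_lie (iota : A ⊗[ℂ] g →ₗ⁅ℂ⁆ U (A ⊗[ℂ] g))
        (oneTensor A (h : g)) (oneTensor A x)
      rw [← LieHom.map_lie, h2, map_smul (oneTensor A), map_smul iota,
        LieRing.of_associative_ring_bracket] at h3
      rw [h3]; abel
    rw [← mul_smul, h1, add_smul, mul_smul, hv h, LinearMap.add_apply, add_smul, smul_assoc,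
      smul_comm]
    rfl
  have hw := hV.wt_le _ (fun h0 => hne (by rw [h0] at hmem; exact hmem))
  have h4 : -((rootSystem H).root α) ∈ posCone b := by
    have : lam.1 - (lam.1 + (rootSystem H).root α) = -((rootSystem H).root α) := by abel
    rwa [this] at hw
  exact (rootSystem H).ne_zero α (posCone_pointed b hα h4)

theorem fPow_kill (hV : IsObj A b lam V) {v : V} (hv : v ∈ wtSpace A H V lam.1)
    {i : H.root} (hi : i ∈ b.support) {x : g} (hx : x ∈ rootSpace H (-(i.1 : H → ℂ))) {n : ℕ}
    (hn : lam.1 ((rootSystem H).coroot i) = n) :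
    (iota (oneTensor A x) : U (A ⊗[ℂ] g)) ^ (n + 1) • v = 0 := by
  have hi0 : i.1.IsNonZero := (Finset.mem_filter.mp i.2).2
  obtain ⟨h, e, f, t, he, hf⟩ := exists_isSl2Triple_of_weight_isNonZero hi0
  have hh : h = coroot i.1 := t.h_eq_coroot hi0 he hf
  have hneg : (-i.1).IsNonZero := by simpa using hi0
  obtain ⟨c, rfl⟩ : ∃ c : ℂ, c • f = x := by
    have h1 := finrank_rootSpace_eq_one (-i.1) hneg
    rw [LieModule.Weight.coe_neg] at h1
    obtain ⟨c, hc⟩ := (finrank_eq_one_iff_of_nonzero'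
      (⟨f, hf⟩ : rootSpace H (-(i.1 : H → ℂ)))
      (fun h => t.f_ne_zero (congrArg Subtype.val h))).mp h1 ⟨x, hx⟩
    exact ⟨c, congrArg Subtype.val hc⟩
  have hpos : (rootSystem H).root i ∈ posCone b :=
    AddSubmonoid.subset_closure ⟨i, hi, rfl⟩
  have key := sl2_pow_zero A V hV.locFin t v n
    (by rw [hh, hv (coroot i.1), ← hn]; rfl) (nPlus_kill hV hv hpos he)
  rw [map_smul (oneTensor A), map_smul iota, smul_pow, smul_assoc, key, smul_zero]

/-- Every `v ∈ V_λ`, `V ∈ 𝓘_A^λ`, is the image of `w_λ` under a homomorphism `W_A(λ) → V`. -/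
theorem exists_hom (hV : IsObj A b lam V) {v : V} (hv : v ∈ wtSpace A H V lam.1) :
    ∃ F : GlobalWeyl A b lam →ₗ[U (A ⊗[ℂ] g)] V, F (weylGen A b lam) = v := by
  let _ : Module (U g) V := Module.compHom V (mapU (oneTensor A (g := g))).toRingHom
  have hact : ∀ (y : U g) (v : V), y • v = mapU (oneTensor A) y • v := fun _ _ => rfl
  let f0 : U g →ₗ[U g] V := LinearMap.toSpanSingleton (U g) V v
  have hf0 : ∀ y, f0 y = mapU (oneTensor A) y • v := fun _ => rfl
  have hle : simpleRel b lam ≤ LinearMap.ker f0 := by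
    refine Submodule.span_le.mpr ?_
    rintro y ((⟨α, hα, x, hx, rfl⟩ | ⟨h, rfl⟩) | ⟨i, hi, x, hx, n, hn, rfl⟩)
    · change f0 _ = 0
      rw [hf0, mapU_iota]
      exact nPlus_kill hV hv hα hx
    · change f0 _ = 0
      rw [hf0, map_sub, mapU_iota, AlgHom.commutes, sub_smul, hv h, algebraMap_smul, sub_self]
    · change f0 _ = 0
      rw [hf0, map_pow, mapU_iota]
      exact fPow_kill hV hv hi hx hn
  let f1 : SimpleMod b lam →ₗ[U g] V := (simpleRel b lam).liftQ f0 hle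
  have hf1 : f1 (simpleGen b lam) = v := by
    change f0 1 = v
    rw [hf0, map_one, one_smul]
  have _ : IsScalarTower ℂ (U g) V := ⟨fun c y v => by
    rw [hact, hact, map_smul, smul_assoc]⟩
  let f2 : U (A ⊗[ℂ] g) ⊗[ℂ] SimpleMod b lam →ₗ[U (A ⊗[ℂ] g)] V :=
    TensorProduct.AlgebraTensorModule.lift
      (LinearMap.toSpanSingleton (U (A ⊗[ℂ] g)) (SimpleMod b lam →ₗ[ℂ] V)
        (f1.restrictScalars ℂ))
  have hf2 : ∀ u y, f2 (u ⊗ₜ y) = u • f1 y := fun u y => rfl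
  have hle2 : inducedRel A b lam ≤ LinearMap.ker f2 := by
    refine Submodule.span_le.mpr ?_
    rintro t ⟨x, y, w, rfl⟩
    change f2 _ = 0
    rw [map_sub, hf2, hf2, map_smul, hact, mul_smul, sub_self]
  let f3 : Induced A b lam →ₗ[U (A ⊗[ℂ] g)] V := (inducedRel A b lam).liftQ f2 hle2
  have hle3 : truncRel A b lam ≤ LinearMap.ker f3 := by
    refine Submodule.span_le.mpr ?_
    rintro p ⟨μ, hμ, hp⟩
    change f3 p = 0
    by_contra hne
    have hmem : f3 p ∈ wtSpace A H V μ := by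
      intro h
      rw [← map_smul, hp h, ← LinearMap.restrictScalars_apply ℂ, map_smul]
      rfl
    exact hμ (hV.wt_le μ (fun h0 => hne (by rw [h0] at hmem; exact hmem)))
  refine ⟨(truncRel A b lam).liftQ f3 hle3, ?_⟩
  change f2 (1 ⊗ₜ simpleGen b lam) = v
  rw [hf2, one_smul, hf1]

/-- `Ann_{𝔥 ⊗ A}(w_λ)` annihilates `V_λ` for `V ∈ 𝓘_A^λ`. -/
theorem ann_kill (hV : IsObj A b lam V) {v : V} (hv : v ∈ wtSpace A H V lam.1)
    {y : U (A ⊗[ℂ] H)} (hy : y ∈ annIdeal A b lam) : inclU A H y • v = 0 := by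
  obtain ⟨F, rfl⟩ := exists_hom hV hv
  have : inclU A H y • weylGen A b lam = 0 := hy
  rw [← map_smul, this, map_zero]

end Universal

/-- Weight spaces are stable under `U(𝔥 ⊗ A)`. -/
theorem wtSpace_stable {V : Type w} [AddCommGroup V] [Module ℂ V] [Module (U (A ⊗[ℂ] g)) V]
    [IsScalarTower ℂ (U (A ⊗[ℂ] g)) V] {μ : Dual ℂ H} (y : U (A ⊗[ℂ] H)) {v : V}
    (hv : v ∈ wtSpace A H V μ) : inclU A H y • v ∈ wtSpace A H V μ := by
  intro h
  have h1 : (iota (oneTensor A (h : g)) : U (A ⊗[ℂ] g)) = inclU A H (iota (oneTensor A h)) := by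
    rw [mapU_iota]
    rfl
  rw [← mul_smul, h1, ← map_mul, cartanU_comm, map_mul, mul_smul, ← h1, hv h, smul_comm]

/-- The underlying space `V_λ` of the `𝐀_λ`-module `𝐑_A^λ V`, for `V` an object of `𝓘_A^λ`. -/
@[nolint unusedArguments]
def RFun {V : Type w} [AddCommGroup V] [Module ℂ V] [Module (U (A ⊗[ℂ] g)) V]
    [IsScalarTower ℂ (U (A ⊗[ℂ] g)) V] (_hV : IsObj A b lam V) : Type w :=
  wtSpace A H V lam.1

section RFun

variable {A b lam}
variable {V : Type w} [AddCommGroup V] [Module ℂ V] [Module (U (A ⊗[ℂ] g)) V]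
    [IsScalarTower ℂ (U (A ⊗[ℂ] g)) V] (hV : IsObj A b lam V)

instance : AddCommGroup (RFun A b lam hV) :=
  inferInstanceAs (AddCommGroup (wtSpace A H V lam.1))

/-- The action of `U(𝔥 ⊗ A)` on `V_λ`. -/
def cartanAct : U (A ⊗[ℂ] H) →+* AddMonoid.End (RFun A b lam hV) where
  toFun y :=
    { toFun := fun v => ⟨inclU A H y • v.1, wtSpace_stable A y v.2⟩
      map_zero' := Subtype.ext (smul_zero _)
      map_add' := fun v v' => Subtype.ext (smul_add _ _ _) }
  map_one' := by
    ext v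
    exact Subtype.ext (by change inclU A H 1 • v.1 = v.1; rw [map_one, one_smul])
  map_mul' y z := by
    ext v
    exact Subtype.ext (by
      change inclU A H (y * z) • v.1 = inclU A H y • inclU A H z • v.1
      rw [map_mul, mul_smul])
  map_zero' := by
    ext v
    exact Subtype.ext (by change inclU A H 0 • v.1 = 0; rw [map_zero, zero_smul])
  map_add' y z := by
    ext v
    exact Subtype.ext (by
      change inclU A H (y + z) • v.1 = inclU A H y • v.1 + inclU A H z • v.1
      rw [map_add, add_smul])

/-- The `𝐀_λ`-module structure on `𝐑_A^λ V = V_λ` induced by the action of `U(𝔥 ⊗ A)`. -/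
instance : Module (Alam A b lam) (RFun A b lam hV) :=
  Module.compHom _ (Ideal.Quotient.lift (annIdeal A b lam) (cartanAct hV) fun y hy => by
    ext v
    exact Subtype.ext (ann_kill hV v.2 hy))

instance : Module ℂ (RFun A b lam hV) :=
  inferInstanceAs (Module ℂ (wtSpace A H V lam.1))

instance : IsScalarTower ℂ (Alam A b lam) (RFun A b lam hV) where
  smul_assoc c y v := by
    obtain ⟨y, rfl⟩ := Ideal.Quotient.mk_surjective y
    refine Subtype.ext ?_
    change inclU A H (c • y) • v.1 = c • (inclU A H y • v.1)
    rw [map_smul, smul_assoc]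

end RFun

/-! ### The functors `𝐖_A^λ` and `𝐕_A^λ` -/

section WFun

variable (M : Type w) [AddCommGroup M] [Module ℂ M] [Module (Alam A b lam) M]
  [IsScalarTower ℂ (Alam A b lam) M]

/-- The relations `(u w_λ) y ⊗ m = u w_λ ⊗ y m`, where `(u w_λ) y = u y w_λ` is the right action of
`y ∈ 𝐀_λ` on `W_A(λ)`. -/
def weylRel : Submodule (U (A ⊗[ℂ] g)) (GlobalWeyl A b lam ⊗[ℂ] M) :=
  Submodule.span (U (A ⊗[ℂ] g))
    {t | ∃ (x : U (A ⊗[ℂ] g)) (y : U (A ⊗[ℂ] H)) (m : M),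
      t = ((x * inclU A H y) • weylGen A b lam) ⊗ₜ[ℂ] m -
        (x • weylGen A b lam) ⊗ₜ[ℂ] (Ideal.Quotient.mk (annIdeal A b lam) y • m)}

/-- The `𝔤 ⊗ A`-module `𝐖_A^λ M = W_A(λ) ⊗_{𝐀_λ} M`. -/
abbrev WFun : Type (max u v w) := (GlobalWeyl A b lam ⊗[ℂ] M) ⧸ weylRel A b lam M

/-- The `𝔤 ⊗ A`-module `𝐕_A^λ M`: the quotient of `𝐖_A^λ M` by the sum of its proper submodules.
It is the unique irreducible quotient of `𝐖_A^λ M` whenever there is one. -/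
abbrev VFun : Type (max u v w) :=
  WFun A b lam M ⧸ sSup {N : Submodule (U (A ⊗[ℂ] g)) (WFun A b lam M) | N ≠ ⊤}

end WFun

end Category

/-! ### Tensor products of evaluation modules -/

section Slot

variable {ι : Type*} (E : ι → Type*) [∀ i, AddCommGroup (E i)] [∀ i, Module ℂ (E i)]

open Classical in
/-- The operator `1 ⊗ ⋯ ⊗ f ⊗ ⋯ ⊗ 1` on `⨂ E_i`, with `f` in the factor `i`. -/
def slot (i : ι) : Module.End ℂ (E i) →ₐ[ℂ] Module.End ℂ (⨂[ℂ] i, E i) :=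
  AlgHom.ofLinearMap
    { toFun := fun f => PiTensorProduct.map (Function.update (fun j => (1 : Module.End ℂ (E j))) i f)
      map_add' := fun f f' => PiTensorProduct.map_update_add _ _ _ _
      map_smul' := fun c f => PiTensorProduct.map_update_smul _ _ _ _ }
    (by
      change PiTensorProduct.map _ = _
      rw [Function.update_eq_self]
      exact PiTensorProduct.map_one)
    (fun f f' => by
      change PiTensorProduct.map _ = PiTensorProduct.map _ * PiTensorProduct.map _
      rw [← PiTensorProduct.map_mul]
      congr 1
      funext j
      by_cases h : j = i
      · subst h; simp
      · simp [h])

theorem slot_tprod [DecidableEq ι] (i : ι) (f : Module.End ℂ (E i)) (x : ∀ i, E i) :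
    slot E i f (PiTensorProduct.tprod ℂ x) =
      PiTensorProduct.tprod ℂ (Function.update x i (f (x i))) := by
  change PiTensorProduct.map _ _ = _
  rw [PiTensorProduct.map_tprod]
  congr 1
  funext j
  by_cases h : j = i
  · subst h; simp
  · simp [h]

theorem slot_comm {i j : ι} (hij : i ≠ j) (f : Module.End ℂ (E i)) (f' : Module.End ℂ (E j)) :
    slot E i f * slot E j f' = slot E j f' * slot E i f := by
  classical
  apply PiTensorProduct.ext
  ext x
  simp only [LinearMap.compMultilinearMap_apply, Module.End.mul_apply, slot_tprod]
  rw [Function.update_of_ne hij, Function.update_of_ne hij.symm, Function.update_comm hij]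

/-- The sum of commuting Lie algebra actions on the factors of `⨂ E_i`:
`x (v_1 ⊗ ⋯ ⊗ v_r) = ∑_k v_1 ⊗ ⋯ ⊗ x v_k ⊗ ⋯ ⊗ v_r`. -/
def tensorAct [Fintype ι] {L : Type*} [LieRing L] [LieAlgebra ℂ L]
    (ρ : ∀ i, L →ₗ⁅ℂ⁆ Module.End ℂ (E i)) : L →ₗ⁅ℂ⁆ Module.End ℂ (⨂[ℂ] i, E i) where
  toFun x := ∑ i, slot E i (ρ i x)
  map_add' x y := by simp [Finset.sum_add_distrib]
  map_smul' c x := by simp [Finset.smul_sum]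
  map_lie' {x y} := by
    rw [LieRing.of_associative_ring_bracket, Finset.sum_mul_sum, Finset.sum_mul_sum,
      Finset.sum_comm (γ := ι) (f := fun i j => slot E i (ρ i y) * slot E j (ρ j x)),
      ← Finset.sum_sub_distrib]
    refine Finset.sum_congr rfl fun i _ => ?_
    rw [← Finset.sum_sub_distrib, Finset.sum_eq_single i]
    · rw [LieHom.map_lie, LieRing.of_associative_ring_bracket, map_sub, map_mul, map_mul]
    · intro j _ hj
      rw [slot_comm E hj.symm, sub_self]
    · intro h
      exact absurd (Finset.mem_univ i) h

end Slot

section Evaluation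

variable {A : Type u} [CommRing A] [Algebra ℂ A] [Algebra.FiniteType ℂ A]

theorem residue_bijective (S : MaximalSpectrum A) :
    Function.Bijective (algebraMap ℂ (A ⧸ S.asIdeal)) := by
  have := S.isMaximal
  let _ := Ideal.Quotient.field S.asIdeal
  have : Module.Finite ℂ (A ⧸ S.asIdeal) := finite_of_finite_type_of_isJacobsonRing ℂ _
  exact IsAlgClosed.algebraMap_bijective_of_isIntegral

/-- The evaluation homomorphism `ev_S : A → A / S = ℂ` at a maximal ideal `S`. -/
def ev (S : MaximalSpectrum A) : A →ₐ[ℂ] ℂ :=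
  (AlgEquiv.ofBijective (Algebra.ofId ℂ (A ⧸ S.asIdeal))
    (residue_bijective S)).symm.toAlgHom.comp (Ideal.Quotient.mkₐ ℂ S.asIdeal)

variable {g : Type v} [LieRing g] [LieAlgebra ℂ g]

/-- The evaluation homomorphism `𝔤 ⊗ A → 𝔤`, `x ⊗ a ↦ ev_S(a) x`. -/
def evLie (S : MaximalSpectrum A) : A ⊗[ℂ] g →ₗ⁅ℂ⁆ g where
  toLinearMap := TensorProduct.lift (LinearMap.lsmul ℂ g ∘ₗ (ev S).toLinearMap)
  map_lie' {x y} := by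
    change TensorProduct.lift _ ⁅x, y⁆ = ⁅TensorProduct.lift _ x, TensorProduct.lift _ y⁆
    induction x using TensorProduct.induction_on with
    | zero => rw [zero_lie, map_zero, zero_lie]
    | add x x' hx hx' => rw [add_lie, map_add, map_add, add_lie, hx, hx']
    | tmul a x =>
      induction y using TensorProduct.induction_on with
      | zero => rw [lie_zero, map_zero, lie_zero]
      | add y y' hy hy' => rw [lie_add, map_add, map_add, lie_add, hy, hy']
      | tmul c y => simp [smul_smul, mul_comm]

theorem evLie_tmul (S : MaximalSpectrum A) (a : A) (x : g) :
    evLie S (a ⊗ₜ[ℂ] x) = ev S a • x := rfl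

variable [FiniteDimensional ℂ g] [IsSimple ℂ g]
  {H : LieSubalgebra ℂ g} [H.IsCartanSubalgebra] (b : (rootSystem H).Base)

/-- The action of `𝔤` on `V(μ)`. -/
def simpleAct (μ : domWeights b) : g →ₗ⁅ℂ⁆ Module.End ℂ (SimpleMod b μ) where
  toLinearMap := (Algebra.lsmul ℂ ℂ (SimpleMod b μ)).toLinearMap ∘ₗ (iota : g →ₗ⁅ℂ⁆ U g).toLinearMap
  map_lie' {x y} := by
    change Algebra.lsmul ℂ ℂ (SimpleMod b μ) (iota ⁅x, y⁆) = _
    rw [LieHom.map_lie, LieRing.of_associative_ring_bracket, map_sub, map_mul, map_mul]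
    rfl

variable (A) in
/-- The monoid `Ξ` of finitely supported functions `max A → P⁺`. -/
abbrev Xi : Type (max u v) := MaximalSpectrum A →₀ domWeights b

variable {b}

/-- The weight `wt ξ = ∑_S ξ(S)`. -/
def Xi.wt (ξ : Xi A b) : domWeights b := ξ.sum fun _ μ => μ

variable (A b) in
/-- The set `Ξ_λ = {ξ ∈ Ξ | wt ξ = λ}`. -/
abbrev XiLam (lam : domWeights b) : Type (max u v) := {ξ : Xi A b // ξ.wt = lam}

/-- The `𝔤 ⊗ A`-module `V_ξ = ⨂_{S ∈ supp ξ} V(ξ(S))`. -/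
def TensEval (ξ : Xi A b) : Type (max u v) :=
  ⨂[ℂ] S : ξ.support, SimpleMod b (ξ S)

instance (ξ : Xi A b) : AddCommGroup (TensEval ξ) :=
  inferInstanceAs (AddCommGroup (⨂[ℂ] S : ξ.support, SimpleMod b (ξ S)))

instance (ξ : Xi A b) : Module ℂ (TensEval ξ) :=
  inferInstanceAs (Module ℂ (⨂[ℂ] S : ξ.support, SimpleMod b (ξ S)))

/-- The action of `𝔤 ⊗ A` on `V_ξ`:
`(x ⊗ a)(v_1 ⊗ ⋯ ⊗ v_r) = ∑_k ev_{S_k}(a) v_1 ⊗ ⋯ ⊗ x v_k ⊗ ⋯ ⊗ v_r`. -/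
def tensEvalAct (ξ : Xi A b) : A ⊗[ℂ] g →ₗ⁅ℂ⁆ Module.End ℂ (TensEval ξ) :=
  tensorAct (fun S : ξ.support => SimpleMod b (ξ S))
    fun S => (simpleAct b (ξ S)).comp (evLie S.1)

instance (ξ : Xi A b) : Module (U (A ⊗[ℂ] g)) (TensEval ξ) :=
  Module.compHom _ (UniversalEnvelopingAlgebra.lift ℂ (tensEvalAct ξ)).toRingHom

instance (ξ : Xi A b) : IsScalarTower ℂ (U (A ⊗[ℂ] g)) (TensEval ξ) where
  smul_assoc c y v := by
    change UniversalEnvelopingAlgebra.lift ℂ (tensEvalAct ξ) (c • y) v =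
      c • UniversalEnvelopingAlgebra.lift ℂ (tensEvalAct ξ) y v
    rw [map_smul]
    rfl

end Evaluation

end WeylFunctor

end

open WeylFunctor

/-! Both classifications reduce to characters of `𝔥 ⊗ A`. In an irreducible object of `𝓘_A^λ` a
weight of minimal depth below `λ` has a weight space killed by `𝔫⁺ ⊗ A`. By triangular decomposition
that space is an irreducible `U(𝔥 ⊗ A)`-module. The algebra `U(𝔥 ⊗ A)` is commutative of countable
dimension, so Schur's lemma in Dixmier's form makes it act by scalars (`exists_curHW`). Irreducible
highest weight modules with equal characters are isomorphic, because the submodule of `V × V'`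
generated by the pair of highest weight vectors is the graph of an isomorphism
(`nonempty_equiv_of_highest_weight`).

The possible characters `φ` are found one simple root at a time, inside `𝔰𝔩₂ ⊗ A`. Local finiteness
gives `(x_i⁻ ⊗ 1)^(n+1) v = 0`. The elements `a` with `(x_i⁻ ⊗ a) v = 0` form an ideal. Applying
`x_i⁺ ⊗ x` to the relation `n` times yields a monic polynomial in `x` lying in this ideal, which
therefore has finite codimension. Irreducibility of `V` makes the ideal radical. Hence `a ↦ φ(a ⊗
h_i)` is a combination of finitely many evaluations, and lifted idempotents show that the
coefficients are natural numbers (`CurrentSl2.exists_eq_sum_ev`). Collecting these numbers over `i`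
gives the `ξ` whose `V_ξ` has character `φ` (`exists_xiChar`).

The modules `V(μ)` are given by generators and relations, so three facts have to be proved. They are
nonzero: an irreducible representation of the Chevalley generators is built on words, and a graph
argument turns it into a representation of `𝔤` without Serre's theorem
(`ChevalleyRep.exists_lieHom`). They are finite-dimensional: the weights are stable under simple
reflections, hence of bounded depth. They are irreducible: the Casimir scalar separates comparable
dominant weights. In `V_ξ`, elements of `A` separating the support isolate the factors, and
Burnside's theorem supplies all operators on each factor, so `V_ξ` is irreducible.

For `𝐀_λ`, the `λ`-weight part of the submodule of `W_A(λ)` generated by `I w_λ` is just `I w_λ`. A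
maximal ideal `I` thus leaves a proper submodule; an irreducible quotient above it is some `V_ξ`,
and `𝐀_λ / I` is isomorphic to `M_ξ` (`exists_xi_of_isSimple`). Finally, `𝐖_A^λ M_ξ` is a highest
weight module, and all its proper submodules lie in the kernel of its surjection onto `V_ξ`; this
identifies `𝐕_A^λ M_ξ`. -/

noncomputable section

namespace WeylFunctor

attribute [local instance 100] LieRing.ofAssociativeRing

/-! ### Simultaneous eigenspaces -/

section Weights

variable {T V : Type*} [AddCommGroup T] [Module ℂ T] [AddCommGroup V] [Module ℂ V]

/-- The simultaneous eigenspace of a linear family of operators. -/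
def wt (τ : T →ₗ[ℂ] Module.End ℂ V) (μ : Dual ℂ T) : Submodule ℂ V where
  carrier := {v | ∀ h, τ h v = μ h • v}
  zero_mem' := fun h => by simp
  add_mem' := fun ha hb h => by rw [map_add, smul_add, ha h, hb h]
  smul_mem' := fun c v hv h => by rw [map_smul, hv h, smul_comm]

variable {τ : T →ₗ[ℂ] Module.End ℂ V}

/-- The weight components of an element of a stable subspace lie in the subspace. -/
theorem mem_of_sum_mem (N : Submodule ℂ V) (hN : ∀ h, ∀ v ∈ N, τ h v ∈ N)
    (s : Finset (Dual ℂ T)) (n : Dual ℂ T → V) (hn : ∀ μ ∈ s, n μ ∈ wt τ μ)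
    (hs : ∑ μ ∈ s, n μ ∈ N) : ∀ μ ∈ s, n μ ∈ N := by
  classical
  induction s using Finset.induction_on generalizing n with
  | empty => simp
  | insert ν s hν ih =>
    have key : ∀ μ ∈ s, n μ ∈ N := by
      intro μ hμ
      have hne : μ ≠ ν := fun h => hν (h ▸ hμ)
      obtain ⟨h, hh⟩ : ∃ h, μ h ≠ ν h := by
        by_contra! hc
        exact hne (LinearMap.ext hc)
      -- The operator `τ h - ν h` removes the component of weight `ν` and multiplies the chosen
      -- component by a nonzero scalar, so the induction hypothesis applies to the shorter sum.
      have h1 : ∑ μ ∈ s, (μ h - ν h) • n μ ∈ N := by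
        have h2 := N.sub_mem (hN h _ hs) (N.smul_mem (ν h) hs)
        rw [map_sum, Finset.smul_sum, ← Finset.sum_sub_distrib, Finset.sum_insert hν,
          hn ν (Finset.mem_insert_self _ _) h, sub_self, zero_add] at h2
        convert h2 using 1
        refine Finset.sum_congr rfl fun μ hμ => ?_
        rw [hn μ (Finset.mem_insert_of_mem hμ) h, sub_smul]
      have h3 := ih (fun μ => (μ h - ν h) • n μ)
        (fun μ hμ => (wt τ μ).smul_mem _ (hn μ (Finset.mem_insert_of_mem hμ))) h1 μ hμ
      exact (N.smul_mem_iff (sub_ne_zero.mpr hh)).mp h3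
    intro μ hμ
    rcases Finset.mem_insert.mp hμ with rfl | hμ
    · rw [Finset.sum_insert hν] at hs
      exact (N.add_mem_iff_left (N.sum_mem key)).mp hs
    · exact key μ hμ

/-- The span of the weight spaces with weights in `Ω`. -/
def wtSum (τ : T →ₗ[ℂ] Module.End ℂ V) (Ω : Set (Dual ℂ T)) : Submodule ℂ V :=
  ⨆ μ ∈ Ω, wt τ μ

theorem wt_le_wtSum {Ω : Set (Dual ℂ T)} {μ : Dual ℂ T} (hμ : μ ∈ Ω) : wt τ μ ≤ wtSum τ Ω :=
  le_iSup₂_of_le μ hμ le_rfl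

theorem wtSum_mono {Ω Ω' : Set (Dual ℂ T)} (h : Ω ⊆ Ω') : wtSum τ Ω ≤ wtSum τ Ω' :=
  iSup₂_le fun _ hμ => wt_le_wtSum (h hμ)

theorem exists_sum_of_mem_wtSum {Ω : Set (Dual ℂ T)} {v : V} (hv : v ∈ wtSum τ Ω) :
    ∃ (s : Finset (Dual ℂ T)) (n : Dual ℂ T → V), ↑s ⊆ Ω ∧ (∀ μ, n μ ∈ wt τ μ) ∧
      ∑ μ ∈ s, n μ = v := by
  classical
  induction hv using Submodule.iSup_induction' with
  | mem μ v hv =>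
    by_cases hμ : μ ∈ Ω
    · simp only [hμ, iSup_pos] at hv
      refine ⟨{μ}, Pi.single μ v, by simpa using hμ, fun ν => ?_, by simp⟩
      by_cases h : ν = μ
      · subst h; simpa using hv
      · simp [h]
    · simp only [hμ, not_false_eq_true, iSup_neg, Submodule.mem_bot] at hv
      subst hv
      exact ⟨∅, 0, by simp, by simp, by simp⟩
  | zero => exact ⟨∅, 0, by simp, by simp, by simp⟩
  | add v v' _ _ hv hv' =>
    obtain ⟨s, n, hs, hn, rfl⟩ := hv
    obtain ⟨s', n', hs', hn', rfl⟩ := hv'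
    refine ⟨s ∪ s', fun μ => (if μ ∈ s then n μ else 0) + if μ ∈ s' then n' μ else 0, ?_, ?_, ?_⟩
    · rw [Finset.coe_union]; exact Set.union_subset hs hs'
    · intro μ
      refine add_mem ?_ ?_ <;> split_ifs
      exacts [hn μ, zero_mem _, hn' μ, zero_mem _]
    · rw [Finset.sum_add_distrib, Finset.sum_ite_mem, Finset.sum_ite_mem,
        Finset.inter_eq_right.mpr Finset.subset_union_left,
        Finset.inter_eq_right.mpr Finset.subset_union_right]

/-- Independence of weight spaces: if `μ` were not in `Ω`, the vanishing sum of the components of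
`v` and of `-v` in weight `μ` would be a sum over distinct weights, and splitting it inside the zero
subspace gives `v = 0`. -/
theorem mem_of_mem_wtSum {Ω : Set (Dual ℂ T)} {v : V} (hv : v ∈ wtSum τ Ω) {μ : Dual ℂ T}
    (hv' : v ∈ wt τ μ) (h0 : v ≠ 0) : μ ∈ Ω := by
  classical
  by_contra hμ
  obtain ⟨s, n, hs, hn, rfl⟩ := exists_sum_of_mem_wtSum hv
  set v := ∑ μ ∈ s, n μ with hvdef
  have hμs : μ ∉ s := fun h => hμ (hs h)
  have h1 : ∑ ν ∈ insert μ s, (if ν = μ then -v else n ν) = 0 := by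
    rw [Finset.sum_insert hμs, if_pos rfl, neg_add_eq_zero, hvdef]
    exact Finset.sum_congr rfl fun ν hν => (if_neg (by rintro rfl; exact hμs hν)).symm
  have h2 := mem_of_sum_mem (τ := τ) ⊥ (fun h v hv => by
      rw [Submodule.mem_bot] at hv ⊢; rw [hv, map_zero])
    (insert μ s) (fun ν => if ν = μ then -v else n ν) (fun ν _ => by
      split_ifs with h
      · rw [h]; exact neg_mem hv'
      · exact hn ν) (by rw [h1]; exact zero_mem _) μ (Finset.mem_insert_self _ _)
  rw [if_pos rfl, Submodule.mem_bot, neg_eq_zero] at h2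
  exact h0 h2

/-- A stable subspace of a sum of weight spaces contains the components of its elements: if
`x + z` is in it, with `x` of weight `μ` and `z` a sum of vectors of other weights, then so is `x`. -/
theorem component_mem (N : Submodule ℂ V) (hN : ∀ h, ∀ v ∈ N, τ h v ∈ N)
    {Ω : Set (Dual ℂ T)} {μ : Dual ℂ T} (hμ : μ ∉ Ω) {x z : V} (hx : x ∈ wt τ μ)
    (hz : z ∈ wtSum τ Ω) (hxz : x + z ∈ N) : x ∈ N := by
  classical
  obtain ⟨s, n, hs, hn, rfl⟩ := exists_sum_of_mem_wtSum hz
  have hμs : μ ∉ s := fun h => hμ (hs h)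
  have := mem_of_sum_mem N hN (insert μ s) (fun ν => if ν = μ then x else n ν) (fun ν _ => by
      split_ifs with h
      · rw [h]; exact hx
      · exact hn ν) (by
      rw [Finset.sum_insert hμs, if_pos rfl]
      convert hxz using 2
      exact Finset.sum_congr rfl fun ν hν => if_neg (by rintro rfl; exact hμs hν))
    μ (Finset.mem_insert_self _ _)
  rwa [if_pos rfl] at this

/-- A nonzero stable subspace of a sum of weight spaces contains a weight vector. -/
theorem exists_wt_vector (N : Submodule ℂ V) (hN : ∀ h, ∀ v ∈ N, τ h v ∈ N)
    {Ω : Set (Dual ℂ T)} {v : V} (hv : v ∈ N) (h0 : v ≠ 0) (hΩ : v ∈ wtSum τ Ω) :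
    ∃ μ ∈ Ω, ∃ x ∈ N, x ∈ wt τ μ ∧ x ≠ 0 := by
  obtain ⟨s, n, hs, hn, rfl⟩ := exists_sum_of_mem_wtSum hΩ
  obtain ⟨μ, hμ, hne⟩ := Finset.exists_ne_zero_of_sum_ne_zero h0
  exact ⟨μ, hs hμ, n μ, mem_of_sum_mem N hN s n (fun μ _ => hn μ) hv μ hμ, hn μ, hne⟩

end Weights

/-! ### Highest weight representations -/

section HighestWeight

variable {L V : Type*} [LieRing L] [LieAlgebra ℂ L] [AddCommGroup V] [Module ℂ V]

theorem rep_lie (ρ : L →ₗ⁅ℂ⁆ Module.End ℂ V) (x y : L) (v : V) :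
    ρ ⁅x, y⁆ v = ρ x (ρ y v) - ρ y (ρ x v) := by
  rw [LieHom.map_lie, LieRing.of_associative_ring_bracket]; rfl

/-- The subrepresentation generated by a subset. -/
def repSpan (ρ : L →ₗ⁅ℂ⁆ Module.End ℂ V) (X : Set V) : Submodule ℂ V :=
  sInf {N | X ⊆ N ∧ ∀ x, ∀ v ∈ N, ρ x v ∈ N}

variable {ρ : L →ₗ⁅ℂ⁆ Module.End ℂ V}

theorem subset_repSpan (X : Set V) : X ⊆ repSpan ρ X := fun v hv => by
  rw [repSpan, SetLike.mem_coe, Submodule.mem_sInf]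
  exact fun N hN => hN.1 hv

theorem repSpan_stable (X : Set V) (x : L) {v : V} (hv : v ∈ repSpan ρ X) :
    ρ x v ∈ repSpan ρ X := by
  rw [repSpan, Submodule.mem_sInf] at hv ⊢
  exact fun N hN => hN.2 x v (hv N hN)

theorem repSpan_le {X : Set V} {N : Submodule ℂ V} (hX : X ⊆ N) (hN : ∀ x, ∀ v ∈ N, ρ x v ∈ N) :
    repSpan ρ X ≤ N := sInf_le ⟨hX, hN⟩

/-- The subspace obtained from `X` by repeated application of a set of operators. -/
inductive WordReach (ρ : L →ₗ⁅ℂ⁆ Module.End ℂ V) (S : Set L) (X : Set V) : V → Prop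
  | base (v : V) : v ∈ X → WordReach ρ S X v
  | step (x : L) (v : V) : x ∈ S → WordReach ρ S X v → WordReach ρ S X (ρ x v)

/-- If `L` is spanned by `S` and `B`, and `X` is stable under `B`, then the subrepresentation
generated by `X` is spanned by the words in `S` applied to `X`. -/
theorem repSpan_le_wordSpan {S B : Set L} (hSB : Submodule.span ℂ (S ∪ B) = ⊤)
    {X : Submodule ℂ V} (hB : ∀ x ∈ B, ∀ v ∈ X, ρ x v ∈ X) :
    repSpan ρ (X : Set V) ≤ Submodule.span ℂ {v | WordReach ρ S X v} := by
  set Y := Submodule.span ℂ {v | WordReach ρ S (X : Set V) v} with hY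
  have hXY : X ≤ Y := fun v hv => Submodule.subset_span (WordReach.base v hv)
  have hS : ∀ x ∈ S, ∀ v ∈ Y, ρ x v ∈ Y := by
    intro x hx v hv
    induction hv using Submodule.span_induction with
    | mem v hv => exact Submodule.subset_span (WordReach.step x v hx hv)
    | zero => rw [map_zero]; exact zero_mem _
    | add a b _ _ ha hb => rw [map_add]; exact add_mem ha hb
    | smul c a _ ha => rw [map_smul]; exact Y.smul_mem c ha
  -- The induction hypothesis covers every `x`, because the commutator `⁅x, y⁆` acts on the shorter
  -- word. Hence neither `S` nor `B` has to be closed under brackets, and no PBW theorem enters.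
  have key : ∀ v, WordReach ρ S (X : Set V) v → ∀ x, ρ x v ∈ Y := by
    intro v hv
    induction hv with
    | base v hv =>
      intro x
      have hx : x ∈ Submodule.span ℂ (S ∪ B) := by rw [hSB]; trivial
      induction hx using Submodule.span_induction with
      | mem x hx =>
        rcases hx with hx | hx
        · exact hS x hx v (hXY hv)
        · exact hXY (hB x hx v hv)
      | zero => rw [map_zero]; exact zero_mem _
      | add a b _ _ ha hb => rw [map_add]; exact add_mem ha hb
      | smul c a _ ha => rw [map_smul]; exact Y.smul_mem c ha
    | step y v hy _ ih =>
      intro x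
      have h1 : ρ x (ρ y v) = ρ ⁅x, y⁆ v + ρ y (ρ x v) := by rw [rep_lie]; abel
      rw [h1]
      exact add_mem (ih _) (hS y hy _ (ih x))
  refine repSpan_le hXY fun x v hv => ?_
  induction hv using Submodule.span_induction with
  | mem v hv => exact key v hv x
  | zero => rw [map_zero]; exact zero_mem _
  | add a b _ _ ha hb => rw [map_add]; exact add_mem ha hb
  | smul c a _ ha => rw [map_smul]; exact Y.smul_mem c ha

variable {T : Type*} [AddCommGroup T] [Module ℂ T] {η : T →ₗ[ℂ] L}

theorem rep_mem_wt {β μ : Dual ℂ T} {x : L} (hx : ∀ h, ⁅η h, x⁆ = β h • x) {v : V}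
    (hv : v ∈ wt (ρ.toLinearMap ∘ₗ η) μ) : ρ x v ∈ wt (ρ.toLinearMap ∘ₗ η) (μ + β) := by
  intro h
  have h1 : ρ (η h) (ρ x v) = ρ ⁅η h, x⁆ v + ρ x (ρ (η h) v) := by rw [rep_lie]; abel
  have h2 : ρ (η h) v = μ h • v := hv h
  change ρ (η h) (ρ x v) = _
  rw [h1, hx, h2, map_smul, map_smul, LinearMap.smul_apply, LinearMap.add_apply, add_smul, add_comm]

/-- The weights strictly below `μ` with respect to a cone. -/
def below (C : AddSubmonoid (Dual ℂ T)) (μ : Dual ℂ T) : Set (Dual ℂ T) :=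
  {ν | μ - ν ∈ C ∧ ν ≠ μ}

/-- The structure of a representation generated by a space of vectors of weight `μ` that is stable
under a Borel subalgebra. -/
theorem repSpan_le_sup {C : AddSubmonoid (Dual ℂ T)} (hC : ∀ x ∈ C, -x ∈ C → x = 0)
    {S B : Set L} (hSB : Submodule.span ℂ (S ∪ B) = ⊤)
    (hS : ∀ x ∈ S, ∃ β ∈ C, β ≠ 0 ∧ ∀ h, ⁅η h, x⁆ = (-β) h • x)
    {X : Submodule ℂ V} (hB : ∀ x ∈ B, ∀ v ∈ X, ρ x v ∈ X) {μ : Dual ℂ T}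
    (hX : X ≤ wt (ρ.toLinearMap ∘ₗ η) μ) :
    repSpan ρ (X : Set V) ≤ X ⊔ wtSum (ρ.toLinearMap ∘ₗ η) (below C μ) := by
  refine (repSpan_le_wordSpan hSB hB).trans (Submodule.span_le.mpr ?_)
  have key : ∀ v, WordReach ρ S (X : Set V) v →
      v ∈ X ∨ ∃ ν ∈ below C μ, v ∈ wt (ρ.toLinearMap ∘ₗ η) ν := by
    intro v hv
    induction hv with
    | base v hv => exact Or.inl hv
    | step x v hx _ ih =>
      obtain ⟨β, hβ, hβ0, hβx⟩ := hS x hx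
      right
      rcases ih with hv | ⟨ν, ⟨hν, hνμ⟩, hv⟩
      · refine ⟨μ + -β, ⟨by simpa using hβ, by simpa using hβ0⟩, rep_mem_wt hβx (hX hv)⟩
      -- A weight strictly below `μ` cannot climb back to `μ` under a lowering operator, since the
      -- cone is pointed.
      · refine ⟨ν + -β, ⟨?_, fun h => hνμ ?_⟩, rep_mem_wt hβx hv⟩
        · have : μ - (ν + -β) = (μ - ν) + β := by abel
          rw [this]; exact add_mem hν hβ
        · have h1 : β = -(μ - ν) := by rw [← h]; abel
          have h2 := hC _ hν (h1 ▸ hβ)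
          exact (sub_eq_zero.mp h2).symm
  intro v hv
  rcases key v hv with hv | ⟨ν, hν, hv⟩
  · exact Submodule.mem_sup_left hv
  · exact Submodule.mem_sup_right (wt_le_wtSum hν hv)

end HighestWeight

/-! ### An `𝔰𝔩₂`-computation -/

section SlTwo

variable {V : Type*} [AddCommGroup V] [Module ℂ V]

theorem sl2_e_f_pow {h e f : Module.End ℂ V} (hef : e * f - f * e = h)
    (hhf : h * f - f * h = -(2 : ℂ) • f) {u : V} (he : e u = 0) {c : ℂ} (hh : h u = c • u) (k : ℕ) :
    h ((f ^ k) u) = (c - 2 * k) • (f ^ k) u ∧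
      e ((f ^ (k + 1)) u) = ((k + 1) * (c - k)) • (f ^ k) u := by
  have hef' : ∀ v, e (f v) = f (e v) + h v := fun v => by
    rw [← hef]; simp
  have hhf' : ∀ v, h (f v) = f (h v) - (2 : ℂ) • f v := fun v => by
    have := LinearMap.congr_fun hhf v
    simp only [LinearMap.sub_apply, Module.End.mul_apply, LinearMap.smul_apply] at this
    rw [sub_eq_iff_eq_add] at this
    rw [this, neg_smul]; abel
  induction k with
  | zero => simp [hef', he, hh]
  | succ k ih =>
    have h1 : h ((f ^ (k + 1)) u) = (c - 2 * (k + 1 : ℕ)) • (f ^ (k + 1)) u := by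
      rw [pow_succ', Module.End.mul_apply, hhf', ih.1, map_smul, ← sub_smul]
      congr 1; push_cast; ring
    refine ⟨h1, ?_⟩
    rw [pow_succ', Module.End.mul_apply, hef', ih.2, h1, map_smul, ← Module.End.mul_apply f,
      ← pow_succ', ← add_smul]
    congr 1; push_cast; ring

/-- Take the last `n` with `f ^ n u ≠ 0`. Applying `e` to `f ^ (n + 1) u = 0` gives `(n + 1) (c - n)
f ^ n u = 0`, so `c = n`. -/
theorem sl2_weight_nat {h e f : Module.End ℂ V} (hef : e * f - f * e = h)
    (hhf : h * f - f * h = -(2 : ℂ) • f) {u : V} (hu : u ≠ 0) (he : e u = 0) {c : ℂ}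
    (hh : h u = c • u) {K : ℕ} (hK : (f ^ K) u = 0) :
    ∃ n : ℕ, c = n ∧ (f ^ (n + 1)) u = 0 ∧ ∀ j ≤ n, (f ^ j) u ≠ 0 := by
  classical
  have hex : ∃ K, (f ^ K) u = 0 := ⟨K, hK⟩
  obtain ⟨n, hn⟩ : ∃ n, Nat.find hex = n + 1 := by
    refine Nat.exists_eq_succ_of_ne_zero fun h0 => hu ?_
    have := Nat.find_spec hex
    rwa [h0, pow_zero, Module.End.one_apply] at this
  have h1 : (f ^ (n + 1)) u = 0 := hn ▸ Nat.find_spec hex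
  have h2 : ∀ j ≤ n, (f ^ j) u ≠ 0 := fun j hj => Nat.find_min hex (by omega)
  refine ⟨n, ?_, h1, h2⟩
  have h3 := (sl2_e_f_pow hef hhf he hh n).2
  rw [h1, map_zero, eq_comm, smul_eq_zero_iff_left (h2 n le_rfl), mul_eq_zero] at h3
  rcases h3 with h3 | h3
  · exact absurd h3 (by exact_mod_cast n.succ_ne_zero)
  · exact sub_eq_zero.mp h3

end SlTwo
/-! ### Modules over enveloping algebras as representations -/

section ActU

variable (L : Type*) [LieRing L] [LieAlgebra ℂ L] (V : Type*) [AddCommGroup V] [Module ℂ V]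
  [Module (U L) V] [IsScalarTower ℂ (U L) V]

/-- The representation of `L` on a `U(L)`-module. -/
def actU : L →ₗ⁅ℂ⁆ Module.End ℂ V where
  toLinearMap := (Algebra.lsmul ℂ ℂ V).toLinearMap ∘ₗ (iota : L →ₗ⁅ℂ⁆ U L).toLinearMap
  map_lie' {x y} := by
    change Algebra.lsmul ℂ ℂ V (iota ⁅x, y⁆) = _
    rw [LieHom.map_lie, LieRing.of_associative_ring_bracket, map_sub, map_mul, map_mul]
    rfl

variable {L V}

theorem actU_apply (x : L) (v : V) : actU L V x v = (iota x : U L) • v := rfl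

theorem smul_mem_of_stable {N : Submodule ℂ V} (hN : ∀ x : L, ∀ v ∈ N, (iota x : U L) • v ∈ N)
    (u : U L) {v : V} (hv : v ∈ N) : u • v ∈ N := by
  induction u using U_induction generalizing v with
  | hC c => rw [algebraMap_smul]; exact N.smul_mem c hv
  | hi x => exact hN x v hv
  | hadd a b ha hb => rw [add_smul]; exact add_mem (ha hv) (hb hv)
  | hmul a b ha hb => rw [mul_smul]; exact ha (hb hv)

/-- A stable subspace as a `U(L)`-submodule. -/
def toUSub (N : Submodule ℂ V) (hN : ∀ x : L, ∀ v ∈ N, (iota x : U L) • v ∈ N) :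
    Submodule (U L) V where
  carrier := N
  zero_mem' := N.zero_mem
  add_mem' := N.add_mem
  smul_mem' := fun u _ hv => smul_mem_of_stable hN u hv

theorem eq_top_of_stable [IsSimpleModule (U L) V] {N : Submodule ℂ V}
    (hN : ∀ x : L, ∀ v ∈ N, (iota x : U L) • v ∈ N) {v : V} (hv : v ∈ N) (h0 : v ≠ 0) : N = ⊤ := by
  have h1 : toUSub N hN = ⊤ := (eq_bot_or_eq_top _).resolve_left fun h => h0 (by
    have : v ∈ toUSub N hN := hv
    rwa [h] at this)
  rw [eq_top_iff]
  intro w _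
  have : w ∈ toUSub N hN := by rw [h1]; trivial
  exact this

theorem span_le_repSpan (X : Set V) {v : V} (hv : v ∈ Submodule.span (U L) X) :
    v ∈ repSpan (actU L V) X := by
  have : Submodule.span (U L) X ≤
      toUSub (repSpan (actU L V) X) (fun x v hv => repSpan_stable X x hv) :=
    Submodule.span_le.mpr (subset_repSpan X)
  exact this hv

theorem repSpan_eq_top_of_simple [IsSimpleModule (U L) V] {X : Set V} {v : V} (hv : v ∈ X)
    (h0 : v ≠ 0) : repSpan (actU L V) X = ⊤ :=
  eq_top_of_stable (fun x _ hv => repSpan_stable X x hv) (subset_repSpan X hv) h0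

end ActU

/-! ### Comparison of irreducible highest weight modules -/

section Compare

variable {L : Type*} [LieRing L] [LieAlgebra ℂ L]
  {T : Type*} [AddCommGroup T] [Module ℂ T] {η : T →ₗ[ℂ] L}
  {V : Type*} [AddCommGroup V] [Module ℂ V] [Module (U L) V] [IsScalarTower ℂ (U L) V]
  {V' : Type*} [AddCommGroup V'] [Module ℂ V'] [Module (U L) V'] [IsScalarTower ℂ (U L) V']

/-- The submodule generated by `(v, v')` meets the weight `μ` only in the line through `(v, v')`. If
it contained a nonzero `(0, y)`, irreducibility of `V'` would put `(0, v')` in it, and this vector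
has weight `μ` but is not on that line. -/
theorem ker_snd_eq_zero {C : AddSubmonoid (Dual ℂ T)} (hC : ∀ x ∈ C, -x ∈ C → x = 0)
    {S B : Set L} (hSB : Submodule.span ℂ (S ∪ B) = ⊤)
    (hS : ∀ x ∈ S, ∃ β ∈ C, β ≠ 0 ∧ ∀ h, ⁅η h, x⁆ = (-β) h • x)
    [IsSimpleModule (U L) V'] {v : V} {v' : V'} (h0 : v ≠ 0) (h0' : v' ≠ 0) {μ : Dual ℂ T}
    (hv : v ∈ wt ((actU L V).toLinearMap ∘ₗ η) μ) (hv' : v' ∈ wt ((actU L V').toLinearMap ∘ₗ η) μ)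
    (hB : ∀ x ∈ B, ∃ c : ℂ, (iota x : U L) • v = c • v ∧ (iota x : U L) • v' = c • v')
    {y : V'} (hy : ((0, y) : V × V') ∈ Submodule.span (U L) {(v, v')}) : y = 0 := by
  by_contra hy0
  set X : Submodule ℂ (V × V') := Submodule.span ℂ {(v, v')} with hX
  let K : Submodule ℂ V' :=
    ((Submodule.span (U L) {(v, v')}).restrictScalars ℂ).comap (LinearMap.inr ℂ V V')
  have hK : K = ⊤ := eq_top_of_stable (L := L) (fun x w hw => by
    have h1 : ((0, w) : V × V') ∈ Submodule.span (U L) {(v, v')} := hw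
    have h2 := Submodule.smul_mem _ (iota x : U L) h1
    rw [Prod.smul_mk, smul_zero] at h2
    exact h2) (v := y) hy hy0
  have h1 : ((0, v') : V × V') ∈ Submodule.span (U L) {(v, v')} := by
    have : v' ∈ K := by rw [hK]; trivial
    exact this
  have hwt : ((v, v') : V × V') ∈ wt ((actU L (V × V')).toLinearMap ∘ₗ η) μ :=
    fun h => Prod.ext (hv h) (hv' h)
  have hwt' : ((0, v') : V × V') ∈ wt ((actU L (V × V')).toLinearMap ∘ₗ η) μ :=
    fun h => Prod.ext (by change (iota (η h) : U L) • (0 : V) = μ h • (0 : V); simp) (hv' h)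
  have hXwt : X ≤ wt ((actU L (V × V')).toLinearMap ∘ₗ η) μ := by
    rw [hX, Submodule.span_singleton_le_iff_mem]; exact hwt
  have h2 : ((0, v') : V × V') ∈ X ⊔ wtSum ((actU L (V × V')).toLinearMap ∘ₗ η) (below C μ) := by
    refine repSpan_le_sup (ρ := actU L (V × V')) hC hSB hS ?_ hXwt ?_
    · intro x hx w hw
      obtain ⟨c, hc, hc'⟩ := hB x hx
      obtain ⟨a, rfl⟩ := Submodule.mem_span_singleton.mp hw
      rw [map_smul]
      refine X.smul_mem a (Submodule.mem_span_singleton.mpr ⟨c, ?_⟩)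
      exact Prod.ext hc.symm hc'.symm
    · have h3 := span_le_repSpan (L := L) _ h1
      exact (repSpan_le (ρ := actU L (V × V')) (fun w hw => subset_repSpan _
        (Submodule.subset_span hw)) fun x w hw => repSpan_stable _ x hw) h3
  obtain ⟨x, hx, z, hz, hxz⟩ := Submodule.mem_sup.mp h2
  obtain ⟨a, rfl⟩ := Submodule.mem_span_singleton.mp hx
  have hzwt : z ∈ wt ((actU L (V × V')).toLinearMap ∘ₗ η) μ := by
    rw [eq_sub_of_add_eq' hxz]
    exact sub_mem hwt' (hXwt hx)
  have hz0 : z = 0 := by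
    by_contra hz0
    exact (mem_of_mem_wtSum hz hzwt hz0).2 rfl
  rw [hz0, add_zero, Prod.smul_mk, Prod.mk.injEq] at hxz
  rcases smul_eq_zero.mp hxz.1 with ha | ha
  · rw [ha, zero_smul] at hxz
    exact h0' (hxz.2.symm.trans (zero_smul ℂ v'))
  · exact h0 ha

/-- Used for both projections: the submodule generated by `(v, v')` is then the graph of an
isomorphism. -/
theorem span_fst_bijective {C : AddSubmonoid (Dual ℂ T)} (hC : ∀ x ∈ C, -x ∈ C → x = 0)
    {S B : Set L} (hSB : Submodule.span ℂ (S ∪ B) = ⊤)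
    (hS : ∀ x ∈ S, ∃ β ∈ C, β ≠ 0 ∧ ∀ h, ⁅η h, x⁆ = (-β) h • x)
    [IsSimpleModule (U L) V] [IsSimpleModule (U L) V'] {v : V} {v' : V'} (h0 : v ≠ 0)
    (h0' : v' ≠ 0) {μ : Dual ℂ T}
    (hv : v ∈ wt ((actU L V).toLinearMap ∘ₗ η) μ) (hv' : v' ∈ wt ((actU L V').toLinearMap ∘ₗ η) μ)
    (hB : ∀ x ∈ B, ∃ c : ℂ, (iota x : U L) • v = c • v ∧ (iota x : U L) • v' = c • v') :
    Function.Bijective ((LinearMap.fst (U L) V V').domRestrict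
      (Submodule.span (U L) {(v, v')})) := by
  constructor
  · rw [← LinearMap.ker_eq_bot, LinearMap.ker_eq_bot']
    rintro ⟨⟨x, y⟩, hxy⟩ h
    obtain rfl : x = 0 := h
    have := ker_snd_eq_zero hC hSB hS h0 h0' hv hv' hB hxy
    exact Subtype.ext (Prod.ext rfl this)
  · rw [← LinearMap.range_eq_top]
    refine (eq_bot_or_eq_top _).resolve_left fun h => h0 ?_
    rw [LinearMap.range_eq_bot] at h
    exact LinearMap.congr_fun h ⟨(v, v'), Submodule.mem_span_singleton_self _⟩

/-- Two irreducible highest weight modules with the same highest weight character are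
isomorphic. -/
theorem nonempty_equiv_of_highest_weight {C : AddSubmonoid (Dual ℂ T)}
    (hC : ∀ x ∈ C, -x ∈ C → x = 0)
    {S B : Set L} (hSB : Submodule.span ℂ (S ∪ B) = ⊤)
    (hS : ∀ x ∈ S, ∃ β ∈ C, β ≠ 0 ∧ ∀ h, ⁅η h, x⁆ = (-β) h • x)
    [IsSimpleModule (U L) V] [IsSimpleModule (U L) V'] {v : V} {v' : V'} (h0 : v ≠ 0)
    (h0' : v' ≠ 0) {μ : Dual ℂ T}
    (hv : v ∈ wt ((actU L V).toLinearMap ∘ₗ η) μ) (hv' : v' ∈ wt ((actU L V').toLinearMap ∘ₗ η) μ)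
    (hB : ∀ x ∈ B, ∃ c : ℂ, (iota x : U L) • v = c • v ∧ (iota x : U L) • v' = c • v') :
    Nonempty (V ≃ₗ[U L] V') := by
  let e1 := LinearEquiv.ofBijective _ (span_fst_bijective hC hSB hS h0 h0' hv hv' hB)
  let e2 := LinearEquiv.ofBijective _ (span_fst_bijective hC hSB hS h0' h0 hv' hv
    (fun x hx => (hB x hx).imp fun c hc => hc.symm))
  have h : (Submodule.span (U L) {(v, v')}).map
      (LinearEquiv.prodComm (U L) V V' : (V × V') →ₗ[U L] V' × V) =
      Submodule.span (U L) {(v', v)} := by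
    rw [Submodule.map_span, Set.image_singleton]; rfl
  let e3 := (LinearEquiv.prodComm (U L) V V').submoduleMap (Submodule.span (U L) {(v, v')})
  exact ⟨e1.symm.trans ((e3.trans (LinearEquiv.ofEq _ _ h)).trans e2)⟩

end Compare

/-! ### Schur's lemma in countable dimension -/

section Schur

open Polynomial in
/-- Schur's lemma for simple modules of countable dimension over `ℂ`. -/
theorem schur_countable {R M : Type*} [Ring R] [Algebra ℂ R] [AddCommGroup M] [Module ℂ M]
    [Module R M] [IsScalarTower ℂ R M] [IsSimpleModule R M]
    (hM : Module.rank ℂ M ≤ Cardinal.aleph0) (φ : Module.End R M) :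
    ∃ c : ℂ, ∀ m, φ m = c • m := by
  classical
  by_contra! hc
  let ψ : ℂ → Module.End R M := fun c => φ - algebraMap ℂ (Module.End R M) c
  have hψ : ∀ c, Function.Bijective (ψ c) := fun c => LinearMap.bijective_of_ne_zero fun h => by
    obtain ⟨m, hm⟩ := hc c
    exact hm (sub_eq_zero.mp (LinearMap.congr_fun h m))
  have := IsSimpleModule.nontrivial R M
  obtain ⟨v, hv⟩ := exists_ne (0 : M)
  -- Dixmier's argument: without an eigenvalue every `φ - c` is invertible, and the vectors `(φ -
  -- c)⁻¹ v` form a linearly independent family indexed by the uncountable field `ℂ`.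
  choose w hw using fun c => (hψ c).2 v
  have hinj : ∀ p : ℂ[X], p ≠ 0 → Function.Injective (aeval φ p) := by
    intro p hp
    rw [(IsAlgClosed.splits p).eq_prod_roots, map_mul, aeval_C]
    have h1 : Function.Injective (algebraMap ℂ (Module.End R M) p.leadingCoeff) := by
      intro x y hxy
      have : p.leadingCoeff • x = p.leadingCoeff • y := hxy
      exact smul_right_injective M (leadingCoeff_ne_zero.mpr hp) this
    refine h1.comp ?_
    induction p.roots using Multiset.induction_on with
    | empty =>
      rw [Multiset.map_zero, Multiset.prod_zero, map_one]
      exact Function.injective_id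
    | cons a s ih =>
      rw [Multiset.map_cons, Multiset.prod_cons, map_mul, map_sub, aeval_X, aeval_C]
      exact (hψ a).1.comp ih
  have hli : LinearIndependent ℂ w := by
    refine linearIndependent_iff'.2 fun s m hm i hi => ?_
    -- Clearing denominators in `∑ m i • (φ - i)⁻¹ v = 0` gives `p(φ) v = 0`. Nonzero polynomials in
    -- `φ` are injective, so `p = 0`; its value at `i` is `m i` times a nonzero product.
    let p : ℂ[X] := ∑ i ∈ s, C (m i) * ∏ j ∈ s.erase i, (X - C j)
    have h1 : aeval φ p v = 0 := by
      have h2 : aeval φ (∏ j ∈ s, (X - C j)) (∑ i ∈ s, m i • w i) = 0 := by rw [hm, map_zero]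
      rw [← h2, map_sum, map_sum, LinearMap.sum_apply]
      refine Finset.sum_congr rfl fun i hi => ?_
      have h3 : aeval φ (∏ j ∈ s, (X - C j)) (w i) = aeval φ (∏ j ∈ s.erase i, (X - C j)) v := by
        rw [← Finset.prod_erase_mul _ _ hi, map_mul, map_sub, aeval_X, aeval_C, ← hw i]
        rfl
      rw [map_mul, aeval_C]
      have h4 : aeval φ (∏ j ∈ s, (X - C j)) (m i • w i) =
          m i • aeval φ (∏ j ∈ s, (X - C j)) (w i) := LinearMap.map_smul_of_tower _ _ _
      rw [h4, h3]
      rfl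
    have hp : p = 0 := by
      by_contra hp
      exact hv (hinj p hp (by rw [h1, map_zero]))
    have h5 := congrArg (eval i) hp
    rw [eval_zero, eval_finsetSum, Finset.sum_eq_single i] at h5
    · rw [eval_mul, eval_C, eval_prod] at h5
      refine (mul_eq_zero.mp h5).resolve_right (Finset.prod_ne_zero_iff.2 fun j hj => ?_)
      rw [eval_sub, eval_X, eval_C]
      exact sub_ne_zero.2 (Finset.ne_of_mem_erase hj).symm
    · intro j hj hji
      rw [eval_mul, eval_prod, Finset.prod_eq_zero (Finset.mem_erase.mpr ⟨hji.symm, hi⟩) (by simp),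
        mul_zero]
    · exact fun h => absurd hi h
  have h6 := hli.cardinal_lift_le_rank
  rw [Cardinal.mk_complex, Cardinal.lift_continuum] at h6
  have h7 : Cardinal.lift.{0} (Module.rank ℂ M) ≤ Cardinal.aleph0 := by
    rw [Cardinal.lift_le_aleph0]; exact hM
  exact absurd (h6.trans h7) (not_le.mpr Cardinal.aleph0_lt_continuum)

theorem rank_le_of_simple {R M : Type*} [Ring R] [Algebra ℂ R] [AddCommGroup M] [Module ℂ M]
    [Module R M] [IsScalarTower ℂ R M] [IsSimpleModule R M]
    (hR : ∃ s : Set R, s.Countable ∧ Submodule.span ℂ s = ⊤) :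
    Module.rank ℂ M ≤ Cardinal.aleph0 := by
  obtain ⟨s, hs, hspan⟩ := hR
  have := IsSimpleModule.nontrivial R M
  obtain ⟨v, hv⟩ := exists_ne (0 : M)
  let f : R →ₗ[ℂ] M := (LinearMap.toSpanSingleton R M v).restrictScalars ℂ
  have hf : Function.Surjective f := IsSimpleModule.toSpanSingleton_surjective R hv
  have h1 : Submodule.span ℂ (f '' s) = ⊤ := by
    rw [Submodule.span_image, hspan, Submodule.map_top, LinearMap.range_eq_top.mpr hf]
  rw [← rank_top, ← h1]
  exact (rank_span_le _).trans (Cardinal.le_aleph0_iff_set_countable.mpr (hs.image f))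

/-- An enveloping algebra of a Lie algebra of countable dimension has countable dimension. -/
theorem countable_span_U {L : Type*} [LieRing L] [LieAlgebra ℂ L]
    (hL : ∃ s : Set L, s.Countable ∧ Submodule.span ℂ s = ⊤) :
    ∃ s : Set (U L), s.Countable ∧ Submodule.span ℂ s = ⊤ := by
  obtain ⟨s, hs, hspan⟩ := hL
  refine ⟨Submonoid.closure ((iota : L →ₗ⁅ℂ⁆ U L) '' s), ?_, ?_⟩
  · have : Countable s := hs
    have : Countable ((iota : L →ₗ⁅ℂ⁆ U L) '' s) := (hs.image _)
    rw [Submonoid.closure_eq_mrange, MonoidHom.coe_mrange]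
    have : Countable (FreeMonoid ((iota : L →ₗ⁅ℂ⁆ U L) '' s)) :=
      inferInstanceAs (Countable (List ((iota : L →ₗ⁅ℂ⁆ U L) '' s)))
    exact Set.countable_range _
  · rw [← Algebra.adjoin_eq_span, Algebra.toSubmodule_eq_top, eq_top_iff]
    intro u _
    induction u using U_induction with
    | hC c => exact Subalgebra.algebraMap_mem _ c
    | hi x =>
      have hx : x ∈ Submodule.span ℂ s := by rw [hspan]; trivial
      induction hx using Submodule.span_induction with
      | mem x hx => exact Algebra.subset_adjoin ⟨x, hx, rfl⟩
      | zero => rw [map_zero]; exact zero_mem _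
      | add a b _ _ ha hb => rw [map_add]; exact add_mem (ha trivial) (hb trivial)
      | smul c a _ ha => rw [map_smul]; exact Subalgebra.smul_mem _ (ha trivial) c
    | hadd a b ha hb => exact add_mem (ha trivial) (hb trivial)
    | hmul a b ha hb => exact mul_mem (ha trivial) (hb trivial)

/-- Burnside's theorem. -/
theorem burnside {R M : Type*} [Ring R] [Algebra ℂ R] [AddCommGroup M] [Module ℂ M]
    [Module R M] [IsScalarTower ℂ R M] [IsSimpleModule R M] [FiniteDimensional ℂ M]
    (f : Module.End ℂ M) : ∃ r : R, ∀ m, f m = r • m := by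
  classical
  have hrank : Module.rank ℂ M ≤ Cardinal.aleph0 := (Module.rank_lt_aleph0 ℂ M).le
  -- By Schur's lemma the `R`-endomorphisms of `M` are scalars, so every `ℂ`-linear map commutes
  -- with them and Jacobson density applies to it.
  let F : Module.End (Module.End R M) M :=
    { toFun := f
      map_add' := map_add f
      map_smul' := fun φ m => by
        obtain ⟨c, hc⟩ := schur_countable hrank φ
        change f (φ m) = φ (f m)
        rw [hc, hc, map_smul] }
  obtain ⟨s, hs⟩ := (Module.finite_def (R := ℂ) (M := M)).mp inferInstance
  obtain ⟨r, hr⟩ := jacobson_density F s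
  refine ⟨r, fun m => ?_⟩
  have hm : m ∈ Submodule.span ℂ (s : Set M) := by rw [hs]; trivial
  induction hm using Submodule.span_induction with
  | mem m hm => exact hr m hm
  | zero => rw [map_zero, smul_zero]
  | add a b _ _ ha hb => rw [map_add, smul_add, ha, hb]
  | smul c a _ ha => rw [map_smul, ha, smul_comm]

end Schur
/-! ### Evaluation at maximal ideals -/

section Evaluate

variable {A : Type u} [CommRing A] [Algebra ℂ A] [Algebra.FiniteType ℂ A]

theorem ev_eq_zero_iff (S : MaximalSpectrum A) (a : A) : ev S a = 0 ↔ a ∈ S.asIdeal := by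
  change (AlgEquiv.ofBijective (Algebra.ofId ℂ (A ⧸ S.asIdeal)) (residue_bijective S)).symm
    (Ideal.Quotient.mk S.asIdeal a) = 0 ↔ _
  rw [map_eq_zero_iff _ (AlgEquiv.injective _), Ideal.Quotient.eq_zero_iff_mem]

/-- The Chinese remainder theorem for distinct points, obtained by multiplying elements that
separate `S` from one other point at a time. The point `S` itself may belong to `s`. -/
theorem exists_ev_eq (s : Finset (MaximalSpectrum A)) (S : MaximalSpectrum A) :
    ∃ a : A, ev S a = 1 ∧ ∀ S' ∈ s, S' ≠ S → ev S' a = 0 := by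
  classical
  have h1 : ∀ S', S' ≠ S → ∃ b : A, ev S b = 1 ∧ ev S' b = 0 := by
    intro S' hS'
    obtain ⟨c, hc, hc'⟩ : ∃ c ∈ S'.asIdeal, c ∉ S.asIdeal := by
      by_contra! hle
      exact hS' (MaximalSpectrum.ext (S'.isMaximal.eq_of_le S.isMaximal.ne_top hle))
    rw [← ev_eq_zero_iff] at hc hc'
    refine ⟨(ev S c)⁻¹ • c, ?_, ?_⟩
    · rw [map_smul, smul_eq_mul, inv_mul_cancel₀ hc']
    · rw [map_smul, hc, smul_zero]
  choose! b hb hb' using h1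
  refine ⟨∏ S' ∈ s.erase S, b S', ?_, fun S' hS' hne => ?_⟩
  · rw [map_prod]
    exact Finset.prod_eq_one fun S' hS' => hb S' (Finset.ne_of_mem_erase hS')
  · rw [map_prod]
    exact Finset.prod_eq_zero (Finset.mem_erase.mpr ⟨hne, hS'⟩) (hb' S' hne)

end Evaluate

/-! ### Highest weights for `𝔰𝔩₂ ⊗ A` -/

section CurrentSlTwo

variable {A : Type u} [CommRing A] [Algebra ℂ A]
  {V : Type*} [AddCommGroup V] [Module ℂ V]

/-- Operators satisfying the relations of `𝔰𝔩₂ ⊗ A` and a highest weight vector on which `f ⊗ 1` is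
nilpotent. -/
structure CurrentSl2 (e f h : A →ₗ[ℂ] Module.End ℂ V) (v : V) (φ : A →ₗ[ℂ] ℂ) (n : ℕ) : Prop where
  ef : ∀ a b u, e a (f b u) = f b (e a u) + h (a * b) u
  hf : ∀ a b u, h a (f b u) = f b (h a u) - (2 : ℂ) • f (a * b) u
  ff : ∀ a b u, f a (f b u) = f b (f a u)
  ne_zero : v ≠ 0
  ev : ∀ a, e a v = 0
  hv : ∀ a, h a v = φ a • v
  pow : (f 1 ^ (n + 1)) v = 0

namespace CurrentSl2

/-- Monomials in the operators `f a`. -/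
def mono (f : A →ₗ[ℂ] Module.End ℂ V) (l : List A) (w : V) : V := l.foldr (fun a u => f a u) w

@[simp] theorem mono_nil (f : A →ₗ[ℂ] Module.End ℂ V) (w : V) : mono f [] w = w := rfl

@[simp] theorem mono_cons (f : A →ₗ[ℂ] Module.End ℂ V) (a : A) (l : List A) (w : V) :
    mono f (a :: l) w = f a (mono f l w) := rfl

theorem mono_concat (f : A →ₗ[ℂ] Module.End ℂ V) (a : A) (l : List A) (w : V) :
    mono f (l ++ [a]) w = mono f l (f a w) := by
  simp [mono]

theorem mono_map (f : A →ₗ[ℂ] Module.End ℂ V) (l : List A) : ∃ g : Module.End ℂ V,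
    ∀ w, mono f l w = g w := by
  induction l with
  | nil => exact ⟨1, fun w => rfl⟩
  | cons a l ih =>
    obtain ⟨g, hg⟩ := ih
    exact ⟨f a * g, fun w => by rw [mono_cons, hg]; rfl⟩

theorem mono_replicate (f : A →ₗ[ℂ] Module.End ℂ V) (k : ℕ) (a : A) (w : V) :
    mono f (List.replicate k a) w = (f a ^ k) w := by
  induction k with
  | zero => simp
  | succ k ih => rw [List.replicate_succ, mono_cons, ih, pow_succ', Module.End.mul_apply]

variable {e f h : A →ₗ[ℂ] Module.End ℂ V} {v : V} {φ : A →ₗ[ℂ] ℂ} {n : ℕ}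
  (t : CurrentSl2 e f h v φ n)

include t

theorem f_pow_comm (a b : A) (k : ℕ) (u : V) : (f a ^ k) (f b u) = f b ((f a ^ k) u) := by
  induction k generalizing u with
  | zero => simp
  | succ k ih => rw [pow_succ, Module.End.mul_apply, Module.End.mul_apply, t.ff a b, ih]

theorem h_f_pow (a c : A) (k : ℕ) :
    h c ((f a ^ k) v) = φ c • (f a ^ k) v - (2 * k : ℂ) • f (c * a) ((f a ^ (k - 1)) v) := by
  induction k with
  | zero => simp [t.hv]
  | succ k ih =>
    rw [pow_succ', Module.End.mul_apply, t.hf, ih, map_sub, map_smul, map_smul, t.ff a (c * a),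
      Nat.add_sub_cancel]
    rcases k with _ | k
    · simp
    · rw [Nat.add_sub_cancel, ← Module.End.mul_apply (f a) (f a ^ k), ← pow_succ']
      push_cast
      module

/-- In the last term the truncated exponent `k - 1` is harmless, as its coefficient vanishes at `k =
0`. The formula is applied at the top nonzero power of `f a`, where the left side is zero. -/
theorem e_f_pow (a b : A) (k : ℕ) :
    e b ((f a ^ (k + 1)) v) = ((k + 1) * φ (a * b) : ℂ) • (f a ^ k) v -
      (k * (k + 1) : ℂ) • f (a * a * b) ((f a ^ (k - 1)) v) := by
  induction k with
  | zero => simp [t.ef, t.ev, t.hv, mul_comm]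
  | succ k ih =>
    rw [pow_succ', Module.End.mul_apply, t.ef, ih, t.h_f_pow, map_sub, map_smul, map_smul,
      t.ff a (a * a * b), ← Module.End.mul_apply (f a) (f a ^ k), ← pow_succ',
      show b * a = a * b from mul_comm _ _, show a * b * a = a * a * b by ring,
      Nat.add_sub_cancel]
    rcases k with _ | k
    · push_cast
      simp only [pow_zero]
      module
    · rw [Nat.add_sub_cancel, ← Module.End.mul_apply (f a) (f a ^ k), ← pow_succ']
      push_cast
      module

/-- Moving `h c` through a monomial multiplies one entry at a time by `c`, so the error terms have
the same number of factors. -/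
theorem h_mono (c : A) (l : List A) (w : V) :
    h c (mono f l w) - mono f l (h c w) ∈
      Submodule.span ℂ {u | ∃ l' : List A, l'.length = l.length ∧ u = mono f l' w} := by
  induction l with
  | nil => simp
  | cons a l ih =>
    have h1 : h c (mono f (a :: l) w) - mono f (a :: l) (h c w) =
        f a (h c (mono f l w) - mono f l (h c w)) - (2 : ℂ) • mono f (c * a :: l) w := by
      rw [mono_cons, mono_cons, t.hf, map_sub, mono_cons]; abel
    rw [h1]
    refine sub_mem ?_ (Submodule.smul_mem _ _ (Submodule.subset_span ⟨_, by simp, rfl⟩))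
    have h2 : Submodule.span ℂ {u | ∃ l' : List A, l'.length = l.length ∧ u = mono f l' w} ≤
        (Submodule.span ℂ {u | ∃ l' : List A, l'.length = (a :: l).length ∧
          u = mono f l' w}).comap (f a) := by
      refine Submodule.span_le.mpr ?_
      rintro _ ⟨l', hl', rfl⟩
      exact Submodule.subset_span ⟨a :: l', by simp [hl'], rfl⟩
    exact h2 ih

/-- Polarization of `f 1 ^ (n + 1) v = 0`: the factors `f 1` are replaced one at a time. Applying `h
b` to a vanishing monomial with `m + 1` factors `f 1` gives other such monomials, zero by induction,
and `-2 (m + 1)` times the monomial in which one `f 1` has become `f b`. -/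
theorem mono_eq_zero (j : ℕ) (hj : j ≤ n + 1) (l : List A) (hl : l.length = j) :
    mono f l ((f 1 ^ (n + 1 - j)) v) = 0 := by
  induction j generalizing l with
  | zero =>
    rw [List.length_eq_zero_iff] at hl
    subst hl
    exact t.pow
  | succ j ih =>
    obtain ⟨l, b, rfl⟩ : ∃ l' b, l = l' ++ [b] := by
      rcases List.eq_nil_or_concat l with rfl | ⟨l', b, h⟩
      · simp at hl
      · exact ⟨l', b, by simpa using h⟩
    have hl' : l.length = j := by simpa using hl
    obtain ⟨m, hm⟩ : ∃ m, n + 1 - j = m + 1 := ⟨n - j, by omega⟩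
    have hm' : n + 1 - (j + 1) = m := by omega
    rw [hm'] at *
    rw [hm] at ih
    have h1 := t.h_mono b l ((f 1 ^ (m + 1)) v)
    have h2 : Submodule.span ℂ {u | ∃ l' : List A, l'.length = l.length ∧
        u = mono f l' ((f 1 ^ (m + 1)) v)} = ⊥ := by
      rw [Submodule.span_eq_bot]
      rintro _ ⟨l', hl'', rfl⟩
      exact ih (by omega) l' (hl''.trans hl')
    rw [h2, Submodule.mem_bot, ih (by omega) l hl', map_zero, zero_sub, neg_eq_zero, t.h_f_pow,
      mul_one, Nat.add_sub_cancel] at h1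
    obtain ⟨g, hg⟩ := mono_map f l
    rw [mono_concat]
    have h3 := ih (by omega) l hl'
    rw [hg] at h1 h3 ⊢
    rw [map_sub, map_smul, map_smul, h3, smul_zero, zero_sub, neg_eq_zero] at h1
    refine (smul_eq_zero.mp h1).resolve_left ?_
    norm_cast

theorem f_pow_eq_zero (a : A) : (f a ^ (n + 1)) v = 0 := by
  have := t.mono_eq_zero (n + 1) le_rfl (List.replicate (n + 1) a) (by simp)
  rwa [mono_replicate, Nat.sub_self, pow_zero, Module.End.one_apply] at this

omit t in
variable (f v) in
/-- Monomials in the operators `f (x ^ i)`, with a record of the coefficients in top degree. -/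
def topSpan (x : A) (k D : ℕ) : Submodule ℂ (V × ℂ) :=
  Submodule.span ℂ ({p | ∃ l : List ℕ, l.length = k ∧ l.sum = D ∧
      p = (mono f (l.map (x ^ ·)) v, 1)} ∪
    {p | ∃ l : List ℕ, l.length = k ∧ l.sum < D ∧ p = (mono f (l.map (x ^ ·)) v, 0)})

omit t in
theorem topSpan_low {x : A} {k D D' : ℕ} (hD : D < D') {y : V} {c : ℂ}
    (hy : (y, c) ∈ topSpan f v x k D) : (y, 0) ∈ topSpan f v x k D' := by
  have : topSpan f v x k D ≤
      (topSpan f v x k D').comap (LinearMap.inl ℂ V ℂ ∘ₗ LinearMap.fst ℂ V ℂ) := by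
    refine Submodule.span_le.mpr ?_
    rintro _ (⟨l, hl, hs, rfl⟩ | ⟨l, hl, hs, rfl⟩)
    · exact Submodule.subset_span (Or.inr ⟨l, hl, by omega, rfl⟩)
    · exact Submodule.subset_span (Or.inr ⟨l, hl, by omega, rfl⟩)
  exact this hy

omit t in
theorem topSpan_f {x : A} {k D : ℕ} (i : ℕ) {y : V} {c : ℂ}
    (hy : (y, c) ∈ topSpan f v x k D) : (f (x ^ i) y, c) ∈ topSpan f v x (k + 1) (D + i) := by
  have : topSpan f v x k D ≤
      (topSpan f v x (k + 1) (D + i)).comap ((f (x ^ i)).prodMap LinearMap.id) := by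
    refine Submodule.span_le.mpr ?_
    rintro _ (⟨l, hl, hs, rfl⟩ | ⟨l, hl, hs, rfl⟩)
    · exact Submodule.subset_span (Or.inl ⟨i :: l, by simp [hl], by simp [hs, add_comm], rfl⟩)
    · exact Submodule.subset_span (Or.inr ⟨i :: l, by simp [hl], by simp; omega, rfl⟩)
  exact this hy

/-- Each of the factors contributes `-2` times a monomial of total degree raised by `p`. The term
coming from `φ (x ^ p)` keeps the old degree, which is strictly lower because `p ≥ 1`, and so does
not count. -/
theorem topSpan_h (x : A) {p : ℕ} (hp : 1 ≤ p) (l : List ℕ) :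
    (h (x ^ p) (mono f (l.map (x ^ ·)) v), (-2 * l.length : ℂ)) ∈
      topSpan f v x l.length (l.sum + p) := by
  induction l with
  | nil =>
    have h1 : ((v, 0) : V × ℂ) ∈ topSpan f v x 0 p :=
      Submodule.subset_span (Or.inr ⟨[], rfl, by simpa using Nat.lt_of_lt_of_le one_pos hp, rfl⟩)
    have h2 := (topSpan f v x 0 p).smul_mem (φ (x ^ p)) h1
    simpa [t.hv] using h2
  | cons i l ih =>
    have h1 := topSpan_f i ih
    have h2 : (mono f (((p + i) :: l).map (x ^ ·)) v, 1) ∈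
        topSpan f v x (l.length + 1) (l.sum + p + i) :=
      Submodule.subset_span (Or.inl ⟨(p + i) :: l, rfl, by simp; ring, rfl⟩)
    have h3 := add_mem h1 (Submodule.smul_mem _ (-2 : ℂ) h2)
    have h4 : l.sum + p + i = (i :: l).sum + p := by simp; ring
    rw [h4] at h3
    change _ ∈ topSpan f v x (l.length + 1) _
    convert h3 using 1
    refine Prod.ext ?_ ?_
    · simp only [List.map_cons, mono_cons, Prod.fst_add, Prod.smul_fst]
      rw [t.hf, pow_add, sub_eq_add_neg, neg_smul]
    · simp; ring

/-- When `e x` meets a factor it turns it into some `h`, which contributes `-2` for every factor to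
its right. Summing over the `k` factors gives `-2 (0 + 1 + ⋯ + (k - 1)) = -k (k - 1)`. -/
theorem topSpan_e_mono (x : A) (l : List ℕ) :
    (e x (mono f (l.map (x ^ ·)) v), (-(l.length * (l.length - 1)) : ℂ)) ∈
      topSpan f v x (l.length - 1) (l.sum + 1) := by
  induction l with
  | nil =>
    have : ((0, 0) : V × ℂ) ∈ topSpan f v x 0 1 := zero_mem _
    simpa [t.ev] using this
  | cons i l ih =>
    have h1 := t.topSpan_h x (p := i + 1) (by omega) l
    have h2 : e x (mono f ((i :: l).map (x ^ ·)) v) =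
        f (x ^ i) (e x (mono f (l.map (x ^ ·)) v)) + h (x ^ (i + 1)) (mono f (l.map (x ^ ·)) v) := by
      rw [List.map_cons, mono_cons, t.ef, ← pow_succ']
    have h3 : l.sum + (i + 1) = (i :: l).sum + 1 := by simp; ring
    rw [h2]
    rw [h3] at h1
    rcases l with _ | ⟨j, l⟩
    · simpa [t.ev] using h1
    · have h4 := topSpan_f i ih
      have h5 : (j :: l).sum + 1 + i = (i :: j :: l).sum + 1 := by simp; ring
      rw [h5] at h4
      have h6 := add_mem h4 h1
      rw [List.length_cons, Nat.add_sub_cancel] at h6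
      change _ ∈ topSpan f v x (l.length + 1) _
      convert h6 using 1
      refine Prod.ext rfl ?_
      simp
      ring

theorem topSpan_e {x : A} {k D : ℕ} {y : V} {c : ℂ} (hy : (y, c) ∈ topSpan f v x k D) :
    (e x y, (-(k * (k - 1)) * c : ℂ)) ∈ topSpan f v x (k - 1) (D + 1) := by
  have : topSpan f v x k D ≤ (topSpan f v x (k - 1) (D + 1)).comap
      ((e x).prodMap (LinearMap.lsmul ℂ ℂ (-(k * (k - 1)) : ℂ))) := by
    refine Submodule.span_le.mpr ?_
    rintro _ (⟨l, hl, hs, rfl⟩ | ⟨l, hl, hs, rfl⟩)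
    · have := t.topSpan_e_mono x l
      rw [hl, hs] at this
      simpa using this
    · have := t.topSpan_e_mono x l
      rw [hl] at this
      have h2 := topSpan_low (D' := D + 1) (by omega) this
      simpa using h2
  exact this hy

/-- Starting from `f 1 ^ (n + 1) v = 0`, with top coefficient `1`, each application of `e x` removes
one factor and raises the total degree by one. The top coefficient is multiplied by `-k (k - 1)`
with `k ≥ 2`, hence stays nonzero. -/
theorem exists_top_mem (x : A) (j : ℕ) (hj : j ≤ n) :
    ∃ c : ℂ, c ≠ 0 ∧ ((0, c) : V × ℂ) ∈ topSpan f v x (n + 1 - j) j := by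
  induction j with
  | zero =>
    refine ⟨1, one_ne_zero, Submodule.subset_span (Or.inl ⟨List.replicate (n + 1) 0, by simp,
      by simp, ?_⟩)⟩
    rw [List.map_replicate, mono_replicate, pow_zero, t.pow]
  | succ j ih =>
    obtain ⟨c, hc, hm⟩ := ih (by omega)
    have h1 := t.topSpan_e hm
    rw [map_zero] at h1
    refine ⟨_, ?_, h1⟩
    obtain ⟨m, hm⟩ : ∃ m, n + 1 - j = m + 2 := ⟨n - 1 - j, by omega⟩
    rw [hm]
    refine mul_ne_zero (neg_ne_zero.mpr (mul_ne_zero ?_ ?_)) hc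
    · norm_cast
    · push_cast
      rw [add_sub_assoc]
      norm_num
      norm_cast

-- After `n` applications of `e x` one factor is left, in top degree `n`: some nonzero multiple of
-- `f (x ^ n) v` is a combination of the `f (x ^ i) v` with `i < n`.
open Polynomial in
theorem exists_monic (x : A) : ∃ p : ℂ[X], p.Monic ∧ f (aeval x p) v = 0 := by
  obtain ⟨c, hc, hm⟩ := t.exists_top_mem x n le_rfl
  rw [Nat.add_sub_cancel_left] at hm
  let P : Submodule ℂ V := Submodule.span ℂ (Set.range fun j : Fin n => f (x ^ (j : ℕ)) v)
  have h1 : topSpan f v x 1 n ≤ P.comap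
      (LinearMap.fst ℂ V ℂ - (LinearMap.toSpanSingleton ℂ V (f (x ^ n) v)) ∘ₗ
        LinearMap.snd ℂ V ℂ) := by
    refine Submodule.span_le.mpr ?_
    rintro _ (⟨l, hl, hs, rfl⟩ | ⟨l, hl, hs, rfl⟩)
    · obtain ⟨i, rfl⟩ := List.length_eq_one_iff.mp hl
      obtain rfl : i = n := by simpa using hs
      simp
    · obtain ⟨i, rfl⟩ := List.length_eq_one_iff.mp hl
      have hi : i < n := by simpa using hs
      have h2 : f (x ^ i) v ∈ P := Submodule.subset_span ⟨⟨i, hi⟩, rfl⟩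
      simpa using h2
  have h2 : (0 : V) - c • f (x ^ n) v ∈ P := h1 hm
  rw [zero_sub, neg_mem_iff, P.smul_mem_iff hc, Submodule.mem_span_range_iff_exists_fun] at h2
  obtain ⟨a, ha⟩ := h2
  refine ⟨X ^ n - ∑ j : Fin n, C (a j) * X ^ (j : ℕ), monic_X_pow_sub ?_, ?_⟩
  · rcases n with _ | n
    · simp
    · refine (degree_sum_le _ _).trans_lt ?_
      rw [Finset.sup_lt_iff (WithBot.bot_lt_coe _)]
      intro j _
      exact (degree_C_mul_X_pow_le _ _).trans_lt (by exact_mod_cast j.2)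
  · have h3 : aeval x (∑ j : Fin n, C (a j) * X ^ (j : ℕ)) = ∑ j : Fin n, a j • x ^ (j : ℕ) := by
      rw [map_sum]
      refine Finset.sum_congr rfl fun j _ => ?_
      rw [map_mul, aeval_C, map_pow, aeval_X, Algebra.smul_def]
    rw [map_sub, h3, map_sub, map_sum, LinearMap.sub_apply, LinearMap.sum_apply, map_pow, aeval_X,
      ← ha, sub_eq_zero]
    refine Finset.sum_congr rfl fun j _ => ?_
    rw [map_smul, LinearMap.smul_apply]

omit t in
/-- The annihilator of the highest weight vector in the algebra of operators `f a`. -/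
def annF (t : CurrentSl2 e f h v φ n) : Ideal A where
  carrier := {a | f a v = 0}
  zero_mem' := by simp
  add_mem' := fun {a b} ha hb => by
    have ha' : f a v = 0 := ha
    have hb' : f b v = 0 := hb
    change f (a + b) v = 0
    rw [map_add, LinearMap.add_apply, ha', hb', add_zero]
  smul_mem' := fun b a ha => by
    have ha' : f a v = 0 := ha
    have h1 := t.hf b a v
    rw [ha', t.hv, map_zero, map_smul, ha', smul_zero, zero_sub, zero_eq_neg] at h1
    exact (smul_eq_zero.mp h1).resolve_left two_ne_zero

theorem mem_annF {a : A} : a ∈ t.annF ↔ f a v = 0 := Iff.rfl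

theorem φ_eq_zero {a : A} (ha : a ∈ t.annF) : φ a = 0 := by
  have h1 := t.ef 1 a v
  rw [t.mem_annF.mp ha, t.ev, map_zero, map_zero, zero_add, one_mul, t.hv] at h1
  exact (smul_eq_zero.mp h1.symm).resolve_right t.ne_zero

theorem finite_quotient [Algebra.FiniteType ℂ A] : Module.Finite ℂ (A ⧸ t.annF) := by
  have : Algebra.IsIntegral ℂ (A ⧸ t.annF) := ⟨fun x => by
    obtain ⟨x, rfl⟩ := Ideal.Quotient.mk_surjective x
    obtain ⟨p, hp, h0⟩ := t.exists_monic x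
    refine ⟨p, hp, ?_⟩
    have h1 : Polynomial.aeval (Ideal.Quotient.mkₐ ℂ t.annF x) p = 0 := by
      rw [Polynomial.aeval_algHom_apply]
      exact Ideal.Quotient.eq_zero_iff_mem.mpr h0
    exact h1⟩
  exact Algebra.IsIntegral.finite

theorem exists_f_pow (a : A) : ∃ K, (f a ^ (K + 1)) v = 0 ∧ (f a ^ K) v ≠ 0 := by
  classical
  have hex : ∃ K, (f a ^ K) v = 0 := ⟨_, t.f_pow_eq_zero a⟩
  obtain ⟨m, hm⟩ : ∃ m, Nat.find hex = m + 1 := by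
    refine Nat.exists_eq_succ_of_ne_zero fun h0 => t.ne_zero ?_
    have := Nat.find_spec hex
    rwa [h0, pow_zero, Module.End.one_apply] at this
  exact ⟨m, hm ▸ Nat.find_spec hex, Nat.find_min hex (by omega)⟩

/-- If `f (a * a) v = 0`, then at the top nonzero power of `f a` the formula for `e b` leaves only
`(K + 1) φ (a * b) = 0`. So `φ` vanishes on all multiples of `a`, and the nondegeneracy hypothesis
`nd` gives `f a v = 0`. -/
theorem annF_isRadical (nd : ∀ c, (∀ b, φ (c * b) = 0) → f c v = 0) : t.annF.IsRadical := by
  rw [Ideal.isRadical_iff_pow_one_lt 2 (by norm_num)]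
  intro a ha
  refine nd a fun b => ?_
  obtain ⟨K, hK, hK0⟩ := t.exists_f_pow a
  have h1 := t.e_f_pow a b K
  have h2 : f (a * a * b) v = 0 := t.annF.mul_mem_right b (by rwa [← sq])
  rw [hK, map_zero, ← t.f_pow_comm, h2, map_zero, smul_zero, sub_zero, eq_comm,
    smul_eq_zero_iff_left hK0, mul_eq_zero] at h1
  refine h1.resolve_left ?_
  exact_mod_cast K.succ_ne_zero

/-- For such `a` the vector `f (a * a) v` equals `f a v`, so the usual `𝔰𝔩₂` identity holds for `f
a`: the top nonzero power `K` satisfies `(K + 1) (φ a - K) = 0`. -/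
theorem φ_idempotent {a : A} (ha : a * a - a ∈ t.annF) : ∃ k : ℕ, φ a = k := by
  obtain ⟨K, hK, hK0⟩ := t.exists_f_pow a
  refine ⟨K, ?_⟩
  have h1 := t.e_f_pow a 1 K
  have h2 : f (a * a) v = f a v := by
    rw [← sub_eq_zero, ← LinearMap.sub_apply, ← map_sub]; exact ha
  have h3 : (K * (K + 1) : ℂ) • (f a ^ (K - 1)) (f a v) = (K * (K + 1) : ℂ) • (f a ^ K) v := by
    rcases K with _ | K
    · simp
    · rw [Nat.add_sub_cancel, ← Module.End.mul_apply, ← pow_succ]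
  rw [hK, map_zero, ← t.f_pow_comm, mul_one, mul_one, h2, h3, ← sub_smul, eq_comm,
    smul_eq_zero_iff_left hK0, mul_comm (K : ℂ), ← mul_sub, mul_eq_zero] at h1
  have h4 := h1.resolve_left (by exact_mod_cast K.succ_ne_zero)
  exact sub_eq_zero.mp h4

theorem exists_eq_sum_ev [Algebra.FiniteType ℂ A] (nd : ∀ c, (∀ b, φ (c * b) = 0) → f c v = 0) :
    ∃ k : MaximalSpectrum A →₀ ℕ, ∀ a, φ a = k.sum fun S m => (m : ℂ) * WeylFunctor.ev S a := by
  classical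
  have hfin := t.finite_quotient
  have : IsArtinianRing (A ⧸ t.annF) := IsArtinianRing.of_finite ℂ _
  have hs : {S : MaximalSpectrum A | t.annF ≤ S.asIdeal}.Finite := by
    let g : MaximalSpectrum (A ⧸ t.annF) → MaximalSpectrum A := fun M =>
      ⟨M.asIdeal.comap (Ideal.Quotient.mk t.annF), by
        have := M.isMaximal
        exact Ideal.comap_isMaximal_of_surjective _ Ideal.Quotient.mk_surjective⟩
    refine (Set.finite_range g).subset ?_
    intro S hS
    have hS' : t.annF ≤ S.asIdeal := hS
    have := S.isMaximal
    have h1 : (S.asIdeal.map (Ideal.Quotient.mk t.annF)).comap (Ideal.Quotient.mk t.annF) =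
        S.asIdeal := by
      rw [Ideal.comap_map_of_surjective _ Ideal.Quotient.mk_surjective, ← RingHom.ker_eq_comap_bot,
        Ideal.mk_ker, sup_eq_left.mpr hS']
    refine ⟨⟨S.asIdeal.map (Ideal.Quotient.mk t.annF), ?_⟩, MaximalSpectrum.ext h1⟩
    refine (Ideal.map_eq_top_or_isMaximal_of_surjective _ Ideal.Quotient.mk_surjective
      this).resolve_left fun h2 => this.ne_top ?_
    rw [← h1, h2, Ideal.comap_top]
  have hfs := hs.to_subtype
  set s := hs.toFinset with hsdef
  have hmem : ∀ S, S ∈ s ↔ t.annF ≤ S.asIdeal := fun S => by simp [hsdef]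
  -- Since `A` is a Jacobson ring, the radical ideal `annF` is the intersection of the finitely many
  -- maximal ideals above it.
  have hI : ∀ a, (∀ S ∈ s, WeylFunctor.ev S a = 0) → a ∈ t.annF := by
    intro a ha
    have := isJacobsonRing_of_finiteType (A := ℂ) (B := A)
    rw [← IsJacobsonRing.out' _ (t.annF_isRadical nd), Ideal.jacobson, Submodule.mem_sInf]
    rintro J ⟨hJ, hJm⟩
    exact (ev_eq_zero_iff ⟨J, hJm⟩ a).mp (ha ⟨J, hJm⟩ ((hmem _).mpr hJ))
  have hspan : φ ∈ Submodule.span ℂ (Set.range fun S : s => (WeylFunctor.ev S.1).toLinearMap) := by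
    refine mem_span_of_iInf_ker_le_ker fun a ha => ?_
    rw [Submodule.mem_iInf] at ha
    exact t.φ_eq_zero (hI a fun S hS => ha ⟨S, hS⟩)
  obtain ⟨c, hc⟩ := (Submodule.mem_span_range_iff_exists_fun ℂ).mp hspan
  have hφ : ∀ a, φ a = ∑ S : s, c S * WeylFunctor.ev S.1 a := fun a => by
    rw [← hc, LinearMap.sum_apply]; rfl
  -- An element that is `1` at `S` and `0` at the other points of `s` is idempotent modulo `annF`,
  -- and `φ` takes the value `c S` on it.
  have hnat : ∀ S : s, ∃ k : ℕ, c S = k := by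
    intro S
    obtain ⟨a, ha, ha'⟩ := exists_ev_eq s S.1
    have h1 : φ a = c S := by
      rw [hφ, Finset.sum_eq_single S, ha, mul_one]
      · intro S' _ hne
        rw [ha' S'.1 S'.2 (fun h => hne (Subtype.ext h)), mul_zero]
      · exact fun h => absurd (Finset.mem_univ S) h
    rw [← h1]
    refine t.φ_idempotent (hI _ fun S' hS' => ?_)
    rw [map_sub, map_mul]
    by_cases h : S' = S.1
    · rw [h, ha]; ring
    · rw [ha' S' hS' h]; ring
  choose k hk using hnat
  refine ⟨Finsupp.onFinset s (fun S => if h : S ∈ s then k ⟨S, h⟩ else 0) fun S hS => ?_, fun a => ?_⟩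
  · by_contra h
    simp [h] at hS
  · rw [hφ, Finsupp.onFinset_sum _ (by simp), ← Finset.sum_coe_sort s]
    refine Finset.sum_congr rfl fun S _ => ?_
    rw [dif_pos S.2, hk]

end CurrentSl2

end CurrentSlTwo
/-! ### Roots and root vectors -/

section Roots

variable {g : Type v} [LieRing g] [LieAlgebra ℂ g] [FiniteDimensional ℂ g] [IsSimple ℂ g]
  {H : LieSubalgebra ℂ g} [H.IsCartanSubalgebra] (b : (rootSystem H).Base)

theorem root_mem_posCone {α : H.root} (hα : b.IsPos α) : (rootSystem H).root α ∈ posCone b := by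
  refine hα.induction_on_add (p := fun α => (rootSystem H).root α ∈ posCone b)
    (fun i hi => AddSubmonoid.subset_closure ⟨i, hi, rfl⟩) ?_
  intro i j k hk hi hj
  rw [hk]
  exact add_mem hi (AddSubmonoid.subset_closure ⟨j, hj, rfl⟩)

theorem root_neg' (α : H.root) :
    letI := (rootSystem H).indexNeg
    (rootSystem H).root (-α) = -(rootSystem H).root α := by
  change (rootSystem H).root ((rootSystem H).reflectionPerm α α) = _
  rw [RootPairing.root_reflectionPerm, RootPairing.reflection_apply_self]

theorem root_mem_posCone_iff {α : H.root} :
    (rootSystem H).root α ∈ posCone b ↔ b.IsPos α := by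
  refine ⟨fun h => ?_, root_mem_posCone b⟩
  let := (rootSystem H).indexNeg
  rcases RootPairing.Base.IsPos.or_neg b α with hα | hα
  · exact hα
  · have h1 := root_mem_posCone b hα
    rw [root_neg'] at h1
    exact absurd (posCone_pointed b h h1) ((rootSystem H).ne_zero α)

theorem pos_or_neg (α : H.root) :
    b.IsPos α ∨ ∃ β : H.root, b.IsPos β ∧ (α.1 : H → ℂ) = -(β.1 : H → ℂ) := by
  let := (rootSystem H).indexNeg
  rcases RootPairing.Base.IsPos.or_neg b α with hα | hα
  · exact Or.inl hα
  · refine Or.inr ⟨-α, hα, ?_⟩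
    have h1 := root_neg' α
    funext h
    have h2 := LinearMap.congr_fun h1 h
    change ((-α : H.root).1 : H → ℂ) h = -(α.1 : H → ℂ) h at h2
    rw [Pi.neg_apply, h2, neg_neg]

/-- The vectors of negative root spaces. -/
def negSet : Set g := {x | ∃ α : H.root, b.IsPos α ∧ x ∈ rootSpace H (-(α.1 : H → ℂ))}

/-- The vectors of positive root spaces. -/
def posSet : Set g := {x | ∃ α : H.root, b.IsPos α ∧ x ∈ rootSpace H (α.1 : H → ℂ)}

theorem span_triangular :
    Submodule.span ℂ (negSet b ∪ (posSet b ∪ (H : Set g))) = ⊤ := by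
  rw [eq_top_iff]
  intro x _
  have hx : x ∈ ⨆ χ : LieModule.Weight ℂ H g, LieModule.genWeightSpace g χ := by
    simp [LieModule.iSup_genWeightSpace_eq_top' ℂ H g]
  induction hx using LieSubmodule.iSup_induction' with
  | zero => exact zero_mem _
  | add x y _ _ hx hy => exact add_mem (hx trivial) (hy trivial)
  | mem χ x hx =>
    refine Submodule.subset_span ?_
    by_cases hχ : χ.IsZero
    · refine Or.inr (Or.inr ?_)
      have h1 : x ∈ rootSpace H (0 : H → ℂ) := by
        have : (χ : H → ℂ) = 0 := hχ
        rw [← this]; exact hx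
      rw [rootSpace_zero_eq] at h1
      exact h1
    · have hmem : χ ∈ H.root := by simpa using hχ
      rcases pos_or_neg b ⟨χ, hmem⟩ with h | ⟨β, hβ, h⟩
      · exact Or.inr (Or.inl ⟨⟨χ, hmem⟩, h, hx⟩)
      · refine Or.inl ⟨β, hβ, ?_⟩
        rw [← h]; exact hx

theorem negSet_lie {x : g} (hx : x ∈ negSet b) : ∃ β ∈ posCone b, β ≠ 0 ∧
    ∀ h : H, ⁅(h : g), x⁆ = (-β) h • x := by
  obtain ⟨α, hα, hx⟩ := hx
  exact ⟨(rootSystem H).root α, root_mem_posCone b hα, (rootSystem H).ne_zero α,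
    fun h => lie_eq_smul_of_mem_rootSpace hx h⟩

theorem posSet_lie {x : g} (hx : x ∈ posSet b) : ∃ β ∈ posCone b, β ≠ 0 ∧
    ∀ h : H, ⁅(h : g), x⁆ = β h • x := by
  obtain ⟨α, hα, hx⟩ := hx
  exact ⟨(rootSystem H).root α, root_mem_posCone b hα, (rootSystem H).ne_zero α,
    fun h => lie_eq_smul_of_mem_rootSpace hx h⟩

theorem root_isNonZero (α : H.root) : α.1.IsNonZero := (Finset.mem_filter.mp α.2).2

theorem exists_triple (α : H.root) : ∃ e f : g, IsSl2Triple (coroot α.1 : g) e f ∧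
    e ∈ rootSpace H (α.1 : H → ℂ) ∧ f ∈ rootSpace H (-(α.1 : H → ℂ)) := by
  obtain ⟨h, e, f, t, he, hf⟩ := exists_isSl2Triple_of_weight_isNonZero (root_isNonZero α)
  obtain rfl := t.h_eq_coroot (root_isNonZero α) he hf
  exact ⟨e, f, t, he, hf⟩

/-- A root vector `x_α`. -/
def eVec (α : H.root) : g := (exists_triple α).choose

/-- A root vector `x_{-α}`. -/
def fVec (α : H.root) : g := (exists_triple α).choose_spec.choose

theorem triple (α : H.root) : IsSl2Triple (coroot α.1 : g) (eVec α) (fVec α) :=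
  (exists_triple α).choose_spec.choose_spec.1

theorem eVec_mem (α : H.root) : eVec α ∈ rootSpace H (α.1 : H → ℂ) :=
  (exists_triple α).choose_spec.choose_spec.2.1

theorem fVec_mem (α : H.root) : fVec α ∈ rootSpace H (-(α.1 : H → ℂ)) :=
  (exists_triple α).choose_spec.choose_spec.2.2

theorem exists_smul_eVec {α : H.root} {x : g} (hx : x ∈ rootSpace H (α.1 : H → ℂ)) :
    ∃ c : ℂ, x = c • eVec α := by
  obtain ⟨c, hc⟩ := (finrank_eq_one_iff_of_nonzero'
    (⟨eVec α, eVec_mem α⟩ : rootSpace H (α.1 : H → ℂ))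
    (fun h => (triple α).e_ne_zero (congrArg Subtype.val h))).mp
    (finrank_rootSpace_eq_one α.1 (root_isNonZero α)) ⟨x, hx⟩
  exact ⟨c, (congrArg Subtype.val hc).symm⟩

theorem exists_smul_fVec {α : H.root} {x : g} (hx : x ∈ rootSpace H (-(α.1 : H → ℂ))) :
    ∃ c : ℂ, x = c • fVec α := by
  have hneg : (-α.1).IsNonZero := by simpa using root_isNonZero α
  have h1 := finrank_rootSpace_eq_one (-α.1) hneg
  rw [LieModule.Weight.coe_neg] at h1
  obtain ⟨c, hc⟩ := (finrank_eq_one_iff_of_nonzero'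
    (⟨fVec α, fVec_mem α⟩ : rootSpace H (-(α.1 : H → ℂ)))
    (fun h => (triple α).f_ne_zero (congrArg Subtype.val h))).mp h1 ⟨x, hx⟩
  exact ⟨c, (congrArg Subtype.val hc).symm⟩

theorem lie_h_eVec (α : H.root) (h : H) : ⁅(h : g), eVec α⁆ = α.1 h • eVec α :=
  lie_eq_smul_of_mem_rootSpace (eVec_mem α) h

theorem lie_h_fVec (α : H.root) (h : H) : ⁅(h : g), fVec α⁆ = -(α.1 h) • fVec α :=
  lie_eq_smul_of_mem_rootSpace (fVec_mem α) h

theorem lie_e_f_of_ne {i j : H.root} (hi : i ∈ b.support) (hj : j ∈ b.support) (hij : i ≠ j) :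
    ⁅eVec i, fVec j⁆ = 0 := by
  by_contra hne
  have h1 := LieAlgebra.lie_mem_genWeightSpace_of_mem_genWeightSpace (eVec_mem i) (fVec_mem j)
  have h2 : LieModule.genWeightSpace g ((i.1 : H → ℂ) + -(j.1 : H → ℂ)) ≠ ⊥ := fun h => hne (by
    rw [h] at h1; exact h1)
  let χ : LieModule.Weight ℂ H g := ⟨_, h2⟩
  have h3 : χ.IsNonZero := by
    intro h0
    have h4 : (i.1 : H → ℂ) + -(j.1 : H → ℂ) = 0 := h0
    refine hij (Subtype.ext (DFunLike.coe_injective ?_))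
    exact add_neg_eq_zero.mp h4
  have hmem : χ ∈ H.root := by simpa using h3
  refine b.sub_notMem_range_root hi hj ⟨⟨χ, hmem⟩, ?_⟩
  ext h
  change χ h = i.1 h - j.1 h
  rw [sub_eq_add_neg]
  rfl

/-- Let `x` be at the top of the `α`-string through `β`, at distance `r` from `β`; since `α + β` is
a root, `r ≥ 1`. Then `f ^ r x` has weight `β`, and `e f ^ r x` is `r (N - r + 1)` times the nonzero
vector `f ^ (r - 1) x`, with `N ≥ r` the length of the string. -/
theorem exists_lie_ne_zero {α β γ : H.root} (hγ : (γ.1 : H → ℂ) = α.1 + β.1) :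
    ∃ x ∈ rootSpace H (α.1 : H → ℂ), ∃ y ∈ rootSpace H (β.1 : H → ℂ), ⁅x, y⁆ ≠ 0 := by
  have hα := root_isNonZero α
  obtain ⟨x, hx, x_ne0⟩ := (LieModule.chainTop (α.1 : H → ℂ) β.1).exists_ne_zero
  have he := eVec_mem α
  have hf := fVec_mem α
  have t := triple α
  have prim : t.HasPrimitiveVectorWith x (chainLength α.1 β.1 : ℂ) :=
    have := LieAlgebra.lie_mem_genWeightSpace_of_mem_genWeightSpace he hx
    ⟨x_ne0, (chainLength_smul _ _ hx).symm,
      by rwa [LieModule.genWeightSpace_add_chainTop _ _ hα] at this⟩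
  set r := LieModule.chainTopCoeff (α.1 : H → ℂ) β.1 with hr
  have hr1 : 1 ≤ r := by
    have h1 := (rootSpace_zsmul_add_ne_bot_iff α.1 β.1 hα 1).mp (by
      rw [one_smul, ← hγ]; exact γ.1.2)
    exact_mod_cast h1.1
  have hrN : r ≤ chainLength α.1 β.1 := chainTopCoeff_le_chainLength _ _
  obtain ⟨m, hm⟩ : ∃ m, r = m + 1 := ⟨r - 1, by omega⟩
  refine ⟨eVec α, he, (LieModule.toEnd ℂ g g (fVec α) ^ (m + 1)) x, ?_, ?_⟩
  · have h1 := LieAlgebra.toEnd_pow_apply_mem hf hx (m + 1)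
    rw [LieModule.coe_chainTop', ← hr, hm] at h1
    convert! h1 using 2
    rw [smul_neg, neg_add_cancel_left]
  · rw [prim.lie_e_pow_succ_toEnd_f]
    refine smul_ne_zero (mul_ne_zero ?_ ?_) (prim.pow_toEnd_f_ne_zero_of_eq_nat rfl (by omega))
    · exact_mod_cast m.succ_ne_zero
    · rw [sub_ne_zero]
      intro h
      have : chainLength α.1 β.1 = m := by exact_mod_cast h
      omega

/-- The positive root vectors are generated by the simple ones. -/
theorem rootSpace_subset_of_simple (K : LieSubalgebra ℂ g) (hK : ∀ i ∈ b.support, eVec i ∈ K)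
    {α : H.root} (hα : b.IsPos α) {x : g} (hx : x ∈ rootSpace H (α.1 : H → ℂ)) : x ∈ K := by
  suffices eVec α ∈ K by
    obtain ⟨c, rfl⟩ := exists_smul_eVec hx
    exact K.smul_mem c this
  refine hα.induction_on_add (p := fun α => eVec α ∈ K) hK ?_
  intro i j k hk hi hj
  have hk' : (k.1 : H → ℂ) = i.1 + j.1 := funext fun h => LinearMap.congr_fun hk h
  obtain ⟨x, hx, y, hy, hne⟩ := exists_lie_ne_zero hk'
  have h1 := LieAlgebra.lie_mem_genWeightSpace_of_mem_genWeightSpace hx hy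
  rw [← hk'] at h1
  obtain ⟨c, rfl⟩ := exists_smul_eVec hx
  obtain ⟨d, rfl⟩ := exists_smul_eVec hy
  obtain ⟨a, ha⟩ := exists_smul_eVec h1
  have ha0 : a ≠ 0 := by
    rintro rfl
    exact hne (by rw [ha, zero_smul])
  rw [← inv_smul_smul₀ ha0 (eVec k), ← ha]
  exact K.smul_mem _ (K.lie_mem (K.smul_mem _ hi) (K.smul_mem _ (hK j hj)))

theorem neg_rootSpace_subset_of_simple (K : LieSubalgebra ℂ g) (hK : ∀ i ∈ b.support, fVec i ∈ K)
    {α : H.root} (hα : b.IsPos α) {x : g} (hx : x ∈ rootSpace H (-(α.1 : H → ℂ))) : x ∈ K := by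
  suffices fVec α ∈ K by
    obtain ⟨c, rfl⟩ := exists_smul_fVec hx
    exact K.smul_mem c this
  refine hα.induction_on_add (p := fun α => fVec α ∈ K) hK ?_
  intro i j k hk hi hj
  let := (rootSystem H).indexNeg
  have hneg : ∀ α : H.root, ((-α : H.root).1 : H → ℂ) = -(α.1 : H → ℂ) := fun α =>
    funext fun h => LinearMap.congr_fun (root_neg' α) h
  have hk' : ((-k : H.root).1 : H → ℂ) = (-i : H.root).1 + (-j : H.root).1 := by
    rw [hneg, hneg, hneg, ← neg_add]
    congr 1
    exact funext fun h => LinearMap.congr_fun hk h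
  obtain ⟨x, hx, y, hy, hne⟩ := exists_lie_ne_zero hk'
  have h1 := LieAlgebra.lie_mem_genWeightSpace_of_mem_genWeightSpace hx hy
  rw [← hk', hneg] at h1
  rw [hneg] at hx hy
  obtain ⟨c, rfl⟩ := exists_smul_fVec hx
  obtain ⟨d, rfl⟩ := exists_smul_fVec hy
  obtain ⟨a, ha⟩ := exists_smul_fVec h1
  have ha0 : a ≠ 0 := by
    rintro rfl
    exact hne (by rw [ha, zero_smul])
  rw [← inv_smul_smul₀ ha0 (fVec k), ← ha]
  exact K.smul_mem _ (K.lie_mem (K.smul_mem _ hi) (K.smul_mem _ (hK j hj)))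

/-! ### Weights and heights -/

/-- Functionals on `𝔥` are determined by their values at the simple coroots. -/
theorem dual_ext {x y : Dual ℂ H}
    (h : ∀ i ∈ b.support, x ((rootSystem H).coroot i) = y ((rootSystem H).coroot i)) : x = y :=
  b.toCoweightBasis.ext fun i => by simpa using h i i.2

theorem exists_domWeight (n : b.support → ℕ) :
    ∃ ξ : domWeights b, ∀ i : b.support, ξ.1 ((rootSystem H).coroot i) = n i := by
  let f : Dual ℂ H := b.toCoweightBasis.constr ℂ fun i => (n i : ℂ)
  have hf : ∀ i : b.support, f ((rootSystem H).coroot i) = n i := fun i => by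
    have := b.toCoweightBasis.constr_basis ℂ (fun i => (n i : ℂ)) i
    rwa [b.toCoweightBasis_apply] at this
  exact ⟨⟨f, fun i hi => ⟨n ⟨i, hi⟩, hf ⟨i, hi⟩⟩⟩, hf⟩

/-- The height function on `𝔥*`. -/
def ht : Dual ℂ H →ₗ[ℂ] ℂ := b.toWeightBasis.constr ℂ fun _ => (1 : ℂ)

theorem ht_root {i : H.root} (hi : i ∈ b.support) : ht b ((rootSystem H).root i) = 1 := by
  have := b.toWeightBasis.constr_basis ℂ (fun _ => (1 : ℂ)) ⟨i, hi⟩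
  rwa [b.toWeightBasis_apply] at this

theorem exists_ht {y : Dual ℂ H} (hy : y ∈ posCone b) : ∃ n : ℕ, ht b y = n ∧ (n = 0 → y = 0) := by
  induction hy using AddSubmonoid.closure_induction with
  | mem y hy =>
    obtain ⟨i, hi, rfl⟩ := hy
    exact ⟨1, by rw [ht_root b hi, Nat.cast_one], fun h => absurd h one_ne_zero⟩
  | zero => exact ⟨0, by simp, fun _ => rfl⟩
  | add y z _ _ hy hz =>
    obtain ⟨m, hm, hm0⟩ := hy
    obtain ⟨n, hn, hn0⟩ := hz
    refine ⟨m + n, by rw [map_add, hm, hn]; push_cast; rfl, fun h => ?_⟩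
    rw [hm0 (by omega), hn0 (by omega), add_zero]

open Classical in
/-- The sum of the positive roots takes the value `2` at the simple coroots. -/
theorem sum_pos_roots {i : H.root} (hi : i ∈ b.support) :
    ∑ α : H.root with b.IsPos α, α.1 (coroot i.1) = 2 := by
  have hipos : b.IsPos i := RootPairing.Base.isPos_of_mem_support hi
  have hmem : i ∈ Finset.univ.filter fun α : H.root => b.IsPos α := by simpa using hipos
  rw [← Finset.add_sum_erase _ _ hmem, root_apply_coroot (root_isNonZero i), add_eq_left]
  have hs : ∀ α : H.root, ((rootSystem H).reflectionPerm i α).1 (coroot i.1) =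
      -(α.1 (coroot i.1)) := by
    intro α
    have h1 := LinearMap.congr_fun ((rootSystem H).root_reflectionPerm i α) (coroot i.1)
    rw [RootPairing.reflection_apply] at h1
    change ((rootSystem H).reflectionPerm i α).1 (coroot i.1) =
      α.1 (coroot i.1) - α.1 (coroot i.1) * i.1 (coroot i.1) at h1
    rw [h1, root_apply_coroot (root_isNonZero i)]
    ring
  -- The reflection in `α_i` permutes the positive roots other than `α_i` and changes the sign of
  -- their values at the coroot, so these values cancel in pairs.
  refine Finset.sum_involution (fun α _ => (rootSystem H).reflectionPerm i α) ?_ ?_ ?_ ?_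
  · intro α _
    rw [hs, add_neg_cancel]
  · intro α _ hne heq
    have := hs α
    rw [heq] at this
    exact hne (self_eq_neg.mp this)
  · intro α hα
    simp only [Finset.mem_erase, Finset.mem_filter, Finset.mem_univ, true_and] at hα ⊢
    refine ⟨fun h => ?_, hα.2.reflectionPerm hi hα.1⟩
    have h1 := congrArg ((rootSystem H).reflectionPerm i) h
    rw [RootPairing.reflectionPerm_self] at h1
    have h2 : ¬ b.IsPos ((rootSystem H).reflectionPerm i i) :=
      fun h => (RootPairing.Base.IsPos.neg_iff_not b i).mp h hipos
    exact h2 (h1 ▸ hα.2)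
  · intro α _
    exact RootPairing.reflectionPerm_self _ _ _

/-- The vector `t_α ∈ 𝔥` representing the root `α` is a positive multiple of the coroot. -/
theorem exists_pos_coroot (α : H.root) : ∃ c : ℝ, 0 < c ∧
    (cartanEquivDual H).symm α.1.toLinear = (c : ℂ) • coroot α.1 := by
  set t := (cartanEquivDual H).symm α.1.toLinear with ht
  have hα := root_isNonZero α
  have hne : α.1 t ≠ 0 := root_apply_cartanEquivDual_symm_ne_zero hα
  set c : ℂ := α.1 t / 2 with hc
  have hc0 : c ≠ 0 := div_ne_zero hne two_ne_zero
  have hαt : α.1 t = 2 * c := by rw [hc]; ring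
  have htc : t = c • coroot α.1 := by
    rw [coroot, ← ht, ← Nat.cast_smul_eq_nsmul ℂ, smul_smul, smul_smul, hαt]
    rw [show c * ((2 : ℕ) : ℂ) * (2 * c)⁻¹ = 1 by push_cast; field_simp, one_smul]
  have h1 : killingForm ℂ g t t = α.1 t := by
    have : cartanEquivDual H t t = α.1 t := by
      rw [ht, LinearEquiv.apply_symm_apply, LieModule.Weight.toLinear_apply]
    rw [← this]; rfl
  have h2 : killingForm ℂ g t t = ∑ β : H.root, β.1 t * β.1 t := by
    have h3 := LinearMap.congr_fun (LinearMap.congr_fun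
      (restrict_killingForm_eq_sum (K := ℂ) (L := g) (H := H)) t) t
    rw [LinearMap.sum_apply, LinearMap.sum_apply, ← Finset.sum_coe_sort] at h3
    exact h3
  choose z hz using fun β : H.root => (⟨_, apply_coroot_eq_cast α.1 β.1⟩ :
    ∃ z : ℤ, β.1 (coroot α.1) = z)
  have h4 : ∀ β : H.root, β.1 t = c * z β := fun β => by
    rw [← hz, ← LieModule.Weight.toLinear_apply, htc, map_smul]; rfl
  simp_rw [h4] at h2
  rw [h1, hαt] at h2
  -- With `t = c α^∨` one has `α(t) = 2c` and `β(t) = c z_β` with integers `z_β`. The identity `α(t)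
  -- = κ(t, t) = ∑ β(t)²` then reads `2c = c² ∑ z_β²`, so `c` is `2` divided by a positive integer.
  have h5 : (2 : ℂ) = c * ((∑ β : H.root, z β * z β : ℤ) : ℂ) := by
    have : c * 2 = c * (c * ((∑ β : H.root, z β * z β : ℤ) : ℂ)) := by
      rw [mul_comm c 2, h2]
      push_cast
      rw [Finset.mul_sum, Finset.mul_sum]
      exact Finset.sum_congr rfl fun β _ => by ring
    exact mul_left_cancel₀ hc0 this
  set N : ℤ := ∑ β : H.root, z β * z β with hN
  have hN0 : 0 < N := by
    have h6 : 0 ≤ N := Finset.sum_nonneg fun β _ => mul_self_nonneg _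
    refine lt_of_le_of_ne h6 fun h7 => ?_
    rw [← h7] at h5
    simp at h5
  refine ⟨2 / N, by positivity, ?_⟩
  rw [htc]
  congr 1
  have hNc : (N : ℂ) ≠ 0 := by exact_mod_cast hN0.ne'
  push_cast
  rw [eq_div_iff hNc]
  exact h5.symm

/-! ### The Weyl group orbit of a weight -/

/-- The group generated by the simple reflections. -/
def simpleReflGroup : Subgroup (Dual ℂ H ≃ₗ[ℂ] Dual ℂ H) :=
  Subgroup.closure ((rootSystem H).reflection '' b.support)

/-- An element of the group permutes the roots and is determined by its values on the simple ones.
-/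
instance : Finite (simpleReflGroup b) := by
  have key : ∀ w ∈ simpleReflGroup b, ∀ α : H.root, ∃ β : H.root,
      w ((rootSystem H).root α) = (rootSystem H).root β := by
    intro w hw
    induction hw using Subgroup.closure_induction with
    | mem w hw =>
      obtain ⟨i, -, rfl⟩ := hw
      exact fun α => ⟨_, ((rootSystem H).root_reflectionPerm i α).symm⟩
    | one => exact fun α => ⟨α, rfl⟩
    | mul x y _ _ hx hy =>
      intro α
      obtain ⟨β, hβ⟩ := hy α
      obtain ⟨γ, hγ⟩ := hx β
      exact ⟨γ, by rw [LinearEquiv.mul_apply, hβ, hγ]⟩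
    | inv x _ hx =>
      choose f hf using hx
      have hinj : Function.Injective f := fun α β h => (rootSystem H).root.injective
        (x.injective (by rw [hf, hf, h]))
      intro α
      obtain ⟨β, rfl⟩ := (Finite.injective_iff_surjective.mp hinj) α
      refine ⟨β, ?_⟩
      rw [← hf, ← LinearEquiv.mul_apply, inv_mul_cancel]
      rfl
  choose f hf using fun w : simpleReflGroup b => key w.1 w.2
  refine Finite.of_injective f fun w w' h => ?_
  refine Subtype.ext (LinearEquiv.toLinearMap_injective (b.toWeightBasis.ext fun i => ?_))
  rw [b.toWeightBasis_apply]
  change w.1 _ = w'.1 _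
  rw [hf, hf, h]

/-- A set of weights that is stable under the simple reflections and bounded above by `μ` has
bounded depth. -/
theorem exists_depth_bound (Ω : Set (Dual ℂ H)) (μ : Dual ℂ H)
    (hs : ∀ i ∈ b.support, ∀ ν ∈ Ω, (rootSystem H).reflection i ν ∈ Ω)
    (hμ : ∀ ν ∈ Ω, μ - ν ∈ posCone b) :
    ∃ N : ℕ, ∀ ν ∈ Ω, ∀ n : ℕ, ht b (μ - ν) = n → n ≤ N := by
  classical
  have := Fintype.ofFinite (simpleReflGroup b)
  have hst : ∀ w ∈ simpleReflGroup b, ∀ ν ∈ Ω, w ν ∈ Ω := by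
    intro w hw
    induction hw using Subgroup.closure_induction'' with
    | mem w hw =>
      obtain ⟨i, hi, rfl⟩ := hw
      exact hs i hi
    | inv_mem w hw =>
      obtain ⟨i, hi, rfl⟩ := hw
      intro ν hν
      rw [RootPairing.reflection_inv]
      exact hs i hi ν hν
    | one => exact fun ν hν => hν
    | mul x y _ _ hx hy => exact fun ν hν => hx _ (hy _ hν)
  -- The sum over the group is fixed by each simple reflection, hence vanishes at every simple
  -- coroot.
  have hsum : ∀ ν : Dual ℂ H, ∑ w : simpleReflGroup b, w.1 ν = 0 := by
    intro ν
    refine dual_ext b fun i hi => ?_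
    let s : simpleReflGroup b := ⟨(rootSystem H).reflection i, Subgroup.subset_closure ⟨i, hi, rfl⟩⟩
    have h1 : (rootSystem H).reflection i (∑ w : simpleReflGroup b, w.1 ν) =
        ∑ w : simpleReflGroup b, w.1 ν := by
      rw [map_sum]
      exact Fintype.sum_equiv (Equiv.mulLeft s) _ _ fun w => rfl
    rw [RootPairing.reflection_apply, sub_eq_self] at h1
    exact (smul_eq_zero.mp h1).resolve_right ((rootSystem H).ne_zero i)
  by_cases hΩ : Ω.Nonempty
  · obtain ⟨ν₀, hν₀⟩ := hΩ
    -- Writing `|W| μ = ∑ (μ - w ν)` with all summands in `Q⁺` bounds the depth of `ν` by the height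
    -- of `|W| μ`, which does not depend on `ν`.
    have h2 : ∀ ν ∈ Ω, ∃ m : ℕ, ht b (Fintype.card (simpleReflGroup b) • μ) =
        ht b (μ - ν) + m := by
      intro ν hν
      have h3 : Fintype.card (simpleReflGroup b) • μ =
          (μ - ν) + ∑ w ∈ Finset.univ.erase (1 : simpleReflGroup b), (μ - w.1 ν) := by
        have h4 : Fintype.card (simpleReflGroup b) • μ = ∑ w : simpleReflGroup b, (μ - w.1 ν) := by
          rw [Finset.sum_sub_distrib, hsum, sub_zero, Finset.sum_const, Finset.card_univ]
        rw [h4, ← Finset.add_sum_erase _ _ (Finset.mem_univ (1 : simpleReflGroup b))]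
        rfl
      obtain ⟨m, hm, -⟩ := exists_ht b (sum_mem (S := posCone b)
        (t := Finset.univ.erase (1 : simpleReflGroup b)) (f := fun w => μ - w.1 ν)
        fun w _ => hμ _ (hst w.1 w.2 ν hν))
      exact ⟨m, by rw [h3, map_add, hm]⟩
    obtain ⟨m₀, hm₀⟩ := h2 ν₀ hν₀
    obtain ⟨n₀, hn₀, -⟩ := exists_ht b (hμ ν₀ hν₀)
    refine ⟨n₀ + m₀, fun ν hν n hn => ?_⟩
    obtain ⟨m, hm⟩ := h2 ν hν
    rw [hm₀, hn₀, hn] at hm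
    have : n₀ + m₀ = n + m := by exact_mod_cast hm
    omega
  · exact ⟨0, fun ν hν => absurd ⟨ν, hν⟩ hΩ⟩

end Roots
/-! ### Triangular decomposition of a Lie algebra with Chevalley generators -/

section Triangular

variable {G I T : Type*} [LieRing G] [LieAlgebra ℂ G] [AddCommGroup T] [Module ℂ T]

theorem lieSpan_stable {s : Set G} {d : G} (h : ∀ x ∈ s, ⁅d, x⁆ ∈ LieSubalgebra.lieSpan ℂ G s)
    {x : G} (hx : x ∈ LieSubalgebra.lieSpan ℂ G s) : ⁅d, x⁆ ∈ LieSubalgebra.lieSpan ℂ G s := by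
  induction hx using LieSubalgebra.lieSpan_induction with
  | mem x hx => exact h x hx
  | zero => rw [lie_zero]; exact zero_mem _
  | add x y _ _ hx hy => rw [lie_add]; exact add_mem hx hy
  | smul c x _ hx => rw [lie_smul]; exact LieSubalgebra.smul_mem _ _ hx
  | lie x y hx' hy' hx hy =>
    rw [leibniz_lie]
    exact add_mem (LieSubalgebra.lie_mem _ hx hy') (LieSubalgebra.lie_mem _ hx' hy)

/-- This is how a raising operator moves `𝔫⁻` into `𝔫⁻ + 𝔥`: once `⁅d, x⁆` lies in that sum, a
further bracket with an element of `𝔫⁻` falls into `𝔫⁻`, because `𝔥` normalizes it. -/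
theorem lieSpan_stable_sup {s : Set G} {t : Submodule ℂ G}
    (ht : ∀ x ∈ t, ∀ y ∈ s, ⁅x, y⁆ ∈ LieSubalgebra.lieSpan ℂ G s) {d : G}
    (h : ∀ x ∈ s, ⁅d, x⁆ ∈ (LieSubalgebra.lieSpan ℂ G s).toSubmodule ⊔ t)
    {x : G} (hx : x ∈ LieSubalgebra.lieSpan ℂ G s) :
    ⁅d, x⁆ ∈ (LieSubalgebra.lieSpan ℂ G s).toSubmodule ⊔ t := by
  have key : ∀ z ∈ (LieSubalgebra.lieSpan ℂ G s).toSubmodule ⊔ t,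
      ∀ y ∈ LieSubalgebra.lieSpan ℂ G s, ⁅z, y⁆ ∈ LieSubalgebra.lieSpan ℂ G s := by
    intro z hz y hy
    obtain ⟨z₁, hz₁, z₂, hz₂, rfl⟩ := Submodule.mem_sup.mp hz
    rw [add_lie]
    exact add_mem (LieSubalgebra.lie_mem _ hz₁ hy) (lieSpan_stable (ht z₂ hz₂) hy)
  induction hx using LieSubalgebra.lieSpan_induction with
  | mem x hx => exact h x hx
  | zero => rw [lie_zero]; exact zero_mem _
  | add x y _ _ hx hy => rw [lie_add]; exact add_mem hx hy
  | smul c x _ hx => rw [lie_smul]; exact Submodule.smul_mem _ _ hx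
  | lie x y hx' hy' hx hy =>
    rw [leibniz_lie]
    refine Submodule.mem_sup_left (add_mem (key _ hx _ hy') ?_)
    rw [← lie_skew]
    exact neg_mem (key _ hy _ hx')

/-- The sum of the three pieces contains the generators and is stable under bracketing with them,
hence with everything they generate. No Serre relations are needed. -/
theorem lieSpan_triangular {e f : I → G} {η : T →ₗ[ℂ] G} {α : I → Dual ℂ T}
    (hef : ∀ i j, ⁅e i, f j⁆ ∈ LinearMap.range η) (he : ∀ t i, ⁅η t, e i⁆ = α i t • e i)
    (hf : ∀ t i, ⁅η t, f i⁆ = (-α i t) • f i) (hη : ∀ t t', ⁅η t, η t'⁆ = 0) :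
    (LieSubalgebra.lieSpan ℂ G (Set.range e ∪ Set.range f ∪ Set.range η)).toSubmodule ≤
      (LieSubalgebra.lieSpan ℂ G (Set.range f)).toSubmodule ⊔ LinearMap.range η ⊔
        (LieSubalgebra.lieSpan ℂ G (Set.range e)).toSubmodule := by
  set N := LieSubalgebra.lieSpan ℂ G (Set.range f)
  set P := LieSubalgebra.lieSpan ℂ G (Set.range e)
  set S := N.toSubmodule ⊔ LinearMap.range η ⊔ P.toSubmodule with hS
  have hNS : N.toSubmodule ⊔ LinearMap.range η ≤ S := le_sup_left
  have hPS : P.toSubmodule ⊔ LinearMap.range η ≤ S :=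
    sup_le le_sup_right (le_sup_right.trans hNS)
  have htN : ∀ x ∈ LinearMap.range η, ∀ y ∈ Set.range f, ⁅x, y⁆ ∈ N := by
    rintro _ ⟨t, rfl⟩ _ ⟨i, rfl⟩
    rw [hf]
    exact N.smul_mem _ (LieSubalgebra.subset_lieSpan ⟨i, rfl⟩)
  have htP : ∀ x ∈ LinearMap.range η, ∀ y ∈ Set.range e, ⁅x, y⁆ ∈ P := by
    rintro _ ⟨t, rfl⟩ _ ⟨i, rfl⟩
    rw [he]
    exact P.smul_mem _ (LieSubalgebra.subset_lieSpan ⟨i, rfl⟩)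
  have gen : ∀ x ∈ Set.range e ∪ Set.range f ∪ Set.range η, ∀ s ∈ S, ⁅x, s⁆ ∈ S := by
    intro x hx s hs
    obtain ⟨s, hs', p, hp, rfl⟩ := Submodule.mem_sup.mp hs
    obtain ⟨n, hn, _, ⟨t, rfl⟩, rfl⟩ := Submodule.mem_sup.mp hs'
    rw [lie_add, lie_add]
    rcases hx with (⟨i, rfl⟩ | ⟨i, rfl⟩) | ⟨t', rfl⟩
    · refine add_mem (add_mem ?_ ?_) ?_
      · refine hNS (lieSpan_stable_sup htN ?_ hn)
        rintro _ ⟨j, rfl⟩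
        exact Submodule.mem_sup_right (hef i j)
      · rw [← lie_skew, he]
        exact neg_mem (Submodule.smul_mem _ _
          (hPS (Submodule.mem_sup_left (LieSubalgebra.subset_lieSpan ⟨i, rfl⟩))))
      · exact hPS (Submodule.mem_sup_left (P.lie_mem (LieSubalgebra.subset_lieSpan ⟨i, rfl⟩) hp))
    · refine add_mem (add_mem ?_ ?_) ?_
      · exact hNS (Submodule.mem_sup_left (N.lie_mem (LieSubalgebra.subset_lieSpan ⟨i, rfl⟩) hn))
      · rw [← lie_skew, hf]
        exact neg_mem (Submodule.smul_mem _ _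
          (hNS (Submodule.mem_sup_left (LieSubalgebra.subset_lieSpan ⟨i, rfl⟩))))
      · refine hPS (lieSpan_stable_sup htP ?_ hp)
        rintro _ ⟨j, rfl⟩
        rw [← lie_skew]
        exact neg_mem (Submodule.mem_sup_right (hef j i))
    · rw [hη, add_zero]
      exact add_mem (hNS (Submodule.mem_sup_left (lieSpan_stable (htN _ ⟨t', rfl⟩) hn)))
        (hPS (Submodule.mem_sup_left (lieSpan_stable (htP _ ⟨t', rfl⟩) hp)))
  have sub : Set.range e ∪ Set.range f ∪ Set.range η ⊆ S := by
    rintro _ ((⟨i, rfl⟩ | ⟨i, rfl⟩) | ⟨t', rfl⟩)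
    · exact hPS (Submodule.mem_sup_left (LieSubalgebra.subset_lieSpan ⟨i, rfl⟩))
    · exact hNS (Submodule.mem_sup_left (LieSubalgebra.subset_lieSpan ⟨i, rfl⟩))
    · exact hNS (Submodule.mem_sup_right ⟨t', rfl⟩)
  have stab : ∀ x ∈ LieSubalgebra.lieSpan ℂ G (Set.range e ∪ Set.range f ∪ Set.range η),
      ∀ s ∈ S, ⁅x, s⁆ ∈ S := by
    intro x hx
    induction hx using LieSubalgebra.lieSpan_induction with
    | mem x hx => exact gen x hx
    | zero => intro s _; rw [zero_lie]; exact zero_mem _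
    | add x y _ _ hx hy => intro s hs; rw [add_lie]; exact add_mem (hx s hs) (hy s hs)
    | smul c x _ hx => intro s hs; rw [smul_lie]; exact Submodule.smul_mem _ _ (hx s hs)
    | lie x y _ _ hx hy =>
      intro s hs
      rw [lie_lie]
      exact sub_mem (hx _ (hy s hs)) (hy _ (hx s hs))
  intro x hx
  induction hx using LieSubalgebra.lieSpan_induction with
  | mem x hx => exact sub hx
  | zero => exact zero_mem _
  | add x y _ _ hx hy => exact add_mem hx hy
  | smul c x _ hx => exact Submodule.smul_mem _ _ hx
  | lie x y hx' _ _ hy => exact stab x hx' y hy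

theorem lie_mem_wtSum {η : T →ₗ[ℂ] G} {Ω : Set (Dual ℂ T)} (hΩ : ∀ α ∈ Ω, ∀ β ∈ Ω, α + β ∈ Ω)
    {x y : G} (hx : x ∈ wtSum ((LieAlgebra.ad ℂ G).toLinearMap ∘ₗ η) Ω)
    (hy : y ∈ wtSum ((LieAlgebra.ad ℂ G).toLinearMap ∘ₗ η) Ω) :
    ⁅x, y⁆ ∈ wtSum ((LieAlgebra.ad ℂ G).toLinearMap ∘ₗ η) Ω := by
  obtain ⟨s, n, hs, hn, rfl⟩ := exists_sum_of_mem_wtSum hx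
  obtain ⟨s', n', hs', hn', rfl⟩ := exists_sum_of_mem_wtSum hy
  rw [sum_lie_sum]
  refine sum_mem fun α hα => sum_mem fun β hβ => ?_
  exact wt_le_wtSum (hΩ β (hs' hβ) α (hs hα)) (rep_mem_wt (ρ := LieAlgebra.ad ℂ G) (hn α) (hn' β))

end Triangular

/-! ### Irreducible highest weight representations -/

section Existence

variable {g : Type v} [LieRing g] [LieAlgebra ℂ g] [FiniteDimensional ℂ g] [IsSimple ℂ g]
  {H : LieSubalgebra ℂ g} [H.IsCartanSubalgebra] (b : (rootSystem H).Base)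

open Classical in
/-- Operators satisfying the relations between the Chevalley generators that do not involve the
Serre relations, on a space with a highest weight vector `one` such that no nonzero stable subspace
lies in the kernel of the projection `ε` to the highest weight space. -/
structure ChevalleyRep (μ : Dual ℂ H) (L : Type*) [AddCommGroup L] [Module ℂ L] where
  E : b.support → Module.End ℂ L
  F : b.support → Module.End ℂ L
  Hh : H →ₗ[ℂ] Module.End ℂ L
  ef : ∀ i j v, E i (F j v) - F j (E i v) = if i = j then Hh (coroot i.1.1) v else 0
  he : ∀ h i v, Hh h (E i v) - E i (Hh h v) = i.1.1 h • E i v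
  hf : ∀ h i v, Hh h (F i v) - F i (Hh h v) = -(i.1.1 h) • F i v
  hh : ∀ h h' v, Hh h (Hh h' v) = Hh h' (Hh h v)
  one : L
  e_one : ∀ i, E i one = 0
  h_one : ∀ h, Hh h one = μ h • one
  ε : L →ₗ[ℂ] ℂ
  ε_one : ε one = 1
  ε_F : ∀ i v, ε (F i v) = 0
  gen : ∀ N : Submodule ℂ L, one ∈ N → (∀ i, ∀ v ∈ N, E i v ∈ N) → (∀ i, ∀ v ∈ N, F i v ∈ N) →
    (∀ h, ∀ v ∈ N, Hh h v ∈ N) → N = ⊤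
  coirr : ∀ N : Submodule ℂ L, (∀ v ∈ N, ε v = 0) → (∀ i, ∀ v ∈ N, E i v ∈ N) →
    (∀ i, ∀ v ∈ N, F i v ∈ N) → (∀ h, ∀ v ∈ N, Hh h v ∈ N) → N = ⊥

variable {b}
variable {μ : Dual ℂ H} {L : Type*} [AddCommGroup L] [Module ℂ L]

/-- The graph argument that replaces Serre's theorem. In `𝔤 × End L` let `D` be generated by the
pairs of corresponding Chevalley generators. The projection of `D` to `𝔤` is onto; if it is also
injective, `D` is the graph of the desired representation. Its kernel acts on `L` as an ideal that
sends the highest weight vector into `ker ε`, and the irreducibility built into `coirr` forces it to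
be zero. -/
theorem ChevalleyRep.exists_lieHom (R : ChevalleyRep b μ L) :
    ∃ ρ : g →ₗ⁅ℂ⁆ Module.End ℂ L, (∀ i, ρ (eVec i.1) = R.E i) ∧ (∀ i, ρ (fVec i.1) = R.F i) ∧
      ∀ h : H, ρ h = R.Hh h := by
  classical
  let e : b.support → g × Module.End ℂ L := fun i => (eVec i.1, R.E i)
  let f : b.support → g × Module.End ℂ L := fun i => (fVec i.1, R.F i)
  let η : H →ₗ[ℂ] g × Module.End ℂ L := (H.toSubmodule.subtype).prod R.Hh
  have hef' : ∀ i j, ⁅e i, f j⁆ = if i = j then η (coroot i.1.1) else 0 := by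
    intro i j
    have h2 : ⁅R.E i, R.F j⁆ = if i = j then R.Hh (coroot i.1.1) else 0 := by
      ext v
      rw [LieRing.of_associative_ring_bracket]
      refine (R.ef i j v).trans ?_
      split_ifs <;> rfl
    have h1 : ⁅eVec i.1, fVec j.1⁆ = if i = j then (coroot i.1.1 : g) else 0 := by
      split_ifs with h
      · subst h; exact (triple i.1).lie_e_f
      · exact lie_e_f_of_ne b i.2 j.2 fun h' => h (Subtype.ext h')
    change (⁅eVec i.1, fVec j.1⁆, ⁅R.E i, R.F j⁆) = _
    rw [h1, h2]
    split_ifs <;> rfl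
  have hef : ∀ i j, ⁅e i, f j⁆ ∈ LinearMap.range η := by
    intro i j
    rw [hef']
    split_ifs
    exacts [⟨_, rfl⟩, zero_mem _]
  let α : b.support → Dual ℂ H := fun i => (rootSystem H).root i.1
  have he : ∀ t i, ⁅η t, e i⁆ = α i t • e i := fun t i => Prod.ext (lie_h_eVec i.1 t)
    (LinearMap.ext fun v => R.he t i v)
  have hf : ∀ t i, ⁅η t, f i⁆ = (-α i t) • f i := fun t i => Prod.ext (lie_h_fVec i.1 t)
    (LinearMap.ext fun v => R.hf t i v)
  have hη : ∀ t t', ⁅η t, η t'⁆ = 0 := fun t t' => Prod.ext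
    (congrArg Subtype.val (trivial_lie_zero H H t t'))
    (LinearMap.ext fun v => sub_eq_zero.mpr (R.hh t t' v))
  set D := LieSubalgebra.lieSpan ℂ (g × Module.End ℂ L) (Set.range e ∪ Set.range f ∪ Set.range η)
    with hD
  have heD : ∀ i, e i ∈ D := fun i => LieSubalgebra.subset_lieSpan (Or.inl (Or.inl ⟨i, rfl⟩))
  have hfD : ∀ i, f i ∈ D := fun i => LieSubalgebra.subset_lieSpan (Or.inl (Or.inr ⟨i, rfl⟩))
  have hηD : ∀ t, η t ∈ D := fun t => LieSubalgebra.subset_lieSpan (Or.inr ⟨t, rfl⟩)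
  let τ := (LieAlgebra.ad ℂ g).toLinearMap ∘ₗ H.toSubmodule.subtype
  let Ω : Set (Dual ℂ H) := {β | β ∈ posCone b ∧ β ≠ 0}
  have hΩ : ∀ β ∈ Ω, ∀ γ ∈ Ω, β + γ ∈ Ω := by
    rintro β ⟨hβ, hβ0⟩ γ ⟨hγ, hγ0⟩
    refine ⟨add_mem hβ hγ, fun h => hβ0 (posCone_pointed b hβ ?_)⟩
    rw [neg_eq_of_add_eq_zero_right h]; exact hγ
  let Ω' : Set (Dual ℂ H) := {β | -β ∈ Ω}
  have hΩ' : ∀ β ∈ Ω', ∀ γ ∈ Ω', β + γ ∈ Ω' := fun β hβ γ hγ => by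
    change -(β + γ) ∈ Ω
    rw [neg_add]; exact hΩ _ hβ _ hγ
  have hαΩ : ∀ i, α i ∈ Ω := fun i =>
    ⟨AddSubmonoid.subset_closure ⟨i.1, i.2, rfl⟩, (rootSystem H).ne_zero i.1⟩
  have hP : ∀ p ∈ LieSubalgebra.lieSpan ℂ _ (Set.range e), p.1 ∈ wtSum τ Ω ∧ p.2 R.one = 0 := by
    intro p hp
    induction hp using LieSubalgebra.lieSpan_induction with
    | mem x hx =>
      obtain ⟨i, rfl⟩ := hx
      exact ⟨wt_le_wtSum (hαΩ i) (lie_h_eVec i.1), R.e_one i⟩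
    | zero => exact ⟨zero_mem _, rfl⟩
    | add x y _ _ hx hy => exact ⟨add_mem hx.1 hy.1, by
        change x.2 _ + y.2 _ = 0; rw [hx.2, hy.2, add_zero]⟩
    | smul c x _ hx => exact ⟨Submodule.smul_mem _ _ hx.1, by
        change c • x.2 _ = 0; rw [hx.2, smul_zero]⟩
    | lie x y _ _ hx hy => exact ⟨lie_mem_wtSum hΩ hx.1 hy.1, by
        change x.2 (y.2 _) - y.2 (x.2 _) = 0; rw [hx.2, hy.2, map_zero, map_zero, sub_zero]⟩
  have hN : ∀ p ∈ LieSubalgebra.lieSpan ℂ _ (Set.range f),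
      p.1 ∈ wtSum τ Ω' ∧ ∀ v, R.ε (p.2 v) = 0 := by
    intro p hp
    induction hp using LieSubalgebra.lieSpan_induction with
    | mem x hx =>
      obtain ⟨i, rfl⟩ := hx
      exact ⟨wt_le_wtSum (μ := -α i) (by change - -α i ∈ Ω; rw [neg_neg]; exact hαΩ i)
        (lie_h_fVec i.1), R.ε_F i⟩
    | zero => exact ⟨zero_mem _, fun v => map_zero _⟩
    | add x y _ _ hx hy => exact ⟨add_mem hx.1 hy.1, fun v => by
        change R.ε (x.2 _ + y.2 _) = 0; rw [map_add, hx.2, hy.2, add_zero]⟩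
    | smul c x _ hx => exact ⟨Submodule.smul_mem _ _ hx.1, fun v => by
        change R.ε (c • x.2 _) = 0; rw [map_smul, hx.2, smul_zero]⟩
    | lie x y _ _ hx hy => exact ⟨lie_mem_wtSum hΩ' hx.1 hy.1, fun v => by
        change R.ε (x.2 (y.2 _) - y.2 (x.2 _)) = 0; rw [map_sub, hx.2, hy.2, sub_zero]⟩
  -- Decompose `d` as lowering + Cartan + raising. The three first components involve different
  -- weights of `𝔥` on `𝔤`, so `d.1 = 0` forces the Cartan part to vanish. The raising part kills
  -- `one`, and the lowering part maps into `ker ε`.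
  have hker : ∀ d ∈ D, d.1 = 0 → R.ε (d.2 R.one) = 0 := by
    intro d hd hd0
    obtain ⟨s, hs, p, hp, rfl⟩ := Submodule.mem_sup.mp (lieSpan_triangular hef he hf hη hd)
    obtain ⟨n, hn, _, ⟨t, rfl⟩, rfl⟩ := Submodule.mem_sup.mp hs
    have ht : (t : g) = 0 := by
      refine component_mem (τ := τ) ⊥ (fun h v hv => ?_) (Ω := Ω ∪ Ω') (μ := 0) ?_ (x := t)
        (z := n.1 + p.1) (fun h => ?_) (add_mem (wtSum_mono Set.subset_union_right (hN n hn).1)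
        (wtSum_mono Set.subset_union_left (hP p hp).1)) ?_
      · rw [Submodule.mem_bot] at hv ⊢; rw [hv, map_zero]
      · rintro (h | h)
        exacts [h.2 rfl, h.2 neg_zero]
      · rw [LinearMap.zero_apply, zero_smul]
        exact congrArg Prod.fst (hη h t)
      · rw [Submodule.mem_bot, ← hd0]
        change (t : g) + (n.1 + p.1) = n.1 + t + p.1
        abel
    have ht' : t = 0 := Subtype.ext ht
    subst ht'
    change R.ε (n.2 R.one + R.Hh 0 R.one + p.2 R.one) = 0
    rw [map_add, map_add, (hN n hn).2, (hP p hp).2]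
    simp
  let K : Submodule ℂ (g × Module.End ℂ L) :=
    D.toSubmodule ⊓ LinearMap.ker (LinearMap.fst ℂ g (Module.End ℂ L))
  have hK : ∀ d ∈ D, ∀ k ∈ K, ⁅d, k⁆ ∈ K := by
    rintro d hd k ⟨hk, hk0⟩
    refine ⟨D.lie_mem hd hk, ?_⟩
    change ⁅d.1, k.1⁆ = 0
    rw [show k.1 = 0 from hk0, lie_zero]
  have hcomm : ∀ (d k : g × Module.End ℂ L) (v : L), d.2 (k.2 v) = ⁅d, k⁆.2 v + k.2 (d.2 v) := by
    intro d k v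
    change _ = (d.2 (k.2 v) - k.2 (d.2 v)) + _
    abel
  let K1 : Submodule ℂ L := K.map ((LinearMap.applyₗ R.one) ∘ₗ LinearMap.snd ℂ g (Module.End ℂ L))
  -- Closing `K · one` under the `F i` alone already gives a subspace stable under `E` and `Hh`,
  -- since `K` is an ideal of `D` and `one` is a highest weight vector. It lies in `ker ε`, so it is
  -- zero.
  let Y : Submodule ℂ L := sInf {Y | K1 ≤ Y ∧ ∀ i, ∀ v ∈ Y, R.F i v ∈ Y}
  have hK1Y : K1 ≤ Y := le_sInf fun _ hN => hN.1
  have hFY : ∀ i, ∀ v ∈ Y, R.F i v ∈ Y := fun i v hv => by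
    rw [Submodule.mem_sInf] at hv ⊢
    exact fun N hN => hN.2 i v (hv N hN)
  have hind : ∀ Z : Submodule ℂ L, K1 ≤ Z → (∀ i, ∀ v ∈ Z, v ∈ Y → R.F i v ∈ Z) → Y ≤ Z := by
    intro Z h1 h2
    have : Y ≤ Y ⊓ Z := sInf_le ⟨le_inf hK1Y h1, fun i v hv => ⟨hFY i v hv.1, h2 i v hv.2 hv.1⟩⟩
    exact this.trans inf_le_right
  have hY1 : Y ≤ (⨅ i, Y.comap (R.E i)) ⊓ ⨅ h, Y.comap (R.Hh h) := by
    refine hind _ ?_ ?_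
    · rintro _ ⟨k, hk, rfl⟩
      simp only [Submodule.mem_inf, Submodule.mem_iInf, Submodule.mem_comap]
      refine ⟨fun i => hK1Y ?_, fun h => hK1Y ?_⟩
      · refine ⟨⁅e i, k⁆, hK _ (heD i) k hk, ?_⟩
        have := hcomm (e i) k R.one
        change _ = _ + k.2 (R.E i R.one) at this
        rw [R.e_one, map_zero, add_zero] at this
        exact this.symm
      · refine ⟨⁅η h, k⁆ + μ h • k, add_mem (hK _ (hηD h) k hk) (K.smul_mem _ hk), ?_⟩
        have := hcomm (η h) k R.one
        change _ = _ + k.2 (R.Hh h R.one) at this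
        rw [R.h_one, map_smul] at this
        exact this.symm
    · intro j v hv hvY
      simp only [Submodule.mem_inf, Submodule.mem_iInf, Submodule.mem_comap] at hv ⊢
      refine ⟨fun i => ?_, fun h => ?_⟩
      · rw [← sub_add_cancel (R.E i (R.F j v)) (R.F j (R.E i v)), R.ef]
        refine add_mem ?_ (hFY j _ (hv.1 i))
        split_ifs
        exacts [hv.2 _, zero_mem _]
      · rw [← sub_add_cancel (R.Hh h (R.F j v)) (R.F j (R.Hh h v)), R.hf]
        exact add_mem (Y.smul_mem _ (hFY j v hvY)) (hFY j _ (hv.2 h))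
  have hYker : Y ≤ LinearMap.ker R.ε := by
    refine hind _ ?_ fun i v _ _ => R.ε_F i v
    rintro _ ⟨k, hk, rfl⟩
    exact hker k hk.1 hk.2
  have hY0 : Y = ⊥ := R.coirr Y (fun v hv => hYker hv)
    (fun i v hv => (Submodule.mem_iInf _).mp (hY1 hv).1 i) hFY
    (fun i v hv => (Submodule.mem_iInf _).mp (hY1 hv).2 i)
  have hk1 : ∀ k ∈ K, k.2 R.one = 0 := fun k hk => by
    have : k.2 R.one ∈ Y := hK1Y ⟨k, hk, rfl⟩
    rwa [hY0, Submodule.mem_bot] at this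
  -- The vectors annihilated by `K` form a stable subspace. It contains `one`, so it is all of `L`,
  -- and the elements of `K` are zero as operators.
  let Z : Submodule ℂ L :=
    { carrier := {v | ∀ k ∈ K, k.2 v = 0}
      zero_mem' := fun k _ => map_zero _
      add_mem' := fun ha hb k hk => by rw [map_add, ha k hk, hb k hk, add_zero]
      smul_mem' := fun c v hv k hk => by rw [map_smul, hv k hk, smul_zero] }
  have hZ : ∀ d ∈ D, ∀ v ∈ Z, d.2 v ∈ Z := by
    intro d hd v hv k hk
    have h1 := hcomm d k v
    rw [hv k hk, map_zero, hv _ (hK d hd k hk), zero_add] at h1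
    exact h1.symm
  have hZtop : Z = ⊤ := R.gen Z hk1 (fun i => hZ _ (heD i)) (fun i => hZ _ (hfD i))
    (fun h => hZ _ (hηD h))
  let π : D →ₗ⁅ℂ⁆ g := (LieHom.fst ℂ g (Module.End ℂ L)).comp D.incl
  have hinj : Function.Injective π := by
    refine (injective_iff_map_eq_zero π).mpr fun d hd => Subtype.ext (Prod.ext hd ?_)
    ext v
    have : v ∈ Z := by rw [hZtop]; trivial
    exact this d.1 ⟨d.2, hd⟩
  have hrange : ∀ x, x ∈ π.range := by
    intro x
    have hx : x ∈ Submodule.span ℂ (negSet b ∪ (posSet b ∪ (H : Set g))) := by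
      rw [span_triangular]; trivial
    refine (Submodule.span_le (p := π.range.toSubmodule)).mpr ?_ hx
    rintro y (⟨α, hα, hy⟩ | ⟨α, hα, hy⟩ | hy)
    · exact neg_rootSpace_subset_of_simple b π.range (fun i hi => ⟨⟨_, hfD ⟨i, hi⟩⟩, rfl⟩) hα hy
    · exact rootSpace_subset_of_simple b π.range (fun i hi => ⟨⟨_, heD ⟨i, hi⟩⟩, rfl⟩) hα hy
    · exact ⟨⟨_, hηD ⟨y, hy⟩⟩, rfl⟩
  have hsurj : Function.Surjective π := fun x => (LieHom.mem_range _ _).mp (hrange x)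
  let Φ : D ≃ₗ⁅ℂ⁆ g := LieEquiv.ofBijective π ⟨hinj, hsurj⟩
  have hΦ : ∀ d : D, Φ.symm d.1.1 = d := fun d => Φ.symm_apply_apply d
  refine ⟨((LieHom.snd ℂ g (Module.End ℂ L)).comp D.incl).comp Φ.symm.toLieHom, fun i => ?_,
    fun i => ?_, fun h => ?_⟩
  · exact congrArg (fun d : D => d.1.2) (hΦ ⟨e i, heD i⟩)
  · exact congrArg (fun d : D => d.1.2) (hΦ ⟨f i, hfD i⟩)
  · exact congrArg (fun d : D => d.1.2) (hΦ ⟨η h, hηD h⟩)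

end Existence
/-! ### The irreducible highest weight representation on words in the Chevalley generators -/

section Words

variable {g : Type v} [LieRing g] [LieAlgebra ℂ g] [FiniteDimensional ℂ g] [IsSimple ℂ g]
  {H : LieSubalgebra ℂ g} [H.IsCartanSubalgebra] (b : (rootSystem H).Base) (μ : Dual ℂ H)

/-- The weight of the vector `f_{i_1} ⋯ f_{i_r} v_μ`. -/
def wordWt : List b.support → Dual ℂ H
  | [] => μ
  | i :: w => wordWt w - (rootSystem H).root i.1

/-- The operator `f_i` on words. -/
def wordF (i : b.support) : Module.End ℂ (List b.support →₀ ℂ) :=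
  Finsupp.lmapDomain ℂ ℂ fun w => i :: w

theorem wordF_single (i : b.support) (w : List b.support) (c : ℂ) :
    wordF b i (Finsupp.single w c) = Finsupp.single (i :: w) c := by
  rw [wordF, Finsupp.lmapDomain_apply, Finsupp.mapDomain_single]

/-- The operators of `𝔥` on words. -/
def wordH : H →ₗ[ℂ] Module.End ℂ (List b.support →₀ ℂ) where
  toFun h := Finsupp.linearCombination ℂ fun w => wordWt b μ w h • Finsupp.single w (1 : ℂ)
  map_add' h h' := by
    ext w : 2
    simp [add_smul]
  map_smul' c h := by
    ext w : 2
    simp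

theorem wordH_single (h : H) (w : List b.support) (c : ℂ) :
    wordH b μ h (Finsupp.single w c) = wordWt b μ w h • Finsupp.single w c := by
  simp [wordH, mul_comm]

open Classical in
/-- The vector `e_i f_{i_1} ⋯ f_{i_r} v_μ`. -/
def wordEVec (i : b.support) : List b.support → List b.support →₀ ℂ
  | [] => 0
  | j :: w => wordF b j (wordEVec i w) +
      if i = j then wordWt b μ w (coroot i.1.1) • Finsupp.single w (1 : ℂ) else 0

/-- The operator `e_i` on words. -/
def wordE (i : b.support) : Module.End ℂ (List b.support →₀ ℂ) :=
  Finsupp.linearCombination ℂ (wordEVec b μ i)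

theorem wordE_single (i : b.support) (w : List b.support) :
    wordE b μ i (Finsupp.single w 1) = wordEVec b μ i w := by
  simp [wordE]

open Classical in
theorem wordE_wordF (i j : b.support) (v : List b.support →₀ ℂ) :
    wordE b μ i (wordF b j v) - wordF b j (wordE b μ i v) =
      if i = j then wordH b μ (coroot i.1.1) v else 0 := by
  have : wordE b μ i ∘ₗ wordF b j - wordF b j ∘ₗ wordE b μ i =
      if i = j then wordH b μ (coroot i.1.1) else 0 := by
    refine Finsupp.lhom_ext' fun w => LinearMap.ext_ring ?_
    simp only [LinearMap.comp_apply, Finsupp.lsingle_apply, LinearMap.sub_apply, wordF_single,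
      wordE_single, wordEVec, add_sub_cancel_left]
    split_ifs <;> simp [wordH_single]
  have h1 := LinearMap.congr_fun this v
  simp only [LinearMap.comp_apply, LinearMap.sub_apply] at h1
  rw [h1]
  split_ifs <;> rfl

theorem wordH_wordF (h : H) (i : b.support) (v : List b.support →₀ ℂ) :
    wordH b μ h (wordF b i v) - wordF b i (wordH b μ h v) = -(i.1.1 h) • wordF b i v := by
  have : wordH b μ h ∘ₗ wordF b i - wordF b i ∘ₗ wordH b μ h = -(i.1.1 h) • wordF b i := by
    refine Finsupp.lhom_ext' fun w => LinearMap.ext_ring ?_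
    simp only [LinearMap.comp_apply, Finsupp.lsingle_apply, LinearMap.sub_apply, wordF_single,
      wordH_single, map_smul, LinearMap.smul_apply]
    rw [← sub_smul]
    congr 1
    change (wordWt b μ w - (rootSystem H).root i.1) h - _ = _
    rw [LinearMap.sub_apply]
    change _ - i.1.1 h - _ = _
    ring
  exact LinearMap.congr_fun this v

theorem wordH_wordEVec (h : H) (i : b.support) (w : List b.support) :
    wordH b μ h (wordEVec b μ i w) = (wordWt b μ w h + i.1.1 h) • wordEVec b μ i w := by
  classical
  induction w with
  | nil => simp [wordEVec]
  | cons j w ih =>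
    have h1 : wordWt b μ (j :: w) h = wordWt b μ w h - j.1.1 h := rfl
    rw [wordEVec, map_add, ← sub_add_cancel (wordH b μ h (wordF b j (wordEVec b μ i w)))
      (wordF b j (wordH b μ h (wordEVec b μ i w))), wordH_wordF, ih, h1, smul_add, map_smul,
      ← add_smul]
    congr 1
    · congr 1; ring
    · split_ifs with hij
      · subst hij
        rw [map_smul, wordH_single, smul_comm]
        congr 2
        ring
      · simp

theorem wordH_wordE (h : H) (i : b.support) (v : List b.support →₀ ℂ) :
    wordH b μ h (wordE b μ i v) - wordE b μ i (wordH b μ h v) = i.1.1 h • wordE b μ i v := by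
  have : wordH b μ h ∘ₗ wordE b μ i - wordE b μ i ∘ₗ wordH b μ h = i.1.1 h • wordE b μ i := by
    refine Finsupp.lhom_ext' fun w => LinearMap.ext_ring ?_
    simp only [LinearMap.comp_apply, Finsupp.lsingle_apply, LinearMap.sub_apply, wordE_single,
      wordH_single, map_smul, LinearMap.smul_apply, wordH_wordEVec]
    rw [← sub_smul]
    congr 1
    ring
  exact LinearMap.congr_fun this v

theorem wordH_comm (h h' : H) (v : List b.support →₀ ℂ) :
    wordH b μ h (wordH b μ h' v) = wordH b μ h' (wordH b μ h v) := by
  have : wordH b μ h ∘ₗ wordH b μ h' = wordH b μ h' ∘ₗ wordH b μ h := by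
    refine Finsupp.lhom_ext' fun w => LinearMap.ext_ring ?_
    simp only [LinearMap.comp_apply, Finsupp.lsingle_apply, wordH_single, map_smul]
    rw [smul_comm]
  exact LinearMap.congr_fun this v

/-- The Chevalley generators acting on words. -/
def wordOps : Set (Module.End ℂ (List b.support →₀ ℂ)) :=
  Set.range (wordE b μ) ∪ Set.range (wordF b) ∪ Set.range (wordH b μ)

/-- The largest stable subspace of the space of words in which the empty word does not occur. -/
def wordRad : Submodule ℂ (List b.support →₀ ℂ) where
  carrier := {t | ∀ x ∈ Algebra.adjoin ℂ (wordOps b μ), x t [] = 0}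
  zero_mem' := fun x _ => by rw [map_zero]; rfl
  add_mem' := fun ha hb x hx => by rw [map_add, Finsupp.add_apply, ha x hx, hb x hx, add_zero]
  smul_mem' := fun c v hv x hx => by rw [map_smul, Finsupp.smul_apply, hv x hx, smul_zero]

theorem wordRad_le_comap {x : Module.End ℂ (List b.support →₀ ℂ)} (hx : x ∈ wordOps b μ) :
    wordRad b μ ≤ (wordRad b μ).comap x :=
  fun _ ht y hy => ht (y * x) (mul_mem hy (Algebra.subset_adjoin hx))

theorem mem_wordOps_E (i : b.support) : wordE b μ i ∈ wordOps b μ := Or.inl (Or.inl ⟨i, rfl⟩)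

theorem mem_wordOps_F (i : b.support) : wordF b i ∈ wordOps b μ := Or.inl (Or.inr ⟨i, rfl⟩)

theorem mem_wordOps_H (h : H) : wordH b μ h ∈ wordOps b μ := Or.inr ⟨h, rfl⟩

/-- The operators on the quotient of the space of words by the radical. -/
def wordQ (x : Module.End ℂ (List b.support →₀ ℂ)) (hx : x ∈ wordOps b μ) :
    Module.End ℂ ((List b.support →₀ ℂ) ⧸ wordRad b μ) :=
  (wordRad b μ).mapQ _ x (wordRad_le_comap b μ hx)

theorem wordQ_mkQ (x : Module.End ℂ (List b.support →₀ ℂ)) (hx : x ∈ wordOps b μ)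
    (v : List b.support →₀ ℂ) :
    wordQ b μ x hx ((wordRad b μ).mkQ v) = (wordRad b μ).mkQ (x v) := rfl

theorem wordQ_ext {x y : Module.End ℂ ((List b.support →₀ ℂ) ⧸ wordRad b μ)}
    (h : ∀ v, x ((wordRad b μ).mkQ v) = y ((wordRad b μ).mkQ v)) : x = y :=
  Submodule.linearMap_qext _ (LinearMap.ext h)

theorem wordQ_add (h h' : H) : wordQ b μ (wordH b μ (h + h')) (mem_wordOps_H b μ (h + h')) =
    wordQ b μ (wordH b μ h) (mem_wordOps_H b μ h) +
      wordQ b μ (wordH b μ h') (mem_wordOps_H b μ h') :=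
  wordQ_ext b μ fun v => by
    rw [LinearMap.add_apply, wordQ_mkQ, wordQ_mkQ, wordQ_mkQ, map_add, LinearMap.add_apply, map_add]

theorem wordQ_smul (c : ℂ) (h : H) : wordQ b μ (wordH b μ (c • h)) (mem_wordOps_H b μ (c • h)) =
    c • wordQ b μ (wordH b μ h) (mem_wordOps_H b μ h) :=
  wordQ_ext b μ fun v => by
    rw [LinearMap.smul_apply, wordQ_mkQ, wordQ_mkQ, (wordH b μ).map_smul, LinearMap.smul_apply,
      (wordRad b μ).mkQ.map_smul]

/-- The action of `𝔥` on the quotient of the space of words by the radical. -/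
def wordQH : H →ₗ[ℂ] Module.End ℂ ((List b.support →₀ ℂ) ⧸ wordRad b μ) where
  toFun h := wordQ b μ (wordH b μ h) (mem_wordOps_H b μ h)
  map_add' h h' := wordQ_add b μ h h'
  map_smul' c h := wordQ_smul b μ c h

theorem wordQH_mkQ (h : H) (v : List b.support →₀ ℂ) :
    wordQH b μ h ((wordRad b μ).mkQ v) = (wordRad b μ).mkQ (wordH b μ h v) := rfl

open Classical in
theorem wordQ_ef (i j : b.support) (v : (List b.support →₀ ℂ) ⧸ wordRad b μ) :
    wordQ b μ (wordE b μ i) (mem_wordOps_E b μ i) (wordQ b μ (wordF b j) (mem_wordOps_F b μ j) v) -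
      wordQ b μ (wordF b j) (mem_wordOps_F b μ j) (wordQ b μ (wordE b μ i) (mem_wordOps_E b μ i) v)
      = if i = j then wordQH b μ (coroot i.1.1) v else 0 := by
  obtain ⟨v, rfl⟩ := Submodule.mkQ_surjective (wordRad b μ) v
  rw [wordQ_mkQ, wordQ_mkQ, wordQ_mkQ, wordQ_mkQ, ← map_sub, wordE_wordF, wordQH_mkQ]
  split_ifs
  exacts [rfl, map_zero _]

theorem wordQ_he (h : H) (i : b.support) (v : (List b.support →₀ ℂ) ⧸ wordRad b μ) :
    wordQH b μ h (wordQ b μ (wordE b μ i) (mem_wordOps_E b μ i) v) -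
      wordQ b μ (wordE b μ i) (mem_wordOps_E b μ i) (wordQH b μ h v) =
      i.1.1 h • wordQ b μ (wordE b μ i) (mem_wordOps_E b μ i) v := by
  obtain ⟨v, rfl⟩ := Submodule.mkQ_surjective (wordRad b μ) v
  rw [wordQ_mkQ, wordQH_mkQ, wordQH_mkQ, wordQ_mkQ, ← map_sub, wordH_wordE]
  rfl

theorem wordQ_hf (h : H) (i : b.support) (v : (List b.support →₀ ℂ) ⧸ wordRad b μ) :
    wordQH b μ h (wordQ b μ (wordF b i) (mem_wordOps_F b μ i) v) -
      wordQ b μ (wordF b i) (mem_wordOps_F b μ i) (wordQH b μ h v) =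
      -(i.1.1 h) • wordQ b μ (wordF b i) (mem_wordOps_F b μ i) v := by
  obtain ⟨v, rfl⟩ := Submodule.mkQ_surjective (wordRad b μ) v
  rw [wordQ_mkQ, wordQH_mkQ, wordQH_mkQ, wordQ_mkQ, ← map_sub, wordH_wordF]
  rfl

/-- The preimage of `N` is stable under the algebra generated by the operators and never involves
the empty word, which is the definition of the radical. -/
theorem wordQ_coirr (N : Submodule ℂ ((List b.support →₀ ℂ) ⧸ wordRad b μ))
    (hN : ∀ t, (wordRad b μ).mkQ t ∈ N → t [] = 0)
    (hx : ∀ x ∈ wordOps b μ, ∀ t, (wordRad b μ).mkQ t ∈ N → (wordRad b μ).mkQ (x t) ∈ N) :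
    N = ⊥ := by
  have key : ∀ x ∈ Algebra.adjoin ℂ (wordOps b μ), ∀ t, (wordRad b μ).mkQ t ∈ N →
      (wordRad b μ).mkQ (x t) ∈ N := by
    intro x hx'
    induction hx' using Algebra.adjoin_induction with
    | mem x hx' => exact hx x hx'
    | algebraMap c =>
      intro t ht
      rw [Module.algebraMap_end_apply, map_smul]
      exact N.smul_mem c ht
    | add x y _ _ hx hy =>
      intro t ht
      rw [LinearMap.add_apply, map_add]
      exact add_mem (hx t ht) (hy t ht)
    | mul x y _ _ hx hy =>
      intro t ht
      rw [Module.End.mul_apply]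
      exact hx _ (hy t ht)
  rw [eq_bot_iff]
  rintro v hv
  obtain ⟨v, rfl⟩ := Submodule.mkQ_surjective _ v
  rw [Submodule.mem_bot, Submodule.mkQ_apply, Submodule.Quotient.mk_eq_zero]
  exact fun x hx => hN _ (key x hx v hv)

theorem wordQ_gen (N : Submodule ℂ ((List b.support →₀ ℂ) ⧸ wordRad b μ))
    (h1 : (wordRad b μ).mkQ (Finsupp.single [] 1) ∈ N)
    (hF : ∀ i t, (wordRad b μ).mkQ t ∈ N → (wordRad b μ).mkQ (wordF b i t) ∈ N) : N = ⊤ := by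
  have h2 : ∀ w, (wordRad b μ).mkQ (Finsupp.single w 1) ∈ N := by
    intro w
    induction w with
    | nil => exact h1
    | cons i w ih => rw [← wordF_single]; exact hF i _ ih
  rw [eq_top_iff]
  rintro v -
  obtain ⟨v, rfl⟩ := Submodule.mkQ_surjective _ v
  induction v using Finsupp.induction_linear with
  | zero => rw [map_zero]; exact zero_mem _
  | add x y hx hy => rw [map_add]; exact add_mem hx hy
  | single w c =>
    rw [← mul_one c, ← smul_eq_mul, ← Finsupp.smul_single, map_smul]
    exact N.smul_mem c (h2 w)

/-- The coefficient of the empty word. -/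
def wordQε : ((List b.support →₀ ℂ) ⧸ wordRad b μ) →ₗ[ℂ] ℂ :=
  (wordRad b μ).liftQ (Finsupp.lapply []) fun _ ht => ht 1 (one_mem _)

theorem wordQε_mkQ (v : List b.support →₀ ℂ) : wordQε b μ ((wordRad b μ).mkQ v) = v [] := rfl

theorem wordQ_hh (h h' : H) (v : (List b.support →₀ ℂ) ⧸ wordRad b μ) :
    wordQH b μ h (wordQH b μ h' v) = wordQH b μ h' (wordQH b μ h v) := by
  obtain ⟨v, rfl⟩ := Submodule.mkQ_surjective (wordRad b μ) v
  rw [wordQH_mkQ, wordQH_mkQ, wordQH_mkQ, wordQH_mkQ, wordH_comm]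

/-- The highest weight vector. -/
def wordQOne : (List b.support →₀ ℂ) ⧸ wordRad b μ := (wordRad b μ).mkQ (Finsupp.single [] 1)

theorem wordQ_e_one (i : b.support) :
    wordQ b μ (wordE b μ i) (mem_wordOps_E b μ i) (wordQOne b μ) = 0 := by
  rw [wordQOne, wordQ_mkQ, wordE_single, wordEVec, map_zero]

theorem wordQ_h_one (h : H) : wordQH b μ h (wordQOne b μ) = μ h • wordQOne b μ := by
  rw [wordQOne, wordQH_mkQ, wordH_single, wordWt]
  rfl

theorem wordQε_F (i : b.support) (v : (List b.support →₀ ℂ) ⧸ wordRad b μ) :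
    wordQε b μ (wordQ b μ (wordF b i) (mem_wordOps_F b μ i) v) = 0 := by
  obtain ⟨v, rfl⟩ := Submodule.mkQ_surjective (wordRad b μ) v
  rw [wordQ_mkQ, wordQε_mkQ, wordF, Finsupp.lmapDomain_apply]
  exact Finsupp.mapDomain_of_notMem_range _ _ (by simp)

/-- The irreducible highest weight representation of highest weight `μ`. -/
def wordRep : ChevalleyRep b μ ((List b.support →₀ ℂ) ⧸ wordRad b μ) where
  E i := wordQ b μ (wordE b μ i) (mem_wordOps_E b μ i)
  F i := wordQ b μ (wordF b i) (mem_wordOps_F b μ i)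
  Hh := wordQH b μ
  ef := wordQ_ef b μ
  he := wordQ_he b μ
  hf := wordQ_hf b μ
  hh := wordQ_hh b μ
  one := wordQOne b μ
  e_one := wordQ_e_one b μ
  h_one := wordQ_h_one b μ
  ε := wordQε b μ
  ε_one := Finsupp.single_eq_same
  ε_F := wordQε_F b μ
  gen N h1 _ hF _ := wordQ_gen b μ N h1 fun i _ ht => hF i _ ht
  coirr N hN hE hF hH := wordQ_coirr b μ N (fun _ ht => hN _ ht) fun _ hx _ ht =>
    match hx with
    | Or.inl (Or.inl ⟨i, hi⟩) => hi ▸ hE i _ ht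
    | Or.inl (Or.inr ⟨i, hi⟩) => hi ▸ hF i _ ht
    | Or.inr ⟨h, hi⟩ => hi ▸ hH h _ ht

end Words

/-! ### Nonvanishing of `V(μ)` -/

section Nontrivial

variable {g : Type v} [LieRing g] [LieAlgebra ℂ g] [FiniteDimensional ℂ g] [IsSimple ℂ g]
  {H : LieSubalgebra ℂ g} [H.IsCartanSubalgebra] (b : (rootSystem H).Base) (μ : domWeights b)

/-- The annihilator in `U(𝔤)` of the highest weight vector `R.one` contains all defining relations
of `V(μ)` but not `1`. -/
theorem simpleGen_ne_zero_of_rep {L : Type*} [AddCommGroup L] [Module ℂ L]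
    (R : ChevalleyRep b μ.1 L) : simpleGen b μ ≠ 0 := by
  classical
  obtain ⟨ρ, hρe, hρf, hρh⟩ := R.exists_lieHom
  let φ := UniversalEnvelopingAlgebra.lift ℂ ρ
  have hφ : ∀ x v, φ (iota x) v = ρ x v := fun x v => by
    rw [UniversalEnvelopingAlgebra.lift_ι_apply]
  let I : Submodule (U g) (U g) :=
    { carrier := {y | φ y R.one = 0}
      zero_mem' := by change φ 0 R.one = 0; rw [map_zero]; rfl
      add_mem' := fun {x y} hx hy => by
        change φ (x + y) R.one = 0
        rw [map_add, LinearMap.add_apply, show φ x R.one = 0 from hx,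
          show φ y R.one = 0 from hy, add_zero]
      smul_mem' := fun c x hx => by
        change φ (c * x) R.one = 0
        rw [map_mul, Module.End.mul_apply, show φ x R.one = 0 from hx, map_zero] }
  have hI : simpleRel b μ ≤ I := by
    refine Submodule.span_le.mpr ?_
    rintro y ((⟨α, hα, x, hx, rfl⟩ | ⟨h, rfl⟩) | ⟨i, hi, x, hx, n, hn, rfl⟩)
    · change φ (iota x) R.one = 0
      rw [hφ]
      let K : LieSubalgebra ℂ g :=
        { carrier := {x | ρ x R.one = 0}
          zero_mem' := by change ρ 0 R.one = 0; rw [map_zero]; rfl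
          add_mem' := fun {x y} hx hy => by
            change ρ (x + y) R.one = 0
            rw [map_add, LinearMap.add_apply, show ρ x R.one = 0 from hx,
              show ρ y R.one = 0 from hy, add_zero]
          smul_mem' := fun c x hx => by
            change ρ (c • x) R.one = 0
            rw [map_smul, LinearMap.smul_apply, show ρ x R.one = 0 from hx, smul_zero]
          lie_mem' := fun {x y} hx hy => by
            change ρ ⁅x, y⁆ R.one = 0
            rw [rep_lie, show ρ x R.one = 0 from hx, show ρ y R.one = 0 from hy, map_zero,
              map_zero, sub_zero] }
      refine rootSpace_subset_of_simple b K (fun i hi => ?_) ((root_mem_posCone_iff b).mp hα) hx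
      change ρ (eVec (⟨i, hi⟩ : b.support).1) R.one = 0
      rw [hρe, R.e_one]
    · change φ _ R.one = 0
      rw [map_sub, LinearMap.sub_apply, hφ, hρh, R.h_one, AlgHom.commutes]
      exact sub_self _
    · change φ _ R.one = 0
      obtain ⟨c, rfl⟩ := exists_smul_fVec hx
      rw [map_smul, smul_pow, map_smul, LinearMap.smul_apply, map_pow]
      have h1 : φ (iota (fVec i)) = R.F ⟨i, hi⟩ := by
        rw [UniversalEnvelopingAlgebra.lift_ι_apply, ← hρf]
      rw [h1]
      suffices hz : (R.F ⟨i, hi⟩ ^ (n + 1)) R.one = 0 by rw [hz, smul_zero]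
      -- The vector `u` is again primitive: `E i` kills it because the factor `μ(h_i) - n` vanishes,
      -- and the other `E j` kill it because they commute with `F i`. The stable subspace it
      -- generates therefore arises by applying operators `F` to `u`, itself in the image of `F i`.
      -- It lies in `ker ε` and is zero.
      set u := (R.F ⟨i, hi⟩ ^ (n + 1)) R.one with hu
      have hEu : ∀ j, R.E j u = 0 := by
        intro j
        by_cases hj : j = ⟨i, hi⟩
        · subst hj
          have h2 := (sl2_e_f_pow (h := R.Hh (coroot i.1)) (e := R.E ⟨i, hi⟩) (f := R.F ⟨i, hi⟩)
            (LinearMap.ext fun v => by simpa using R.ef ⟨i, hi⟩ ⟨i, hi⟩ v)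
            (LinearMap.ext fun v => by
              have := R.hf (coroot i.1) ⟨i, hi⟩ v
              rw [root_apply_coroot (root_isNonZero i)] at this
              exact this) (R.e_one ⟨i, hi⟩) (R.h_one _) n).2
          have h3 : μ.1 (coroot i.1) = n := hn
          rw [h3, sub_self, mul_zero, zero_smul] at h2
          exact h2
        · have h3 : ∀ k : ℕ, R.E j ((R.F ⟨i, hi⟩ ^ k) R.one) = 0 := by
            intro k
            induction k with
            | zero => exact R.e_one j
            | succ k ih =>
              have := R.ef j ⟨i, hi⟩ ((R.F ⟨i, hi⟩ ^ k) R.one)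
              rw [if_neg hj, ih, map_zero, sub_zero] at this
              rw [pow_succ']
              exact this
          exact h3 (n + 1)
      have hHu : ∀ h, ∃ c : ℂ, R.Hh h u = c • u := by
        have : ∀ k : ℕ, ∀ h, ∃ c : ℂ, R.Hh h ((R.F ⟨i, hi⟩ ^ k) R.one) =
            c • (R.F ⟨i, hi⟩ ^ k) R.one := by
          intro k h
          induction k with
          | zero => exact ⟨_, R.h_one h⟩
          | succ k ih =>
            obtain ⟨c, hc⟩ := ih
            have := R.hf h ⟨i, hi⟩ ((R.F ⟨i, hi⟩ ^ k) R.one)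
            rw [hc, map_smul, sub_eq_iff_eq_add, ← add_smul] at this
            rw [pow_succ']
            exact ⟨_, this⟩
        exact this (n + 1)
      let Y : Submodule ℂ _ := sInf {Y | u ∈ Y ∧ ∀ i, ∀ v ∈ Y, R.F i v ∈ Y}
      have huY : u ∈ Y := Submodule.mem_sInf.mpr fun N hN => hN.1
      have hFY : ∀ i, ∀ v ∈ Y, R.F i v ∈ Y := fun i v hv =>
        Submodule.mem_sInf.mpr fun N hN => hN.2 i v (Submodule.mem_sInf.mp hv N hN)
      have hind : ∀ Z : Submodule ℂ _, u ∈ Z → (∀ i, ∀ v ∈ Z, v ∈ Y → R.F i v ∈ Z) → Y ≤ Z := by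
        intro Z h1 h2
        have : Y ≤ Y ⊓ Z := sInf_le ⟨⟨huY, h1⟩, fun i v hv => ⟨hFY i v hv.1, h2 i v hv.2 hv.1⟩⟩
        exact this.trans inf_le_right
      have hY1 : Y ≤ (⨅ i, Y.comap (R.E i)) ⊓ ⨅ h, Y.comap (R.Hh h) := by
        refine hind _ ⟨(Submodule.mem_iInf _).mpr fun i => ?_,
          (Submodule.mem_iInf _).mpr fun h => ?_⟩ ?_
        · rw [Submodule.mem_comap, hEu]; exact zero_mem _
        · obtain ⟨c, hc⟩ := hHu h
          rw [Submodule.mem_comap, hc]; exact Y.smul_mem c huY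
        · intro j v hv hvY
          have hvE := (Submodule.mem_iInf _).mp hv.1
          have hvH := (Submodule.mem_iInf _).mp hv.2
          refine ⟨(Submodule.mem_iInf _).mpr fun i => ?_, (Submodule.mem_iInf _).mpr fun h => ?_⟩
          · rw [Submodule.mem_comap, ← sub_add_cancel (R.E i (R.F j v)) (R.F j (R.E i v)), R.ef]
            refine add_mem ?_ (hFY j _ (hvE i))
            split_ifs
            exacts [hvH _, zero_mem _]
          · rw [Submodule.mem_comap, ← sub_add_cancel (R.Hh h (R.F j v)) (R.F j (R.Hh h v)), R.hf]
            exact add_mem (Y.smul_mem _ (hFY j v hvY)) (hFY j _ (hvH h))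
      have hY0 : Y = ⊥ := by
        refine R.coirr Y (fun v hv => ?_) (fun i v hv => (Submodule.mem_iInf _).mp (hY1 hv).1 i)
          hFY (fun i v hv => (Submodule.mem_iInf _).mp (hY1 hv).2 i)
        refine (hind (LinearMap.ker R.ε) ?_ fun i v _ _ => R.ε_F i v) hv
        rw [LinearMap.mem_ker, hu, pow_succ']
        exact R.ε_F _ _
      rwa [hY0, Submodule.mem_bot] at huY
  intro h0
  have h1 : (1 : U g) ∈ simpleRel b μ := (Submodule.Quotient.mk_eq_zero _).mp h0
  have h2 : φ 1 R.one = 0 := hI h1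
  rw [map_one, Module.End.one_apply] at h2
  have h3 := R.ε_one
  rw [h2, map_zero] at h3
  exact zero_ne_one h3

theorem simpleGen_ne_zero : simpleGen b μ ≠ 0 := simpleGen_ne_zero_of_rep b μ (wordRep b μ.1)

end Nontrivial
/-! ### Integrable highest weight representations -/

section LocallyNilpotent

variable {L V : Type*} [LieRing L] [LieAlgebra ℂ L] [AddCommGroup V] [Module ℂ V]

/-- The vector `x` is in the generalized `0`-eigenspace of `ad f` and `u` in that of `ρ f`;
generalized eigenvalues add under the action. -/
theorem exists_pow_eq_zero_of_ad_nilpotent (ρ : L →ₗ⁅ℂ⁆ Module.End ℂ V) {f x : L}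
    (hf : _root_.IsNilpotent (LieAlgebra.ad ℂ L f)) {u : V} (hu : ∃ K : ℕ, (ρ f ^ K) u = 0) :
    ∃ K : ℕ, (ρ f ^ K) (ρ x u) = 0 := by
  let _ : LieRingModule L V := LieRingModule.compLieHom V ρ
  have _ : LieModule ℂ L V := LieModule.compLieHom V ρ
  obtain ⟨k, hk⟩ := hf
  have h1 : x ∈ (LieModule.toEnd ℂ L L f).maxGenEigenspace 0 := by
    rw [Module.End.mem_maxGenEigenspace]
    refine ⟨k, ?_⟩
    rw [zero_smul, sub_zero]
    exact LinearMap.congr_fun hk x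
  have h2 : u ∈ (LieModule.toEnd ℂ L V f).maxGenEigenspace 0 := by
    rw [Module.End.mem_maxGenEigenspace]
    obtain ⟨K, hK⟩ := hu
    refine ⟨K, ?_⟩
    rw [zero_smul, sub_zero]
    exact hK
  have h3 := LieModule.lie_mem_maxGenEigenspace_toEnd h1 h2
  rw [Module.End.mem_maxGenEigenspace, add_zero] at h3
  obtain ⟨K, hK⟩ := h3
  rw [zero_smul, sub_zero] at hK
  exact ⟨K, hK⟩

theorem exists_pow_eq_zero (ρ : L →ₗ⁅ℂ⁆ Module.End ℂ V) {f : L}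
    (hf : _root_.IsNilpotent (LieAlgebra.ad ℂ L f)) {X : Set V} (hX : repSpan ρ X = ⊤)
    (h : ∀ u ∈ X, ∃ K : ℕ, (ρ f ^ K) u = 0) (u : V) : ∃ K : ℕ, (ρ f ^ K) u = 0 := by
  let N : Submodule ℂ V :=
    { carrier := {u | ∃ K : ℕ, (ρ f ^ K) u = 0}
      zero_mem' := ⟨0, by simp⟩
      add_mem' := by
        rintro a b ⟨j, hj⟩ ⟨k, hk⟩
        refine ⟨max j k, ?_⟩
        rw [map_add, Module.End.pow_map_zero_of_le (le_max_left j k) hj,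
          Module.End.pow_map_zero_of_le (le_max_right j k) hk, add_zero]
      smul_mem' := by
        rintro c a ⟨j, hj⟩
        exact ⟨j, by rw [map_smul, hj, smul_zero]⟩ }
  have h1 : repSpan ρ X ≤ N := repSpan_le h fun x u hu => exists_pow_eq_zero_of_ad_nilpotent ρ hf hu
  rw [hX] at h1
  exact h1 (Submodule.mem_top (x := u))

/-- A nonzero vector annihilated by a power of an operator has a nonzero image under some power
that the operator annihilates. -/
theorem exists_pow_ne_zero {e : Module.End ℂ V} {u : V} (h0 : u ≠ 0)
    (h : ∃ K : ℕ, (e ^ K) u = 0) : ∃ k : ℕ, (e ^ k) u ≠ 0 ∧ e ((e ^ k) u) = 0 := by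
  classical
  obtain ⟨n, hn⟩ : ∃ n, Nat.find h = n + 1 := by
    refine Nat.exists_eq_succ_of_ne_zero fun h1 => h0 ?_
    have := Nat.find_spec h
    rwa [h1, pow_zero, Module.End.one_apply] at this
  refine ⟨n, Nat.find_min h (by omega), ?_⟩
  have := Nat.find_spec h
  rwa [hn, pow_succ', Module.End.mul_apply] at this

variable {T : Type*} [AddCommGroup T] [Module ℂ T] {η : T →ₗ[ℂ] L} {ρ : L →ₗ⁅ℂ⁆ Module.End ℂ V}

theorem pow_mem_wt {β μ : Dual ℂ T} {x : L} (hx : ∀ h, ⁅η h, x⁆ = β h • x) {v : V}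
    (hv : v ∈ wt (ρ.toLinearMap ∘ₗ η) μ) (k : ℕ) :
    (ρ x ^ k) v ∈ wt (ρ.toLinearMap ∘ₗ η) (μ + k • β) := by
  induction k with
  | zero => simpa using hv
  | succ k ih =>
    rw [pow_succ', Module.End.mul_apply, succ_nsmul, ← add_assoc]
    exact rep_mem_wt hx ih

end LocallyNilpotent

/-! ### Integrable highest weight representations of `𝔤`: reflections of weights and finite
dimension -/

section Integrable

variable {g : Type v} [LieRing g] [LieAlgebra ℂ g] [FiniteDimensional ℂ g] [IsSimple ℂ g]
  {H : LieSubalgebra ℂ g} [H.IsCartanSubalgebra] {b : (rootSystem H).Base}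
  {V : Type*} [AddCommGroup V] [Module ℂ V]

/-- The weight space `V_μ` of a representation of `𝔤`. -/
abbrev wtG (H : LieSubalgebra ℂ g) (ρ : g →ₗ⁅ℂ⁆ Module.End ℂ V) (μ : Dual ℂ H) : Submodule ℂ V :=
  wt (ρ.toLinearMap ∘ₗ (H.incl : H →ₗ[ℂ] g)) μ

variable {ρ : g →ₗ⁅ℂ⁆ Module.End ℂ V}

theorem eVec_mem_wtG (α : H.root) {μ : Dual ℂ H} {v : V} (hv : v ∈ wtG H ρ μ) :
    ρ (eVec α) v ∈ wtG H ρ (μ + (rootSystem H).root α) :=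
  rep_mem_wt (lie_h_eVec α) hv

theorem fVec_mem_wtG (α : H.root) {μ : Dual ℂ H} {v : V} (hv : v ∈ wtG H ρ μ) :
    ρ (fVec α) v ∈ wtG H ρ (μ + -(rootSystem H).root α) :=
  rep_mem_wt (lie_h_fVec α) hv

theorem eVec_pow_mem_wtG (α : H.root) {μ : Dual ℂ H} {v : V} (hv : v ∈ wtG H ρ μ) (k : ℕ) :
    (ρ (eVec α) ^ k) v ∈ wtG H ρ (μ + k • (rootSystem H).root α) :=
  pow_mem_wt (lie_h_eVec α) hv k

theorem fVec_pow_mem_wtG (α : H.root) {μ : Dual ℂ H} {v : V} (hv : v ∈ wtG H ρ μ) (k : ℕ) :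
    (ρ (fVec α) ^ k) v ∈ wtG H ρ (μ + k • -(rootSystem H).root α) :=
  pow_mem_wt (lie_h_fVec α) hv k

theorem triple_ef (ρ : g →ₗ⁅ℂ⁆ Module.End ℂ V) (α : H.root) :
    ρ (eVec α) * ρ (fVec α) - ρ (fVec α) * ρ (eVec α) = ρ (coroot α.1 : g) := by
  rw [← LieRing.of_associative_ring_bracket, ← LieHom.map_lie, (triple α).lie_e_f]

theorem triple_hf (ρ : g →ₗ⁅ℂ⁆ Module.End ℂ V) (α : H.root) :
    ρ (coroot α.1 : g) * ρ (fVec α) - ρ (fVec α) * ρ (coroot α.1 : g) = -(2 : ℂ) • ρ (fVec α) := by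
  rw [← LieRing.of_associative_ring_bracket, ← LieHom.map_lie, lie_h_fVec,
    root_apply_coroot (root_isNonZero α), map_smul]

theorem triple_he (ρ : g →ₗ⁅ℂ⁆ Module.End ℂ V) (α : H.root) :
    ρ (coroot α.1 : g) * ρ (eVec α) - ρ (eVec α) * ρ (coroot α.1 : g) = (2 : ℂ) • ρ (eVec α) := by
  rw [← LieRing.of_associative_ring_bracket, ← LieHom.map_lie, lie_h_eVec,
    root_apply_coroot (root_isNonZero α), map_smul]

variable (H ρ) in
/-- The set of weights of a representation. -/
def wtSet : Set (Dual ℂ H) := {ν | wtG H ρ ν ≠ ⊥}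

theorem mem_wtSet {ν : Dual ℂ H} {u : V} (hu : u ∈ wtG H ρ ν) (h0 : u ≠ 0) : ν ∈ wtSet H ρ :=
  fun h => h0 (by rw [h] at hu; exact hu)

/-- Raise `u` to a primitive vector `e ^ k u`, of `𝔰𝔩₂`-weight `n = ν(h_i) + 2k`. The vectors `f ^ j
e ^ k u` are nonzero for `j ≤ n`, and `j = n - k` gives the reflected weight `ν - ν(h_i) α_i`. -/
theorem reflection_mem_wtSet (i : H.root) (he : ∀ u : V, ∃ K : ℕ, (ρ (eVec i) ^ K) u = 0)
    (hf : ∀ u : V, ∃ K : ℕ, (ρ (fVec i) ^ K) u = 0) {ν : Dual ℂ H} (hν : ν ∈ wtSet H ρ) :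
    (rootSystem H).reflection i ν ∈ wtSet H ρ := by
  obtain ⟨u, hu, h0⟩ := (Submodule.ne_bot_iff _).mp hν
  have hroot : (rootSystem H).root i (coroot i.1) = 2 := root_apply_coroot (root_isNonZero i)
  have hrefl : (rootSystem H).reflection i ν = ν - ν (coroot i.1) • (rootSystem H).root i := by
    rw [RootPairing.reflection_apply]; rfl
  obtain ⟨k, hk, hk0⟩ := exists_pow_ne_zero h0 (he u)
  have hwk := eVec_pow_mem_wtG i hu k
  have hhk : ρ (coroot i.1 : g) ((ρ (eVec i) ^ k) u) =
      (ν (coroot i.1) + k * 2) • (ρ (eVec i) ^ k) u := by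
    have := hwk (coroot i.1)
    change _ = (ν (coroot i.1) + (k • (rootSystem H).root i) (coroot i.1)) • _ at this
    rw [LinearMap.smul_apply, hroot, nsmul_eq_mul] at this
    exact this
  obtain ⟨K, hK⟩ := hf ((ρ (eVec i) ^ k) u)
  obtain ⟨n, hn, -, hj⟩ := sl2_weight_nat (triple_ef ρ i) (triple_hf ρ i) hk hk0 hhk hK
  by_cases hle : k ≤ n
  · have hw := fVec_pow_mem_wtG i hwk (n - k)
    refine mem_wtSet (u := (ρ (fVec i) ^ (n - k)) ((ρ (eVec i) ^ k) u)) ?_ (hj _ (by omega))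
    convert hw using 2
    rw [hrefl, eq_sub_of_add_eq hn]
    ext h
    change ν h - ((n : ℂ) - k * 2) * i.1 h = ν h + (k • (rootSystem H).root i) h +
      ((n - k) • (-(rootSystem H).root i)) h
    rw [LinearMap.smul_apply, LinearMap.smul_apply, LinearMap.neg_apply, nsmul_eq_mul, nsmul_eq_mul,
      Nat.cast_sub hle]
    change _ = ν h + k * i.1 h + (n - k) * (-(i.1 h))
    ring
  -- Rather than excluding `k > n`, the same argument is run from the bottom of the string with `e`
  -- and `f` exchanged. Since `n + m = 2k + 2l`, the inequality `k > n` implies `l ≤ m`.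
  · obtain ⟨l, hl, hl0⟩ := exists_pow_ne_zero h0 (hf u)
    have hwl := fVec_pow_mem_wtG i hu l
    have hhl : (-ρ (coroot i.1 : g)) ((ρ (fVec i) ^ l) u) =
        (-ν (coroot i.1) + l * 2) • (ρ (fVec i) ^ l) u := by
      have := hwl (coroot i.1)
      change _ = (ν (coroot i.1) + (l • (-(rootSystem H).root i)) (coroot i.1)) • _ at this
      rw [LinearMap.smul_apply, LinearMap.neg_apply, hroot, nsmul_eq_mul] at this
      rw [LinearMap.neg_apply]
      refine (congrArg Neg.neg this).trans ?_
      rw [← neg_smul]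
      congr 1
      ring
    obtain ⟨K, hK⟩ := he ((ρ (fVec i) ^ l) u)
    obtain ⟨m, hm, -, hj'⟩ := sl2_weight_nat (h := -ρ (coroot i.1 : g)) (e := ρ (fVec i))
      (f := ρ (eVec i)) (by rw [← triple_ef ρ i]; abel)
      (by rw [neg_smul, ← triple_he ρ i, neg_mul, mul_neg]; abel) hl hl0 hhl hK
    have h1 : (n : ℂ) + m = 2 * k + 2 * l := by rw [← hn, ← hm]; ring
    have h2 : n + m = 2 * k + 2 * l := by exact_mod_cast h1
    have hle' : l ≤ m := by omega
    have hw := eVec_pow_mem_wtG i hwl (m - l)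
    refine mem_wtSet (u := (ρ (eVec i) ^ (m - l)) ((ρ (fVec i) ^ l) u)) ?_ (hj' _ (by omega))
    convert hw using 2
    have h3 : ν (coroot i.1) = l * 2 - m := by rw [← hm]; ring
    rw [hrefl, h3]
    ext h
    change ν h - ((l : ℂ) * 2 - m) * i.1 h = ν h + (l • (-(rootSystem H).root i)) h +
      ((m - l) • ((rootSystem H).root i)) h
    rw [LinearMap.smul_apply, LinearMap.smul_apply, LinearMap.neg_apply, nsmul_eq_mul, nsmul_eq_mul,
      Nat.cast_sub hle']
    change _ = ν h + l * (-i.1 h) + (m - l) * ((i.1 h))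
    ring

variable (b) in
/-- A representation generated by a highest weight vector on which the simple lowering operators
are nilpotent. -/
structure IntegrableHW (ρ : g →ₗ⁅ℂ⁆ Module.End ℂ V) (μ : Dual ℂ H) (v : V) : Prop where
  weight : v ∈ wtG H ρ μ
  pos : ∀ α, b.IsPos α → ρ (eVec α) v = 0
  nil : ∀ i ∈ b.support, ∃ K : ℕ, (ρ (fVec i) ^ K) v = 0
  gen : repSpan ρ {v} = ⊤

namespace IntegrableHW

variable {μ : Dual ℂ H} {v : V} (h : IntegrableHW b ρ μ v)
include h

theorem pos' {x : g} (hx : x ∈ posSet b) : ρ x v = 0 := by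
  obtain ⟨α, hα, hx⟩ := hx
  obtain ⟨c, rfl⟩ := exists_smul_eVec hx
  rw [map_smul, LinearMap.smul_apply, h.pos α hα, smul_zero]

theorem le_sup : (⊤ : Submodule ℂ V) ≤ Submodule.span ℂ {v} ⊔
    wtSum (ρ.toLinearMap ∘ₗ (H.incl : H →ₗ[ℂ] g)) (below (posCone b) μ) := by
  have h1 : repSpan ρ (Submodule.span ℂ {v} : Set V) = ⊤ := by
    rw [eq_top_iff, ← h.gen]
    exact repSpan_le (fun x hx => subset_repSpan _ (Submodule.subset_span hx))
      fun x u hu => repSpan_stable _ x hu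
  rw [← h1]
  refine repSpan_le_sup (fun x hx hx' => posCone_pointed b hx hx') (span_triangular b)
    (fun x hx => negSet_lie b hx) ?_ ?_
  · rintro x (hx | hx) u hu
    all_goals obtain ⟨c, rfl⟩ := Submodule.mem_span_singleton.mp hu; rw [map_smul]
    · rw [h.pos' hx, smul_zero]; exact zero_mem _
    · refine Submodule.smul_mem _ _ ?_
      have := h.weight ⟨x, hx⟩
      change ρ x v = _ at this
      rw [this]
      exact Submodule.smul_mem _ _ (Submodule.mem_span_singleton_self v)
  · exact (Submodule.span_singleton_le_iff_mem _ _).mpr h.weight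

theorem wtSum_eq_top : wtSum (ρ.toLinearMap ∘ₗ (H.incl : H →ₗ[ℂ] g)) {ν | μ - ν ∈ posCone b} = ⊤ := by
  rw [eq_top_iff]
  refine h.le_sup.trans (sup_le ?_ (wtSum_mono fun ν hν => hν.1))
  rw [Submodule.span_singleton_le_iff_mem]
  refine wt_le_wtSum (μ := μ) ?_ h.weight
  change μ - μ ∈ posCone b
  rw [sub_self]; exact zero_mem _

theorem sub_mem_posCone {ν : Dual ℂ H} (hν : ν ∈ wtSet H ρ) : μ - ν ∈ posCone b := by
  obtain ⟨u, hu, h0⟩ := (Submodule.ne_bot_iff _).mp hν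
  exact mem_of_mem_wtSum (Ω := {ν | μ - ν ∈ posCone b}) (by rw [h.wtSum_eq_top]; trivial) hu h0

theorem mem_span_of_mem_wtG {u : V} (hu : u ∈ wtG H ρ μ) : u ∈ Submodule.span ℂ {v} := by
  obtain ⟨x, hx, z, hz, rfl⟩ := Submodule.mem_sup.mp (h.le_sup (Submodule.mem_top (x := u)))
  have hx' : x ∈ wtG H ρ μ := (Submodule.span_singleton_le_iff_mem _ _).mpr h.weight hx
  have hz' : z ∈ wtG H ρ μ := by
    have := sub_mem hu hx'
    rwa [add_sub_cancel_left] at this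
  by_cases h0 : z = 0
  · rw [h0, add_zero]; exact hx
  · exact absurd rfl (mem_of_mem_wtSum hz hz' h0).2

theorem eVec_nil {i : H.root} (hi : i ∈ b.support) (u : V) : ∃ K : ℕ, (ρ (eVec i) ^ K) u = 0 := by
  refine exists_pow_eq_zero ρ
    (LieAlgebra.isNilpotent_ad_of_mem_rootSpace H (root_isNonZero i) (eVec_mem i)) h.gen ?_ u
  rintro u rfl
  exact ⟨1, by rw [pow_one]; exact h.pos i (RootPairing.Base.isPos_of_mem_support hi)⟩

theorem fVec_nil {i : H.root} (hi : i ∈ b.support) (u : V) : ∃ K : ℕ, (ρ (fVec i) ^ K) u = 0 := by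
  refine exists_pow_eq_zero ρ
    (LieAlgebra.isNilpotent_ad_of_mem_rootSpace H (χ := -(i.1 : H → ℂ)) ?_ (fVec_mem i)) h.gen ?_ u
  · exact neg_ne_zero.mpr (root_isNonZero i)
  · rintro u rfl
    exact h.nil i hi

theorem exists_depth : ∃ N : ℕ, ∀ ν ∈ wtSet H ρ, ∀ n : ℕ, ht b (μ - ν) = n → n ≤ N :=
  exists_depth_bound b (wtSet H ρ) μ
    (fun i hi _ hν => reflection_mem_wtSet i (h.eVec_nil hi) (h.fVec_nil hi) hν)
    fun _ hν => h.sub_mem_posCone hν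

/-- A word of length `k` in negative root vectors has depth at least `k` when applied to `v`. The
depth of a weight is bounded, so long words vanish, and there are finitely many words of each
length. -/
theorem finiteDimensional : FiniteDimensional ℂ V := by
  classical
  obtain ⟨N, hN⟩ := h.exists_depth
  let S : Set g := {x | ∃ α : H.root, b.IsPos α ∧ x = fVec α}
  let W : ℕ → Set V := fun k => k.rec {v} fun _ X => ⋃ α : H.root, ρ (fVec α) '' X
  have hfin : ∀ k, (W k).Finite := by
    intro k
    induction k with
    | zero => exact Set.finite_singleton v
    | succ k ih => exact Set.finite_iUnion fun α => ih.image _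
  let W' : ℕ → Set V := fun k => {w | w ∈ W k ∧ ∃ ν, w ∈ wtG H ρ ν ∧ μ - ν ∈ posCone b ∧
    ∃ n : ℕ, ht b (μ - ν) = n ∧ k ≤ n}
  have hspan : Submodule.span ℂ (S ∪ (posSet b ∪ (H : Set g))) = ⊤ := by
    rw [eq_top_iff, ← span_triangular b, Submodule.span_le]
    rintro x (⟨α, hα, hx⟩ | hx)
    · obtain ⟨c, rfl⟩ := exists_smul_fVec hx
      exact Submodule.smul_mem _ _ (Submodule.subset_span (Or.inl ⟨α, hα, rfl⟩))
    · exact Submodule.subset_span (Or.inr hx)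
  have hwords : ∀ u, WordReach ρ S (Submodule.span ℂ {v} : Set V) u →
      ∃ (c : ℂ) (k : ℕ), ∃ w ∈ W' k, u = c • w := by
    intro u hu
    induction hu with
    | base u hu =>
      obtain ⟨c, rfl⟩ := Submodule.mem_span_singleton.mp hu
      refine ⟨c, 0, v, ⟨rfl, μ, h.weight, ?_, 0, ?_, le_rfl⟩, rfl⟩
      · rw [sub_self]; exact zero_mem _
      · rw [sub_self, map_zero, Nat.cast_zero]
    | step x u hx _ ih =>
      obtain ⟨α, hα, rfl⟩ := hx
      obtain ⟨c, k, w, ⟨hw, ν, hν, hC, n, hn, hkn⟩, rfl⟩ := ih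
      obtain ⟨m, hm, hm0⟩ := exists_ht b (root_mem_posCone b hα)
      have hsub : μ - (ν + -(rootSystem H).root α) = (μ - ν) + (rootSystem H).root α := by abel
      refine ⟨c, k + 1, ρ (fVec α) w, ⟨Set.mem_iUnion.mpr ⟨α, w, hw, rfl⟩, _,
        fVec_mem_wtG α hν, ?_, n + m, ?_, ?_⟩, map_smul _ _ _⟩
      · rw [hsub]; exact add_mem hC (root_mem_posCone b hα)
      · rw [hsub, map_add, hn, hm, Nat.cast_add]
      · have : m ≠ 0 := fun h0 => (rootSystem H).ne_zero α (hm0 h0)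
        omega
  have hle : (⊤ : Submodule ℂ V) ≤ Submodule.span ℂ (⋃ k ∈ Finset.range (N + 1), W k) := by
    have h1 : repSpan ρ (Submodule.span ℂ {v} : Set V) = ⊤ := by
      rw [eq_top_iff, ← h.gen]
      exact repSpan_le (fun x hx => subset_repSpan _ (Submodule.subset_span hx))
        fun x u hu => repSpan_stable _ x hu
    rw [← h1]
    refine (repSpan_le_wordSpan hspan ?_).trans (Submodule.span_le.mpr ?_)
    · rintro x (hx | hx) u hu
      all_goals obtain ⟨c, rfl⟩ := Submodule.mem_span_singleton.mp hu; rw [map_smul]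
      · rw [h.pos' hx, smul_zero]; exact zero_mem _
      · refine Submodule.smul_mem _ _ ?_
        have := h.weight ⟨x, hx⟩
        change ρ x v = _ at this
        rw [this]
        exact Submodule.smul_mem _ _ (Submodule.mem_span_singleton_self v)
    · intro u hu
      obtain ⟨c, k, w, ⟨hw, ν, hν, hC, n, hn, hkn⟩, rfl⟩ := hwords u hu
      refine Submodule.smul_mem _ _ ?_
      by_cases h0 : w = 0
      · rw [h0]; exact zero_mem _
      · have := hN ν (mem_wtSet hν h0) n hn
        exact Submodule.subset_span (Set.mem_biUnion
          (Finset.mem_coe.mpr (Finset.mem_range.mpr (by omega : k < N + 1))) hw)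
  exact ⟨⟨(Set.Finite.biUnion (Finset.finite_toSet (Finset.range (N + 1)))
    fun k _ => hfin k).toFinset, by rw [Set.Finite.coe_toFinset]; exact top_le_iff.mp hle⟩⟩

end IntegrableHW

end Integrable
/-! ### The Casimir operator -/

section Casimir

variable {g : Type v} [LieRing g] [LieAlgebra ℂ g] [FiniteDimensional ℂ g] [IsSimple ℂ g]
  (H : LieSubalgebra ℂ g) [H.IsCartanSubalgebra]

/-- The index set of a basis of `𝔤` adapted to the root space decomposition. -/
abbrev CasIdx := Fin (finrank ℂ H) ⊕ H.root

/-- A basis of `𝔤` adapted to the root space decomposition. -/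
def casVec : CasIdx H → g
  | Sum.inl i => (Module.finBasis ℂ H i : g)
  | Sum.inr α => eVec α

/-- The dual basis with respect to the Killing form. -/
def casDual : CasIdx H → g
  | Sum.inl i => ((cartanEquivDual H).symm ((Module.finBasis ℂ H).coord i) : g)
  | Sum.inr α => (killingForm ℂ g (eVec α) (fVec α))⁻¹ • fVec α

variable {H}

/-- The vector `t_μ ∈ 𝔥` that represents `μ ∈ 𝔥*` with respect to the Killing form. -/
abbrev tVec (μ : Dual ℂ H) : H := (cartanEquivDual H).symm μ

theorem killingForm_tVec (μ : Dual ℂ H) (h : H) : killingForm ℂ g (tVec μ) h = μ h := by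
  have : cartanEquivDual H (tVec μ) h = μ h := by rw [LinearEquiv.apply_symm_apply]
  rw [← this]; rfl

theorem lie_eVec_fVec (α : H.root) :
    ⁅eVec α, fVec α⁆ = killingForm ℂ g (eVec α) (fVec α) • (tVec α.1.toLinear : g) :=
  lie_eq_killingForm_smul_of_mem_rootSpace_of_mem_rootSpace_neg (eVec_mem α) (fVec_mem α)

theorem killingForm_eVec_fVec_ne_zero (α : H.root) : killingForm ℂ g (eVec α) (fVec α) ≠ 0 := by
  intro h0
  have h1 := lie_eVec_fVec α
  rw [h0, zero_smul, (triple α).lie_e_f] at h1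
  exact (triple α).h_ne_zero h1

theorem lie_casVec_casDual (α : H.root) :
    ⁅casVec H (Sum.inr α), casDual H (Sum.inr α)⁆ = (tVec α.1.toLinear : g) := by
  change ⁅eVec α, (killingForm ℂ g (eVec α) (fVec α))⁻¹ • fVec α⁆ = _
  rw [lie_smul, lie_eVec_fVec, inv_smul_smul₀ (killingForm_eVec_fVec_ne_zero α)]

theorem exists_neg_root (α : H.root) : ∃ β : H.root, (β.1 : H → ℂ) = -(α.1 : H → ℂ) := by
  let := (rootSystem H).indexNeg
  exact ⟨-α, funext fun h => LinearMap.congr_fun (root_neg' α) h⟩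

theorem span_roots (b : (rootSystem H).Base) :
    Submodule.span ℂ (Set.range (eVec (H := H)) ∪ (H : Set g)) = ⊤ := by
  rw [eq_top_iff, ← span_triangular b, Submodule.span_le]
  rintro x (⟨α, -, hx⟩ | ⟨α, -, hx⟩ | hx)
  · obtain ⟨β, hβ⟩ := exists_neg_root α
    rw [← hβ] at hx
    obtain ⟨c, rfl⟩ := exists_smul_eVec hx
    exact Submodule.smul_mem _ _ (Submodule.subset_span (Or.inl ⟨β, rfl⟩))
  · obtain ⟨c, rfl⟩ := exists_smul_eVec hx
    exact Submodule.smul_mem _ _ (Submodule.subset_span (Or.inl ⟨α, rfl⟩))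
  · exact Submodule.subset_span (Or.inr hx)

theorem killingForm_eq_zero_of_ne {χ ψ : H → ℂ} {x y : g} (hx : x ∈ rootSpace H χ)
    (hy : y ∈ rootSpace H ψ) (h : χ + ψ ≠ 0) : killingForm ℂ g x y = 0 :=
  LieAlgebra.killingForm_apply_eq_zero_of_mem_rootSpace_of_add_ne_zero ℂ g H hx hy h

theorem cartan_mem_rootSpace (h : H) : (h : g) ∈ rootSpace H (0 : H → ℂ) := by
  rw [rootSpace_zero_eq]; exact h.2

theorem root_fun_ne_zero (α : H.root) : (α.1 : H → ℂ) ≠ 0 := root_isNonZero α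

theorem sum_casVec (b : (rootSystem H).Base) (y : g) :
    ∑ k, killingForm ℂ g y (casDual H k) • casVec H k = y := by
  let F : g →ₗ[ℂ] g := ∑ k, ((killingForm ℂ g).flip (casDual H k)).smulRight (casVec H k)
  suffices F = LinearMap.id by
    have := LinearMap.congr_fun this y
    simpa [F] using this
  refine LinearMap.ext_on (span_roots b) ?_
  have hF : ∀ y, F y = ∑ k, killingForm ℂ g y (casDual H k) • casVec H k := fun y => by simp [F]
  rintro x (⟨β, rfl⟩ | hx)
  · rw [hF, LinearMap.id_apply, Fintype.sum_sum_type, Finset.sum_eq_zero, zero_add,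
      Finset.sum_eq_single β]
    · change killingForm ℂ g (eVec β) ((killingForm ℂ g (eVec β) (fVec β))⁻¹ • fVec β) • eVec β = _
      rw [map_smul, smul_eq_mul, inv_mul_cancel₀ (killingForm_eVec_fVec_ne_zero β), one_smul]
    · intro α _ hα
      change killingForm ℂ g (eVec β) ((killingForm ℂ g (eVec α) (fVec α))⁻¹ • fVec α) • eVec α = _
      rw [map_smul, killingForm_eq_zero_of_ne (eVec_mem β) (fVec_mem α), smul_zero, zero_smul]
      intro h
      exact hα (Subtype.ext (DFunLike.coe_injective (add_neg_eq_zero.mp h).symm))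
    · exact fun h => absurd (Finset.mem_univ _) h
    · intro i _
      change killingForm ℂ g (eVec β) ((tVec ((Module.finBasis ℂ H).coord i) : H) : g) • _ = _
      rw [killingForm_eq_zero_of_ne (eVec_mem β) (cartan_mem_rootSpace _), zero_smul]
      rw [add_zero]; exact root_fun_ne_zero β
  · rw [hF, LinearMap.id_apply, Fintype.sum_sum_type, add_comm, Finset.sum_eq_zero, zero_add]
    · have h1 : ∀ i, killingForm ℂ g x (casDual H (Sum.inl i)) • casVec H (Sum.inl i) =
          (((Module.finBasis ℂ H).repr ⟨x, hx⟩ i • Module.finBasis ℂ H i : H) : g) := by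
        intro i
        have := killingForm_tVec ((Module.finBasis ℂ H).coord i) ⟨x, hx⟩
        rw [Module.Basis.coord_apply] at this
        rw [← this, LieModule.traceForm_comm]
        rfl
      simp_rw [h1]
      have h2 := congrArg (Subtype.val : H → g) ((Module.finBasis ℂ H).sum_repr ⟨x, hx⟩)
      exact (map_sum H.incl _ _).symm.trans h2
    · intro α _
      change killingForm ℂ g x ((killingForm ℂ g (eVec α) (fVec α))⁻¹ • fVec α) • eVec α = _
      rw [map_smul, killingForm_eq_zero_of_ne (cartan_mem_rootSpace ⟨x, hx⟩) (fVec_mem α),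
        smul_zero, zero_smul]
      rw [zero_add]; exact neg_ne_zero.mpr (root_fun_ne_zero α)

/-- The expansion in the dual basis follows from `sum_casVec` by pairing with an arbitrary `z`,
since the Killing form is nondegenerate. -/
theorem sum_casDual (b : (rootSystem H).Base) (y : g) :
    ∑ k, killingForm ℂ g y (casVec H k) • casDual H k = y := by
  rw [← sub_eq_zero, ← Submodule.mem_bot ℂ, ← ker_killingForm_eq_bot (R := ℂ) (L := g),
    LinearMap.mem_ker]
  ext z
  rw [map_sub, LinearMap.sub_apply, LinearMap.zero_apply, sub_eq_zero, map_sum, LinearMap.sum_apply]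
  conv_rhs => rw [← sum_casVec b z, map_sum]
  refine Finset.sum_congr rfl fun k _ => ?_
  rw [map_smul, map_smul, LinearMap.smul_apply, smul_eq_mul, smul_eq_mul, mul_comm,
    LieModule.traceForm_comm ℂ g g (casDual H k) z]

variable {V : Type*} [AddCommGroup V] [Module ℂ V]

variable (H) in
/-- The Casimir operator. -/
def casimir (ρ : g →ₗ⁅ℂ⁆ Module.End ℂ V) : Module.End ℂ V :=
  ∑ k, ρ (casVec H k) * ρ (casDual H k)

theorem casimir_apply (ρ : g →ₗ⁅ℂ⁆ Module.End ℂ V) (v : V) :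
    casimir H ρ v = ∑ k, ρ (casVec H k) (ρ (casDual H k) v) := by
  rw [casimir, LinearMap.sum_apply]; rfl

/-- By invariance of the Killing form, the matrices of `ad y` in the two dual bases are negative
transposes of each other, so the two families of commutator terms cancel. -/
theorem casimir_comm (b : (rootSystem H).Base) (ρ : g →ₗ⁅ℂ⁆ Module.End ℂ V) (y : g) (v : V) :
    casimir H ρ (ρ y v) = ρ y (casimir H ρ v) := by
  rw [casimir_apply, casimir_apply, map_sum, ← sub_eq_zero, ← neg_eq_zero, neg_sub,
    ← Finset.sum_sub_distrib]
  have h1 : ∀ k, ρ y (ρ (casVec H k) (ρ (casDual H k) v)) -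
      ρ (casVec H k) (ρ (casDual H k) (ρ y v)) =
      ρ ⁅y, casVec H k⁆ (ρ (casDual H k) v) + ρ (casVec H k) (ρ ⁅y, casDual H k⁆ v) := by
    intro k
    rw [rep_lie, rep_lie, map_sub]
    abel
  simp_rw [h1]
  rw [Finset.sum_add_distrib]
  have h2 : ∀ k, ρ ⁅y, casVec H k⁆ (ρ (casDual H k) v) =
      ∑ l, killingForm ℂ g ⁅y, casVec H k⁆ (casDual H l) • ρ (casVec H l) (ρ (casDual H k) v) := by
    intro k
    conv_lhs => rw [← sum_casVec b ⁅y, casVec H k⁆]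
    rw [map_sum, LinearMap.sum_apply]
    exact Finset.sum_congr rfl fun l _ => by rw [map_smul, LinearMap.smul_apply]
  have h3 : ∀ l, ρ (casVec H l) (ρ ⁅y, casDual H l⁆ v) =
      ∑ k, -killingForm ℂ g ⁅y, casVec H k⁆ (casDual H l) •
        ρ (casVec H l) (ρ (casDual H k) v) := by
    intro l
    conv_lhs => rw [← sum_casDual b ⁅y, casDual H l⁆]
    rw [map_sum, LinearMap.sum_apply, map_sum]
    refine Finset.sum_congr rfl fun k _ => ?_
    have h4 : killingForm ℂ g ⁅y, casDual H l⁆ (casVec H k) =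
        -killingForm ℂ g ⁅y, casVec H k⁆ (casDual H l) := by
      rw [LieModule.traceForm_apply_lie_apply', LieModule.traceForm_comm]
    rw [map_smul, LinearMap.smul_apply, map_smul, h4]
  simp_rw [h2, h3]
  rw [Finset.sum_comm, ← Finset.sum_add_distrib]
  refine Finset.sum_eq_zero fun l _ => ?_
  rw [← Finset.sum_add_distrib]
  exact Finset.sum_eq_zero fun k _ => by rw [neg_smul, add_neg_cancel]

open Classical in
/-- The scalar by which the Casimir operator acts on a primitive vector of weight `ν`. -/
def casScalar (b : (rootSystem H).Base) (ν : Dual ℂ H) : ℂ :=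
  ν (tVec ν) + ∑ α : H.root with b.IsPos α, ν (tVec α.1.toLinear)

/-- The Cartan part contributes `(ν, ν)`. For positive `α` the product acts as its commutator `t_α`,
because the first factor kills `u`. For negative `α` the second factor is a positive root vector and
kills `u`. -/
theorem casimir_primitive (b : (rootSystem H).Base) {ρ : g →ₗ⁅ℂ⁆ Module.End ℂ V} {ν : Dual ℂ H}
    {u : V} (hu : u ∈ wtG H ρ ν) (hpos : ∀ x ∈ posSet b, ρ x u = 0) :
    casimir H ρ u = casScalar b ν • u := by
  classical
  have hu' : ∀ h : H, ρ h u = ν h • u := hu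
  rw [casimir_apply, Fintype.sum_sum_type, casScalar, add_smul]
  congr 1
  · have h1 : ∀ i, ρ (casVec H (Sum.inl i)) (ρ (casDual H (Sum.inl i)) u) =
        (ν (tVec ((Module.finBasis ℂ H).coord i)) * ν (Module.finBasis ℂ H i)) • u := by
      intro i
      change ρ (Module.finBasis ℂ H i : g) (ρ ((tVec ((Module.finBasis ℂ H).coord i) : H) : g) u) = _
      rw [hu', map_smul, hu', smul_smul]
    simp_rw [h1]
    rw [← Finset.sum_smul]
    congr 1
    conv_rhs => rw [← (Module.finBasis ℂ H).sum_repr (tVec ν), map_sum]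
    refine Finset.sum_congr rfl fun i _ => ?_
    rw [map_smul, smul_eq_mul]
    congr 1
    rw [← killingForm_tVec ν, LieModule.traceForm_comm, ← Module.Basis.coord_apply,
      ← killingForm_tVec]
  · rw [Finset.sum_smul, Finset.sum_filter]
    refine Finset.sum_congr rfl fun α _ => ?_
    split_ifs with hα
    · have h1 := rep_lie ρ (casVec H (Sum.inr α)) (casDual H (Sum.inr α)) u
      rw [hpos (casVec H (Sum.inr α)) ⟨α, hα, eVec_mem α⟩, map_zero, sub_zero,
        lie_casVec_casDual, hu'] at h1
      exact h1.symm
    · have h1 : fVec α ∈ posSet b := by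
        obtain ⟨β, hβ, hαβ⟩ := (pos_or_neg b α).resolve_left hα
        refine ⟨β, hβ, ?_⟩
        have := fVec_mem α
        rwa [hαβ, neg_neg] at this
      change ρ _ (ρ ((killingForm ℂ g (eVec α) (fVec α))⁻¹ • fVec α) u) = 0
      rw [map_smul, LinearMap.smul_apply, hpos _ h1, smul_zero, map_zero]

end Casimir
-- Positivity of the form and irreducibility of integrable highest weight representations
section CasimirPositive

variable {g : Type v} [LieRing g] [LieAlgebra ℂ g] [FiniteDimensional ℂ g] [IsSimple ℂ g]
  {H : LieSubalgebra ℂ g} [H.IsCartanSubalgebra] (b : (rootSystem H).Base)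

theorem tVec_symm (μ ν : Dual ℂ H) : μ (tVec ν) = ν (tVec μ) := by
  rw [← killingForm_tVec μ, LieModule.traceForm_comm, killingForm_tVec]

/-- Each `t_α` is a positive multiple of the coroot, so a functional positive at the simple coroots
is strictly positive at `t_γ` for every nonzero `γ ∈ Q⁺`. -/
theorem exists_nonneg_of_posCone {φ : Dual ℂ H}
    (hφ : ∀ i ∈ b.support, ∃ r : ℝ, 0 < r ∧ φ (coroot i.1) = r) {γ : Dual ℂ H}
    (hγ : γ ∈ posCone b) : ∃ r : ℝ, 0 ≤ r ∧ φ (tVec γ) = r ∧ (r = 0 → γ = 0) := by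
  induction hγ using AddSubmonoid.closure_induction with
  | mem y hy =>
    obtain ⟨i, hi, rfl⟩ := hy
    obtain ⟨r, hr, hri⟩ := hφ i hi
    obtain ⟨c, hc, hci⟩ := exists_pos_coroot i
    refine ⟨c * r, by positivity, ?_, fun h => absurd h (by positivity)⟩
    change φ ((cartanEquivDual H).symm i.1.toLinear) = _
    rw [hci, map_smul, hri, smul_eq_mul, Complex.ofReal_mul]
  | zero => exact ⟨0, le_rfl, by simp, fun _ => rfl⟩
  | add y z _ _ hy hz =>
    obtain ⟨r, hr, hr1, hr2⟩ := hy
    obtain ⟨s, hs, hs1, hs2⟩ := hz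
    refine ⟨r + s, add_nonneg hr hs, ?_, fun h => ?_⟩
    · rw [show tVec (y + z) = tVec y + tVec z from map_add _ _ _, map_add, hr1, hs1, Complex.ofReal_add]
    · rw [hr2 (by linarith), hs2 (by linarith), add_zero]

/-- The difference of the scalars is `(μ + ν + 2ρ, μ - ν)`, with `2ρ` the sum of the positive roots.
The first entry takes values at least `2` at the simple coroots, and the second is a nonzero element
of `Q⁺`. -/
theorem casScalar_ne {μ ν : Dual ℂ H} (hμ : ∀ i ∈ b.support, ∃ n : ℕ, μ (coroot i.1) = n)
    (hν : ∀ i ∈ b.support, ∃ n : ℕ, ν (coroot i.1) = n) (h : μ - ν ∈ posCone b) (hne : μ ≠ ν) :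
    casScalar b μ ≠ casScalar b ν := by
  classical
  let S : Dual ℂ H := ∑ α : H.root with b.IsPos α, α.1.toLinear
  have hS : ∀ μ, casScalar b μ = μ (tVec μ) + S (tVec μ) := by
    intro μ
    rw [casScalar, LinearMap.sum_apply]
    congr 1
    exact Finset.sum_congr rfl fun α _ => tVec_symm _ _
  intro heq
  obtain ⟨r, -, hr1, hr2⟩ := exists_nonneg_of_posCone b (φ := μ + ν + S) (fun i hi => by
    obtain ⟨m, hm⟩ := hμ i hi
    obtain ⟨n, hn⟩ := hν i hi
    refine ⟨m + n + 2, by positivity, ?_⟩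
    rw [LinearMap.add_apply, LinearMap.add_apply, hm, hn, LinearMap.sum_apply]
    have := sum_pos_roots b hi
    simp only [LieModule.Weight.toLinear_apply]
    rw [this]
    push_cast
    rfl) h
  have h1 : (μ + ν + S) (tVec (μ - ν)) = 0 := by
    have h2 : tVec (μ - ν) = tVec μ - tVec ν := map_sub _ _ _
    rw [hS, hS] at heq
    have h3 := tVec_symm μ ν
    rw [h2]
    simp only [LinearMap.add_apply, map_sub]
    linear_combination heq - h3
  rw [h1] at hr1
  exact hne (sub_eq_zero.mp (hr2 (by exact_mod_cast hr1.symm)))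

variable {b} {V : Type*} [AddCommGroup V] [Module ℂ V] {ρ : g →ₗ⁅ℂ⁆ Module.End ℂ V}

namespace IntegrableHW

variable {μ : Dual ℂ H} {v : V} (h : IntegrableHW b ρ μ v)
include h

theorem dominant {ν : Dual ℂ H} {u : V} (hu : u ∈ wtG H ρ ν) (h0 : u ≠ 0)
    (hpos : ∀ x ∈ posSet b, ρ x u = 0) (i : H.root) (hi : i ∈ b.support) :
    ∃ n : ℕ, ν (coroot i.1) = n := by
  obtain ⟨K, hK⟩ := h.fVec_nil hi u
  obtain ⟨n, hn, -⟩ := sl2_weight_nat (triple_ef ρ i) (triple_hf ρ i) h0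
    (hpos _ ⟨i, RootPairing.Base.isPos_of_mem_support hi, eVec_mem i⟩) (hu (coroot i.1)) hK
  exact ⟨n, hn⟩

theorem casimir_eq (u : V) : casimir H ρ u = casScalar b μ • u := by
  let N : Submodule ℂ V := LinearMap.ker (casimir H ρ - casScalar b μ • LinearMap.id)
  have hmem : ∀ u, u ∈ N ↔ casimir H ρ u = casScalar b μ • u := fun u => by
    rw [LinearMap.mem_ker, LinearMap.sub_apply, sub_eq_zero]; rfl
  have h1 : repSpan ρ {v} ≤ N := by
    refine repSpan_le ?_ fun x u hu => ?_
    · rintro _ rfl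
      rw [SetLike.mem_coe, hmem]
      exact casimir_primitive b h.weight fun x hx => h.pos' hx
    · rw [hmem] at hu ⊢
      rw [casimir_comm b, hu, map_smul]
  rw [h.gen] at h1
  exact (hmem u).mp (h1 trivial)

/-- An integrable highest weight representation is irreducible. -/
theorem eq_top_of_stable {N : Submodule ℂ V} (hN : ∀ x, ∀ u ∈ N, ρ x u ∈ N) {u : V} (hu : u ∈ N)
    (h0 : u ≠ 0) : N = ⊤ := by
  classical
  -- A weight vector of `N` of least depth is primitive, since a raising operator would lower the
  -- depth. The Casimir operator acts on it by the scalar of `μ` and by that of its own dominant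
  -- weight, so the two weights agree.
  let Q : ℕ → Prop := fun n => ∃ ν : Dual ℂ H, ∃ u ∈ N, u ∈ wtG H ρ ν ∧ u ≠ 0 ∧ ht b (μ - ν) = n
  have hQ : ∃ n, Q n := by
    obtain ⟨ν, hν, x, hx, hxν, hx0⟩ := exists_wt_vector (τ := ρ.toLinearMap ∘ₗ (H.incl : H →ₗ[ℂ] g))
      N (fun h v hv => hN _ v hv) (Ω := {ν | μ - ν ∈ posCone b}) hu h0
      (by rw [h.wtSum_eq_top]; trivial)
    obtain ⟨n, hn, -⟩ := exists_ht b hν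
    exact ⟨n, ν, x, hx, hxν, hx0, hn⟩
  obtain ⟨ν, x, hx, hxν, hx0, hn⟩ := Nat.find_spec hQ
  have hmin : ∀ m, Q m → Nat.find hQ ≤ m := fun m hm => Nat.find_min' hQ hm
  have hpos : ∀ y ∈ posSet b, ρ y x = 0 := by
    rintro y ⟨α, hα, hy⟩
    obtain ⟨c, rfl⟩ := exists_smul_eVec hy
    rw [map_smul, LinearMap.smul_apply]
    by_contra hne
    have hne' : ρ (eVec α) x ≠ 0 := fun h1 => hne (by rw [h1, smul_zero])
    have hw := eVec_mem_wtG α hxν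
    obtain ⟨m, hm, -⟩ := exists_ht b (h.sub_mem_posCone (mem_wtSet hw hne'))
    obtain ⟨k, hk, hk0⟩ := exists_ht b (root_mem_posCone b hα)
    have h1 := hmin m ⟨_, _, hN _ _ hx, hw, hne', hm⟩
    have h2 : μ - ν = (μ - (ν + (rootSystem H).root α)) + (rootSystem H).root α := by abel
    rw [h2, map_add, hm, hk] at hn
    have h3 : m + k = Nat.find hQ := by exact_mod_cast hn
    have h4 : k ≠ 0 := fun h0 => (rootSystem H).ne_zero α (hk0 h0)
    omega
  have hv0 : v ≠ 0 := by
    rintro rfl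
    have : (⊤ : Submodule ℂ V) ≤ ⊥ := by
      rw [← h.gen]
      exact repSpan_le (by simp) (by simp)
    exact h0 ((Submodule.mem_bot ℂ).mp (this (Submodule.mem_top (x := u))))
  by_cases hνμ : ν = μ
  · subst hνμ
    obtain ⟨c, rfl⟩ := Submodule.mem_span_singleton.mp (h.mem_span_of_mem_wtG hxν)
    have hc : c ≠ 0 := fun hc => hx0 (by rw [hc, zero_smul])
    have hv : v ∈ N := (N.smul_mem_iff hc).mp hx
    rw [eq_top_iff, ← h.gen]
    exact repSpan_le (by simpa using hv) hN
  · exfalso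
    refine casScalar_ne b (μ := μ) (ν := ν) (h.dominant h.weight hv0 fun x hx => h.pos' hx)
      (h.dominant hxν hx0 hpos) (h.sub_mem_posCone (mem_wtSet hxν hx0)) (Ne.symm hνμ) ?_
    have h1 := casimir_primitive b hxν hpos
    rw [h.casimir_eq, ← sub_eq_zero, ← sub_smul, smul_eq_zero_iff_left hx0, sub_eq_zero] at h1
    exact h1

end IntegrableHW

end CasimirPositive

/-! ### Finite dimension and irreducibility of `V(μ)` -/

section SimpleMod

variable {g : Type v} [LieRing g] [LieAlgebra ℂ g] [FiniteDimensional ℂ g] [IsSimple ℂ g]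
  {H : LieSubalgebra ℂ g} [H.IsCartanSubalgebra] (b : (rootSystem H).Base) (μ : domWeights b)

theorem mk_smul_simpleGen (u : U g) : u • simpleGen b μ = Submodule.Quotient.mk u := by
  rw [simpleGen, ← Submodule.Quotient.mk_smul, smul_eq_mul, mul_one]

theorem smul_simpleGen_eq_zero {u : U g} (hu : u ∈ simpleRel b μ) : u • simpleGen b μ = 0 := by
  rw [mk_smul_simpleGen]; exact (Submodule.Quotient.mk_eq_zero _).mpr hu

theorem simpleMod_integrable :
    IntegrableHW b (actU g (SimpleMod b μ)) μ.1 (simpleGen b μ) where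
  weight h := by
    have h1 := smul_simpleGen_eq_zero b μ (u := iota (h : g) - algebraMap ℂ (U g) (μ.1 h))
      (Submodule.subset_span (Or.inl (Or.inr ⟨h, rfl⟩)))
    rw [sub_smul, algebraMap_smul, sub_eq_zero] at h1
    exact h1
  pos α hα := smul_simpleGen_eq_zero b μ (Submodule.subset_span
    (Or.inl (Or.inl ⟨α, root_mem_posCone b hα, _, eVec_mem α, rfl⟩)))
  nil i hi := by
    obtain ⟨n, hn⟩ := μ.2 i hi
    refine ⟨n + 1, ?_⟩
    have h1 := smul_simpleGen_eq_zero b μ (Submodule.subset_span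
      (Or.inr ⟨i, hi, fVec i, fVec_mem i, n, hn, rfl⟩))
    have h2 : ∀ k : ℕ, (actU g (SimpleMod b μ) (fVec i) ^ k) (simpleGen b μ) =
        (iota (fVec i) : U g) ^ k • simpleGen b μ := by
      intro k
      induction k with
      | zero => rw [pow_zero, pow_zero, one_smul, Module.End.one_apply]
      | succ k ih => rw [pow_succ', Module.End.mul_apply, ih, actU_apply, pow_succ', mul_smul]
    rw [h2, h1]
  gen := by
    rw [eq_top_iff]
    intro x _
    refine span_le_repSpan _ ?_
    obtain ⟨u, rfl⟩ := Submodule.Quotient.mk_surjective _ x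
    rw [← mk_smul_simpleGen]
    exact Submodule.smul_mem _ _ (Submodule.mem_span_singleton_self _)

instance : FiniteDimensional ℂ (SimpleMod b μ) := (simpleMod_integrable b μ).finiteDimensional

instance : IsSimpleModule (U g) (SimpleMod b μ) := by
  have : Nontrivial (SimpleMod b μ) := ⟨_, _, simpleGen_ne_zero b μ⟩
  refine (isSimpleModule_iff (U g) (SimpleMod b μ)).mpr
    { eq_bot_or_eq_top := fun N => or_iff_not_imp_left.mpr fun hN => ?_ }
  obtain ⟨u, hu, h0⟩ := (Submodule.ne_bot_iff _).mp hN
  have := (simpleMod_integrable b μ).eq_top_of_stable (N := N.restrictScalars ℂ)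
    (fun x u hu => N.smul_mem _ hu) hu h0
  rw [eq_top_iff]
  intro x _
  have hx : x ∈ N.restrictScalars ℂ := by rw [this]; trivial
  exact hx

end SimpleMod
/-! ### Highest weight modules for the current algebra -/

section CurrentHW

variable (A : Type u) [CommRing A] [Algebra ℂ A]
variable {g : Type v} [LieRing g] [LieAlgebra ℂ g] [FiniteDimensional ℂ g] [IsSimple ℂ g]
  {H : LieSubalgebra ℂ g} [H.IsCartanSubalgebra]

/-- The inclusion `𝔥 → 𝔤 ⊗ A`. -/
def curEta (H : LieSubalgebra ℂ g) : H →ₗ[ℂ] A ⊗[ℂ] g :=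
  (oneTensor A : g →ₗ⁅ℂ⁆ A ⊗[ℂ] g).toLinearMap ∘ₗ (H.incl : H →ₗ[ℂ] g)

theorem curEta_apply (h : H) : curEta A H h = 1 ⊗ₜ (h : g) := rfl

theorem curEta_lie {x : g} {β : Dual ℂ H} (hx : ∀ h : H, ⁅(h : g), x⁆ = β h • x) (a : A) (h : H) :
    ⁅curEta A H h, a ⊗ₜ[ℂ] x⁆ = β h • (a ⊗ₜ[ℂ] x) := by
  rw [curEta_apply, ExtendScalars.bracket_tmul, one_mul, hx, TensorProduct.tmul_smul]

variable (b : (rootSystem H).Base)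

/-- The elements `a ⊗ x` with `x` a negative root vector. -/
def curNeg : Set (A ⊗[ℂ] g) := {y | ∃ a : A, ∃ x ∈ negSet b, y = a ⊗ₜ x}

/-- The elements `a ⊗ x` with `x` a positive root vector. -/
def curPos : Set (A ⊗[ℂ] g) := {y | ∃ a : A, ∃ x ∈ posSet b, y = a ⊗ₜ x}

variable (H) in
/-- The elements `a ⊗ h` with `h ∈ 𝔥`. -/
def curCartan : Set (A ⊗[ℂ] g) := {y | ∃ (a : A) (h : H), y = a ⊗ₜ (h : g)}

theorem cur_span : Submodule.span ℂ (curNeg A b ∪ (curPos A b ∪ curCartan A H)) = ⊤ := by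
  rw [eq_top_iff]
  intro y _
  induction y using TensorProduct.induction_on with
  | zero => exact zero_mem _
  | add x y hx hy => exact add_mem (hx trivial) (hy trivial)
  | tmul a x =>
    have hx : x ∈ Submodule.span ℂ (negSet b ∪ (posSet b ∪ (H : Set g))) := by
      rw [span_triangular]; trivial
    refine (Submodule.span_le (p := (Submodule.span ℂ (curNeg A b ∪ (curPos A b ∪
      curCartan A H))).comap (TensorProduct.mk ℂ A g a))).mpr ?_ hx
    rintro x (hx | hx | hx)
    · exact Submodule.subset_span (Or.inl ⟨a, x, hx, rfl⟩)
    · exact Submodule.subset_span (Or.inr (Or.inl ⟨a, x, hx, rfl⟩))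
    · exact Submodule.subset_span (Or.inr (Or.inr ⟨a, ⟨x, hx⟩, rfl⟩))

theorem curNeg_lie : ∀ y ∈ curNeg A b, ∃ β ∈ posCone b, β ≠ 0 ∧
    ∀ h, ⁅curEta A H h, y⁆ = (-β) h • y := by
  rintro _ ⟨a, x, hx, rfl⟩
  obtain ⟨β, hβ, h0, h⟩ := negSet_lie b hx
  exact ⟨β, hβ, h0, curEta_lie A h a⟩

theorem curPos_lie : ∀ y ∈ curPos A b, ∃ β ∈ posCone b, β ≠ 0 ∧
    ∀ h, ⁅curEta A H h, y⁆ = β h • y := by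
  rintro _ ⟨a, x, hx, rfl⟩
  obtain ⟨β, hβ, h0, h⟩ := posSet_lie b hx
  exact ⟨β, hβ, h0, curEta_lie A h a⟩

variable {A b}
variable {V : Type*} [AddCommGroup V] [Module ℂ V] [Module (U (A ⊗[ℂ] g)) V]
  [IsScalarTower ℂ (U (A ⊗[ℂ] g)) V]
  {V' : Type*} [AddCommGroup V'] [Module ℂ V'] [Module (U (A ⊗[ℂ] g)) V']
  [IsScalarTower ℂ (U (A ⊗[ℂ] g)) V']

theorem curPos_mem_wtSpace {y : A ⊗[ℂ] g} (hy : y ∈ curPos A b) {μ : Dual ℂ H} {v : V}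
    (hv : v ∈ wtSpace A H V μ) : ∃ β ∈ posCone b, β ≠ 0 ∧
      (iota y : U (A ⊗[ℂ] g)) • v ∈ wtSpace A H V (μ + β) := by
  obtain ⟨β, hβ, h0, h⟩ := curPos_lie A b y hy
  exact ⟨β, hβ, h0, rep_mem_wt (ρ := actU (A ⊗[ℂ] g) V) h hv⟩

variable (b) in
/-- A highest weight vector with character `Λ`. -/
structure CurHW (v : V) (Λ : A → Dual ℂ H) : Prop where
  ne_zero : v ≠ 0
  pos : ∀ y ∈ curPos A b, (iota y : U (A ⊗[ℂ] g)) • v = 0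
  cartan : ∀ (a : A) (h : H), (iota (a ⊗ₜ[ℂ] (h : g)) : U (A ⊗[ℂ] g)) • v = Λ a h • v

namespace CurHW

variable {v : V} {Λ : A → Dual ℂ H} (hv : CurHW b v Λ) {v' : V'} {Λ' : A → Dual ℂ H}
  (hv' : CurHW b v' Λ')

include hv in
theorem mem_wtSpace : v ∈ wtSpace A H V (Λ 1) := fun h => hv.cartan 1 h

include hv in
theorem le_sup_of_span (hspan : Submodule.span (U (A ⊗[ℂ] g)) {v} = ⊤) :
    (⊤ : Submodule ℂ V) ≤ Submodule.span ℂ {v} ⊔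
      wtSum ((actU (A ⊗[ℂ] g) V).toLinearMap ∘ₗ curEta A H) (below (posCone b) (Λ 1)) := by
  have h1 : (⊤ : Submodule ℂ V) ≤ repSpan (actU (A ⊗[ℂ] g) V) (Submodule.span ℂ {v} : Set V) := by
    intro u _
    refine span_le_repSpan _ (Submodule.span_mono Submodule.subset_span ?_)
    rw [hspan]; trivial
  refine h1.trans (repSpan_le_sup (fun x hx hx' => posCone_pointed b hx hx') (cur_span A b)
    (curNeg_lie A b) ?_ ((Submodule.span_singleton_le_iff_mem _ _).mpr hv.mem_wtSpace))
  rintro x (hx | ⟨a, h, rfl⟩) u hu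
  all_goals obtain ⟨c, rfl⟩ := Submodule.mem_span_singleton.mp hu; rw [map_smul]
  · rw [actU_apply, hv.pos x hx, smul_zero]; exact zero_mem _
  · rw [actU_apply, hv.cartan]
    exact Submodule.smul_mem _ _ (Submodule.smul_mem _ _ (Submodule.mem_span_singleton_self v))

include hv in
theorem le_sup [IsSimpleModule (U (A ⊗[ℂ] g)) V] : (⊤ : Submodule ℂ V) ≤ Submodule.span ℂ {v} ⊔
    wtSum ((actU (A ⊗[ℂ] g) V).toLinearMap ∘ₗ curEta A H) (below (posCone b) (Λ 1)) :=
  hv.le_sup_of_span (IsSimpleModule.span_singleton_eq_top _ hv.ne_zero)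

include hv in
theorem wt_le [IsSimpleModule (U (A ⊗[ℂ] g)) V] {ν : Dual ℂ H} (hν : wtSpace A H V ν ≠ ⊥) :
    Λ 1 - ν ∈ posCone b := by
  obtain ⟨u, hu, h0⟩ := (Submodule.ne_bot_iff _).mp hν
  refine mem_of_mem_wtSum (τ := (actU (A ⊗[ℂ] g) V).toLinearMap ∘ₗ curEta A H)
    (Ω := {ν | Λ 1 - ν ∈ posCone b}) ?_ hu h0
  refine hv.le_sup.trans (sup_le ?_ (wtSum_mono fun ν hν => hν.1)) (Submodule.mem_top (x := u))
  rw [Submodule.span_singleton_le_iff_mem]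
  refine wt_le_wtSum (μ := Λ 1) ?_ hv.mem_wtSpace
  change Λ 1 - Λ 1 ∈ posCone b
  rw [sub_self]; exact zero_mem _

include hv in
theorem mem_span [IsSimpleModule (U (A ⊗[ℂ] g)) V] {u : V} (hu : u ∈ wtSpace A H V (Λ 1)) :
    ∃ c : ℂ, u = c • v := by
  obtain ⟨x, hx, z, hz, rfl⟩ := Submodule.mem_sup.mp (hv.le_sup (Submodule.mem_top (x := u)))
  obtain ⟨c, rfl⟩ := Submodule.mem_span_singleton.mp hx
  have hz' : z ∈ wtSpace A H V (Λ 1) := by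
    have := sub_mem hu ((wtSpace A H V (Λ 1)).smul_mem c hv.mem_wtSpace)
    rwa [add_sub_cancel_left] at this
  by_cases h0 : z = 0
  · exact ⟨c, by rw [h0, add_zero]⟩
  · exact absurd rfl (mem_of_mem_wtSum hz hz' h0).2

include hv hv' in
theorem nonempty_equiv [IsSimpleModule (U (A ⊗[ℂ] g)) V] [IsSimpleModule (U (A ⊗[ℂ] g)) V']
    (h : ∀ a h, Λ a h = Λ' a h) : Nonempty (V ≃ₗ[U (A ⊗[ℂ] g)] V') := by
  have h1 : Λ 1 = Λ' 1 := LinearMap.ext (h 1)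
  refine nonempty_equiv_of_highest_weight (fun x hx hx' => posCone_pointed b hx hx')
    (cur_span A b) (curNeg_lie A b) hv.ne_zero hv'.ne_zero (μ := Λ 1) hv.mem_wtSpace
    (by rw [h1]; exact hv'.mem_wtSpace) ?_
  rintro x (hx | ⟨a, k, rfl⟩)
  · exact ⟨0, by rw [hv.pos x hx, zero_smul], by rw [hv'.pos x hx, zero_smul]⟩
  · exact ⟨Λ a k, hv.cartan a k, by rw [h a k]; exact hv'.cartan a k⟩

theorem map_mem_wtSpace (f : V →ₗ[U (A ⊗[ℂ] g)] V') {ν : Dual ℂ H} {u : V}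
    (hu : u ∈ wtSpace A H V ν) : f u ∈ wtSpace A H V' ν := by
  intro h
  rw [← map_smul, hu h, ← LinearMap.restrictScalars_apply ℂ, map_smul]
  rfl

-- An isomorphism carries each highest weight to a weight of the other module, so the two dominate
-- each other and coincide. The highest weight spaces are lines, hence correspond, and the action of
-- `𝔥 ⊗ A` on them can be compared.
include hv hv' in
theorem char_eq [IsSimpleModule (U (A ⊗[ℂ] g)) V] [IsSimpleModule (U (A ⊗[ℂ] g)) V']
    (f : V ≃ₗ[U (A ⊗[ℂ] g)] V') (a : A) : Λ a = Λ' a := by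
  have hf : f v ∈ wtSpace A H V' (Λ 1) := map_mem_wtSpace f.toLinearMap hv.mem_wtSpace
  have hf' : f.symm v' ∈ wtSpace A H V (Λ' 1) := map_mem_wtSpace f.symm.toLinearMap hv'.mem_wtSpace
  have hf0 : f v ≠ 0 := f.map_ne_zero_iff.mpr hv.ne_zero
  have h1 : Λ' 1 - Λ 1 ∈ posCone b := hv'.wt_le ((Submodule.ne_bot_iff _).mpr ⟨_, hf, hf0⟩)
  have h2 : Λ 1 - Λ' 1 ∈ posCone b := hv.wt_le ((Submodule.ne_bot_iff _).mpr
    ⟨_, hf', f.symm.map_ne_zero_iff.mpr hv'.ne_zero⟩)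
  have h3 : Λ' 1 = Λ 1 := sub_eq_zero.mp (posCone_pointed b h1 (by rwa [neg_sub]))
  rw [← h3] at hf
  obtain ⟨c, hc⟩ := hv'.mem_span hf
  ext h
  have h4 : (iota (a ⊗ₜ[ℂ] (h : g)) : U (A ⊗[ℂ] g)) • f v = Λ' a h • f v := by
    rw [hc, smul_comm, hv'.cartan, smul_comm]
  have h5 : (iota (a ⊗ₜ[ℂ] (h : g)) : U (A ⊗[ℂ] g)) • f v = Λ a h • f v := by
    rw [← map_smul, hv.cartan]
    exact map_smul (f.toLinearMap.restrictScalars ℂ) _ _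
  rw [h4] at h5
  exact (smul_left_injective ℂ hf0 h5).symm

end CurHW

end CurrentHW
/-! ### Tensor products of evaluation modules -/

section SlotStable

variable {ι : Type*} [Fintype ι] {E : ι → Type*} [∀ i, AddCommGroup (E i)] [∀ i, Module ℂ (E i)]

theorem map_mem_of_slot_mem {N : Submodule ℂ (⨂[ℂ] i, E i)}
    (hN : ∀ i (f : Module.End ℂ (E i)), ∀ t ∈ N, slot E i f t ∈ N) (f : ∀ i, Module.End ℂ (E i))
    {t : ⨂[ℂ] i, E i} (ht : t ∈ N) : PiTensorProduct.map f t ∈ N := by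
  classical
  suffices h : ∀ s : Finset ι, PiTensorProduct.map
      (fun i => if i ∈ s then f i else (1 : Module.End ℂ (E i))) t ∈ N by
    have := h Finset.univ
    simpa using this
  intro s
  induction s using Finset.induction_on with
  | empty =>
    simp only [Finset.notMem_empty, if_false]
    have : PiTensorProduct.map (fun i => (1 : Module.End ℂ (E i))) t = t := by
      rw [PiTensorProduct.map_one]; rfl
    rw [this]; exact ht
  | insert j s hj ih =>
    have h1 : PiTensorProduct.map (fun i => if i ∈ insert j s then f i else
        (1 : Module.End ℂ (E i))) =
        slot E j (f j) * PiTensorProduct.map (fun i => if i ∈ s then f i else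
          (1 : Module.End ℂ (E i))) := by
      apply PiTensorProduct.ext
      ext x
      simp only [LinearMap.compMultilinearMap_apply, Module.End.mul_apply,
        PiTensorProduct.map_tprod, slot_tprod]
      congr 1
      funext i
      by_cases hij : i = j
      · subst hij; simp [hj]
      · simp [hij]
    rw [h1]
    exact hN j _ _ ih

/-- A nonzero subspace stable under all operators on the factors is the whole tensor product. -/
theorem eq_top_of_slot_mem {N : Submodule ℂ (⨂[ℂ] i, E i)}
    (hN : ∀ i (f : Module.End ℂ (E i)), ∀ t ∈ N, slot E i f t ∈ N) {t : ⨂[ℂ] i, E i}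
    (ht : t ∈ N) (h0 : t ≠ 0) : N = ⊤ := by
  classical
  let B := fun i => Module.Basis.ofVectorSpace ℂ (E i)
  let C := Basis.piTensorProduct B
  obtain ⟨p, hp⟩ : ∃ p, C.repr t p ≠ 0 := by
    by_contra! h
    exact h0 (C.repr.map_eq_zero_iff.mp (Finsupp.ext h))
  rw [eq_top_iff, ← PiTensorProduct.span_tprod_eq_top, Submodule.span_le]
  rintro _ ⟨y, rfl⟩
  let f : ∀ i, Module.End ℂ (E i) := fun i => ((B i).coord (p i)).smulRight (y i)
  -- The tensor product of the rank-one maps `f i` is the rank-one map sending `t` to its coordinate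
  -- at `p` times the pure tensor of `y`. That coordinate of the given `t` is nonzero.
  have h1 : PiTensorProduct.map f = (C.coord p).smulRight (PiTensorProduct.tprod ℂ y) := by
    apply PiTensorProduct.ext
    ext x
    simp only [LinearMap.compMultilinearMap_apply, PiTensorProduct.map_tprod,
      LinearMap.smulRight_apply, Module.Basis.coord_apply, f, C,
      Basis.piTensorProduct_repr_tprod_apply]
    rw [MultilinearMap.map_smul_univ]
  have h2 := map_mem_of_slot_mem hN f ht
  rw [h1, LinearMap.smulRight_apply, Module.Basis.coord_apply] at h2
  exact (N.smul_mem_iff hp).mp h2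

theorem tprod_ne_zero {x : ∀ i, E i} (hx : ∀ i, x i ≠ 0) : PiTensorProduct.tprod ℂ x ≠ 0 := by
  classical
  have h1 : ∀ i, ∃ φ : Dual ℂ (E i), φ (x i) ≠ 0 := fun i => by
    by_contra! h
    exact hx i ((Module.forall_dual_apply_eq_zero_iff ℂ (x i)).mp h)
  choose φ hφ using h1
  intro h0
  have h2 := congrArg (PiTensorProduct.lift
    ((MultilinearMap.mkPiAlgebra ℂ ι ℂ).compLinearMap φ)) h0
  rw [PiTensorProduct.lift.tprod, map_zero, MultilinearMap.compLinearMap_apply,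
    MultilinearMap.mkPiAlgebra_apply, Finset.prod_eq_zero_iff] at h2
  obtain ⟨i, -, hi⟩ := h2
  exact hφ i hi

end SlotStable

/-! ### Irreducibility and characters of the modules `V_ξ` -/

section TensEval

variable {A : Type u} [CommRing A] [Algebra ℂ A] [Algebra.FiniteType ℂ A]
variable {g : Type v} [LieRing g] [LieAlgebra ℂ g] [FiniteDimensional ℂ g] [IsSimple ℂ g]
  {H : LieSubalgebra ℂ g} [H.IsCartanSubalgebra] {b : (rootSystem H).Base}

theorem tensEval_smul (ξ : Xi A b) (y : A ⊗[ℂ] g) (t : TensEval ξ) :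
    (iota y : U (A ⊗[ℂ] g)) • t = tensEvalAct ξ y t := by
  change UniversalEnvelopingAlgebra.lift ℂ (tensEvalAct ξ) (iota y) t = _
  rw [UniversalEnvelopingAlgebra.lift_ι_apply]

/-- An operator on one factor of `V_ξ`. -/
def tensSlot (ξ : Xi A b) (S : ξ.support) :
    Module.End ℂ (SimpleMod b (ξ S)) →ₐ[ℂ] Module.End ℂ (TensEval ξ) :=
  slot (fun S : ξ.support => SimpleMod b (ξ S)) S

theorem tensEvalAct_apply (ξ : Xi A b) (y : A ⊗[ℂ] g) :
    tensEvalAct ξ y = ∑ S : ξ.support, tensSlot ξ S (simpleAct b (ξ S) (evLie S.1 y)) := rfl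

theorem tensEval_smul_tmul (ξ : Xi A b) (a : A) (x : g) (t : TensEval ξ) :
    (iota (a ⊗ₜ[ℂ] x) : U (A ⊗[ℂ] g)) • t = ∑ S : ξ.support,
      ev S.1 a • tensSlot ξ S (simpleAct b (ξ S) x) t := by
  rw [tensEval_smul, tensEvalAct_apply, LinearMap.sum_apply]
  refine Finset.sum_congr rfl fun S _ => ?_
  rw [evLie_tmul, map_smul, map_smul, LinearMap.smul_apply]

instance (ξ : Xi A b) : FiniteDimensional ℂ (TensEval ξ) :=
  inferInstanceAs (FiniteDimensional ℂ (⨂[ℂ] S : ξ.support, SimpleMod b (ξ S)))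

/-- The highest weight vector of `V_ξ`. -/
def tensGen (ξ : Xi A b) : TensEval ξ :=
  PiTensorProduct.tprod ℂ fun S : ξ.support => simpleGen b (ξ S)

theorem tensGen_ne_zero (ξ : Xi A b) : tensGen ξ ≠ 0 :=
  tprod_ne_zero fun S : ξ.support => simpleGen_ne_zero b (ξ S)

/-- If `a` is `1` at `S` and `0` at the other points of the support, then `x ⊗ a` acts as `x` on the
factor `S` alone. Burnside's theorem for the irreducible `V(ξ(S))` then gives every operator on that
factor. -/
theorem slot_mem_of_stable (ξ : Xi A b) {N : Submodule ℂ (TensEval ξ)}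
    (hN : ∀ y : A ⊗[ℂ] g, ∀ t ∈ N, (iota y : U (A ⊗[ℂ] g)) • t ∈ N) (S : ξ.support)
    (f : Module.End ℂ (SimpleMod b (ξ S))) (t : TensEval ξ) (ht : t ∈ N) :
    tensSlot ξ S f t ∈ N := by
  obtain ⟨a, ha, ha'⟩ := exists_ev_eq (A := A) ξ.support S.1
  have h1 : ∀ x : g, ∀ t ∈ N,
      tensSlot ξ S (simpleAct b (ξ S) x) t ∈ N := by
    intro x t ht
    have := hN (a ⊗ₜ x) t ht
    rw [tensEval_smul_tmul, Finset.sum_eq_single S, ha, one_smul] at this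
    · exact this
    · intro S' _ hne
      rw [ha' S'.1 S'.2 fun h => hne (Subtype.ext h), zero_smul]
    · exact fun h => absurd (Finset.mem_univ S) h
  obtain ⟨r, hr⟩ := burnside (R := U g) f
  have h2 : f = Algebra.lsmul ℂ ℂ (SimpleMod b (ξ S)) r := LinearMap.ext hr
  rw [h2]
  clear h2 hr
  induction r using U_induction generalizing t with
  | hC c =>
    rw [AlgHom.commutes, AlgHom.commutes, Module.algebraMap_end_apply]
    exact N.smul_mem c ht
  | hi x => exact h1 x t ht
  | hadd r s hr hs =>
    rw [map_add, map_add]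
    exact add_mem (hr t ht) (hs t ht)
  | hmul r s hr hs =>
    rw [map_mul, map_mul]
    exact hr _ (hs t ht)

instance (ξ : Xi A b) : IsSimpleModule (U (A ⊗[ℂ] g)) (TensEval ξ) := by
  have : Nontrivial (TensEval ξ) := ⟨_, _, tensGen_ne_zero ξ⟩
  refine (isSimpleModule_iff _ _).mpr
    { eq_bot_or_eq_top := fun N => or_iff_not_imp_left.mpr fun hN => ?_ }
  obtain ⟨t, ht, h0⟩ := (Submodule.ne_bot_iff _).mp hN
  have h1 : N.restrictScalars ℂ = ⊤ := eq_top_of_slot_mem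
    (slot_mem_of_stable ξ (N := N.restrictScalars ℂ) fun y t ht => N.smul_mem _ ht) ht h0
  rw [eq_top_iff]
  intro x _
  have hx : x ∈ N.restrictScalars ℂ := by rw [h1]; trivial
  exact hx

/-- The highest weight character of `V_ξ`. -/
def xiChar (ξ : Xi A b) (a : A) : Dual ℂ H := ξ.sum fun S μ => ev S a • μ.1

theorem xiChar_one (ξ : Xi A b) : xiChar ξ 1 = ξ.wt.1 := by
  rw [xiChar, Xi.wt, Finsupp.sum, Finsupp.sum, AddSubmonoid.coe_finsetSum]
  exact Finset.sum_congr rfl fun S _ => by rw [map_one, one_smul]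

/-- Evaluating the characters at an element that is `1` at `S` and `0` at the other points of both
supports recovers the value at `S`. -/
theorem xiChar_injective {ξ ξ' : Xi A b} (h : ∀ a, xiChar ξ a = xiChar ξ' a) : ξ = ξ' := by
  classical
  ext S : 1
  obtain ⟨a, ha, ha'⟩ := exists_ev_eq (A := A) (ξ.support ∪ ξ'.support) S
  have key : ∀ ζ : Xi A b, ζ.support ⊆ ξ.support ∪ ξ'.support → xiChar ζ a = (ζ S).1 := by
    intro ζ hζ
    rw [xiChar, Finsupp.sum, Finset.sum_eq_single S, ha, one_smul]
    · intro S' hS' hne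
      rw [ha' S' (hζ hS') hne, zero_smul]
    · intro hS
      rw [Finsupp.notMem_support_iff.mp hS]
      simp
  apply Subtype.ext
  rw [← key ξ Finset.subset_union_left, ← key ξ' Finset.subset_union_right, h]

theorem tensGen_curHW (ξ : Xi A b) : CurHW b (tensGen ξ) (xiChar ξ) where
  ne_zero := tensGen_ne_zero ξ
  pos := by
    classical
    rintro _ ⟨a, x, hx, rfl⟩
    rw [tensEval_smul_tmul]
    refine Finset.sum_eq_zero fun S _ => ?_
    have h1 : simpleAct b (ξ S) x (simpleGen b (ξ S)) = 0 := (simpleMod_integrable b (ξ S)).pos' hx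
    have h2 : tensSlot ξ S (simpleAct b (ξ S) x) (tensGen ξ) = 0 := by
      refine (slot_tprod _ S _ _).trans ?_
      rw [h1]
      exact MultilinearMap.map_update_zero _ _ _
    rw [h2, smul_zero]
  cartan := by
    classical
    intro a h
    rw [tensEval_smul_tmul]
    have h1 : ∀ S : ξ.support, tensSlot ξ S
        (simpleAct b (ξ S) (h : g)) (tensGen ξ) = (ξ S).1 h • tensGen ξ := by
      intro S
      have h2 : simpleAct b (ξ S) (h : g) (simpleGen b (ξ S)) = (ξ S).1 h • simpleGen b (ξ S) :=
        (simpleMod_integrable b (ξ S)).weight h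
      refine (slot_tprod _ S _ _).trans ?_
      rw [h2, MultilinearMap.map_update_smul, Function.update_eq_self]
      rfl
    simp_rw [h1, smul_smul]
    rw [← Finset.sum_smul, xiChar, Finsupp.sum, LinearMap.sum_apply,
      ← Finset.sum_coe_sort ξ.support]
    rfl

theorem tensEval_isObj {lam : domWeights b} (ξ : Xi A b) (hξ : lam.1 - ξ.wt.1 ∈ posCone b) :
    IsObj A b lam (TensEval ξ) where
  locFin v := ⟨⊤, trivial, inferInstance, fun _ _ _ => trivial⟩
  wt_le μ hμ := by
    have h1 := (tensGen_curHW ξ).wt_le hμ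
    rw [xiChar_one] at h1
    have h2 : lam.1 - μ = (lam.1 - ξ.wt.1) + (ξ.wt.1 - μ) := by abel
    rw [h2]
    exact add_mem hξ h1

theorem xi_eq_of_equiv {ξ ξ' : Xi A b} (e : TensEval ξ ≃ₗ[U (A ⊗[ℂ] g)] TensEval ξ') : ξ = ξ' :=
  xiChar_injective ((tensGen_curHW ξ).char_eq (tensGen_curHW ξ') e)

end TensEval
/-! ### Irreducible modules over `U(𝔥 ⊗ A)` -/

section Scalars

theorem exists_scalar_of_comm {R M : Type*} [Ring R] [Algebra ℂ R] [AddCommGroup M] [Module ℂ M]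
    [Module R M] [IsScalarTower ℂ R M] [IsSimpleModule R M] (hcomm : ∀ x y : R, x * y = y * x)
    (hR : ∃ s : Set R, s.Countable ∧ Submodule.span ℂ s = ⊤) (y : R) :
    ∃ c : ℂ, ∀ m : M, y • m = c • m :=
  schur_countable (rank_le_of_simple hR)
    ({ toFun := fun m => y • m
       map_add' := smul_add y
       map_smul' := fun r m => by
        rw [← mul_smul, hcomm, mul_smul, RingHom.id_apply] } : Module.End R M)

theorem countable_span_of_finiteType {A : Type*} [CommRing A] [Algebra ℂ A]
    [Algebra.FiniteType ℂ A] : ∃ s : Set A, s.Countable ∧ Submodule.span ℂ s = ⊤ := by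
  obtain ⟨s, hs⟩ := (Algebra.FiniteType.out : (⊤ : Subalgebra ℂ A).FG)
  refine ⟨Submonoid.closure (s : Set A), ?_, ?_⟩
  · rw [Submonoid.closure_eq_mrange, MonoidHom.coe_mrange]
    have : Countable (FreeMonoid (s : Set A)) := inferInstanceAs (Countable (List (s : Set A)))
    exact Set.countable_range _
  · rw [← Algebra.adjoin_eq_span, hs, Algebra.top_toSubmodule]

theorem countable_span_tensor {A L : Type*} [CommRing A] [Algebra ℂ A] [Algebra.FiniteType ℂ A]
    [AddCommGroup L] [Module ℂ L] [FiniteDimensional ℂ L] :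
    ∃ s : Set (A ⊗[ℂ] L), s.Countable ∧ Submodule.span ℂ s = ⊤ := by
  obtain ⟨s, hs, hspan⟩ := countable_span_of_finiteType (A := A)
  let B := Module.finBasis ℂ L
  refine ⟨Set.image2 (fun a x => a ⊗ₜ[ℂ] x) s (Set.range B),
    hs.image2 (Set.countable_range B) _, ?_⟩
  have h1 : Submodule.map₂ (TensorProduct.mk ℂ A L) (Submodule.span ℂ s)
      (Submodule.span ℂ (Set.range B)) = ⊤ := by
    rw [hspan, B.span_eq]; exact TensorProduct.map₂_mk_top_top_eq_top ℂ A L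
  rw [Submodule.map₂_span_span] at h1
  exact h1

theorem exists_linear_of_scalar {R M : Type*} [AddCommGroup R] [Module ℂ R] [AddCommGroup M]
    [Module ℂ M] (v : M) (F : R →ₗ[ℂ] M) (hv : v ≠ 0)
    (h : ∀ y, ∃ c : ℂ, F y = c • v) : ∃ φ : R →ₗ[ℂ] ℂ, ∀ y, F y = φ y • v := by
  choose φ hφ using h
  have inj := smul_left_injective ℂ hv
  exact ⟨{ toFun := φ
           map_add' := fun x y => inj (by
            change φ (x + y) • v = (φ x + φ y) • v
            rw [add_smul, ← hφ, ← hφ, ← hφ, map_add])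
           map_smul' := fun c y => inj (by
            change φ (c • y) • v = (c • φ y) • v
            rw [smul_assoc, ← hφ, ← hφ, map_smul]) }, hφ⟩

end Scalars

/-! ### Highest weight vectors in irreducible objects of `𝓘_A^λ` -/

section Irreducible

variable {A : Type u} [CommRing A] [Algebra ℂ A]
variable {g : Type v} [LieRing g] [LieAlgebra ℂ g] [FiniteDimensional ℂ g] [IsSimple ℂ g]
  {H : LieSubalgebra ℂ g} [H.IsCartanSubalgebra] {b : (rootSystem H).Base} {lam : domWeights b}
variable {V : Type w} [AddCommGroup V] [Module ℂ V] [Module (U (A ⊗[ℂ] g)) V]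
  [IsScalarTower ℂ (U (A ⊗[ℂ] g)) V]

theorem inclU_iota (a : A) (h : H) :
    inclU A H (iota (a ⊗ₜ[ℂ] h)) = iota (a ⊗ₜ[ℂ] (h : g)) := by
  rw [mapU_iota]; rfl

/-- The representation of `𝔤` on a finite-dimensional `𝔤`-submodule. -/
def locRep {N : Submodule ℂ V}
    (hN : ∀ x : g, ∀ n ∈ N, (iota (oneTensor A x) : U (A ⊗[ℂ] g)) • n ∈ N) :
    g →ₗ⁅ℂ⁆ Module.End ℂ N where
  toFun x := ((actU (A ⊗[ℂ] g) V (oneTensor A x))).restrict (hN x)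
  map_add' x y := LinearMap.ext fun n => Subtype.ext (by
    change actU (A ⊗[ℂ] g) V (oneTensor A (x + y)) n.1 =
      actU (A ⊗[ℂ] g) V (oneTensor A x) n.1 + actU (A ⊗[ℂ] g) V (oneTensor A y) n.1
    rw [map_add, map_add]; rfl)
  map_smul' c x := LinearMap.ext fun n => Subtype.ext (by
    change actU (A ⊗[ℂ] g) V (oneTensor A (c • x)) n.1 =
      c • actU (A ⊗[ℂ] g) V (oneTensor A x) n.1
    rw [map_smul, map_smul]; rfl)
  map_lie' {x y} := by
    ext n
    have := rep_lie ((actU (A ⊗[ℂ] g) V).comp (oneTensor A)) x y n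
    exact this

/-- A locally finite-dimensional module has a weight vector. -/
theorem exists_wtSpace_ne_bot (hV : IsLocFin A (g := g) V) [Nontrivial V] :
    ∃ ν : Dual ℂ H, wtSpace A H V ν ≠ ⊥ := by
  obtain ⟨v, hv⟩ := exists_ne (0 : V)
  obtain ⟨N, hvN, hfin, hst⟩ := hV v
  let ρ : H →ₗ⁅ℂ⁆ Module.End ℂ N := (locRep hst).comp H.incl
  let _ : LieRingModule H N := LieRingModule.compLieHom N ρ
  have _ : LieModule ℂ H N := LieModule.compLieHom N ρ
  have : Nontrivial N := ⟨⟨v, hvN⟩, 0, fun h => hv (congrArg Subtype.val h)⟩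
  obtain ⟨χ, hχ⟩ := LieModule.exists_nontrivial_weightSpace_of_isSolvable ℂ H N
  obtain ⟨⟨n, hn⟩, hn0⟩ := exists_ne (0 : LieModule.weightSpace N χ)
  rw [LieModule.mem_weightSpace] at hn
  refine ⟨χ, (Submodule.ne_bot_iff _).mpr ⟨n, fun h => congrArg Subtype.val (hn h), fun h0 => ?_⟩⟩
  exact hn0 (Subtype.ext (Subtype.ext h0))

/-- Primitive vectors of a locally finite-dimensional module have dominant weights. -/
theorem dominant_of_locFin (hV : IsLocFin A (g := g) V) {v : V} (h0 : v ≠ 0) {μ : Dual ℂ H}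
    (hv : v ∈ wtSpace A H V μ) (i : H.root)
    (he : (iota (oneTensor A (eVec i)) : U (A ⊗[ℂ] g)) • v = 0) :
    ∃ n : ℕ, μ (coroot i.1) = n := by
  obtain ⟨N, hvN, hfin, hst⟩ := hV v
  let _ : LieRingModule g N := LieRingModule.compLieHom N (locRep hst)
  have _ : LieModule ℂ g N := LieModule.compLieHom N (locRep hst)
  have P : (triple i).HasPrimitiveVectorWith (⟨v, hvN⟩ : N) (μ (coroot i.1)) :=
    { ne_zero := fun h => h0 (congrArg Subtype.val h)
      lie_h := Subtype.ext (hv (coroot i.1))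
      lie_e := Subtype.ext he }
  exact P.exists_nat

/-- A subspace of vectors annihilated by `𝔫⁺ ⊗ A` of an irreducible module. -/
theorem top_le_of_primitive [IsSimpleModule (U (A ⊗[ℂ] g)) V] {μ : Dual ℂ H} {X : Submodule ℂ V}
    (hX : X ≤ wtSpace A H V μ) (hpos : ∀ y ∈ curPos A b, ∀ v ∈ X, (iota y : U (A ⊗[ℂ] g)) • v = 0)
    (hcar : ∀ (a : A) (h : H), ∀ v ∈ X, (iota (a ⊗ₜ[ℂ] (h : g)) : U (A ⊗[ℂ] g)) • v ∈ X)
    {v : V} (hv : v ∈ X) (h0 : v ≠ 0) : (⊤ : Submodule ℂ V) ≤ X ⊔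
      wtSum ((actU (A ⊗[ℂ] g) V).toLinearMap ∘ₗ curEta A H) (below (posCone b) μ) := by
  rw [← repSpan_eq_top_of_simple (L := A ⊗[ℂ] g) (X := (X : Set V)) hv h0]
  refine repSpan_le_sup (fun x hx hx' => posCone_pointed b hx hx') (cur_span A b)
    (curNeg_lie A b) ?_ hX
  rintro x (hx | ⟨a, h, rfl⟩) u hu
  · rw [actU_apply, hpos x hx u hu]; exact zero_mem _
  · exact hcar a h u hu

/-- The primitive subspace `X` generates `V`, and everything generated outside `X` has weight
strictly below `μ`. This is what makes a maximal weight space irreducible under `𝔥 ⊗ A`. -/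
theorem wtSpace_le_of_primitive [IsSimpleModule (U (A ⊗[ℂ] g)) V] {μ : Dual ℂ H}
    {X : Submodule ℂ V} (hX : X ≤ wtSpace A H V μ)
    (hpos : ∀ y ∈ curPos A b, ∀ v ∈ X, (iota y : U (A ⊗[ℂ] g)) • v = 0)
    (hcar : ∀ (a : A) (h : H), ∀ v ∈ X, (iota (a ⊗ₜ[ℂ] (h : g)) : U (A ⊗[ℂ] g)) • v ∈ X)
    {v : V} (hv : v ∈ X) (h0 : v ≠ 0) : wtSpace A H V μ ≤ X := by
  intro u hu
  obtain ⟨x, hx, z, hz, rfl⟩ := Submodule.mem_sup.mp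
    (top_le_of_primitive hX hpos hcar hv h0 (Submodule.mem_top (x := u)))
  have hz' : z ∈ wtSpace A H V μ := by
    have := sub_mem hu (hX hx)
    rwa [add_sub_cancel_left] at this
  by_cases hz0 : z = 0
  · rw [hz0, add_zero]; exact hx
  · exact absurd rfl (mem_of_mem_wtSum hz hz' hz0).2

theorem sub_mem_of_primitive [IsSimpleModule (U (A ⊗[ℂ] g)) V] {μ : Dual ℂ H}
    {X : Submodule ℂ V} (hX : X ≤ wtSpace A H V μ)
    (hpos : ∀ y ∈ curPos A b, ∀ v ∈ X, (iota y : U (A ⊗[ℂ] g)) • v = 0)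
    (hcar : ∀ (a : A) (h : H), ∀ v ∈ X, (iota (a ⊗ₜ[ℂ] (h : g)) : U (A ⊗[ℂ] g)) • v ∈ X)
    {v : V} (hv : v ∈ X) (h0 : v ≠ 0) {ν : Dual ℂ H} (hν : wtSpace A H V ν ≠ ⊥) :
    μ - ν ∈ posCone b := by
  obtain ⟨u, hu, hu0⟩ := (Submodule.ne_bot_iff _).mp hν
  refine mem_of_mem_wtSum (τ := (actU (A ⊗[ℂ] g) V).toLinearMap ∘ₗ curEta A H)
    (Ω := {ν | μ - ν ∈ posCone b}) ?_ hu hu0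
  refine (top_le_of_primitive hX hpos hcar hv h0).trans
    (sup_le ?_ (wtSum_mono fun ν hν => hν.1)) (Submodule.mem_top (x := u))
  refine le_trans hX (wt_le_wtSum (τ := (actU (A ⊗[ℂ] g) V).toLinearMap ∘ₗ curEta A H) (μ := μ) ?_)
  change μ - μ ∈ posCone b
  rw [sub_self]; exact zero_mem _

/-- A module in `𝓘_A^λ` has a weight of maximal height. -/
theorem exists_max_weight [Nontrivial V] (hV : IsObj A b lam V) :
    ∃ μ : Dual ℂ H, wtSpace A H V μ ≠ ⊥ ∧
      ∀ y ∈ curPos A b, ∀ v ∈ wtSpace A H V μ, (iota y : U (A ⊗[ℂ] g)) • v = 0 := by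
  classical
  let Q : ℕ → Prop := fun n => ∃ ν : Dual ℂ H, wtSpace A H V ν ≠ ⊥ ∧ ht b (lam.1 - ν) = n
  have hQ : ∃ n, Q n := by
    obtain ⟨ν, hν⟩ := exists_wtSpace_ne_bot (H := H) hV.locFin
    obtain ⟨n, hn, -⟩ := exists_ht b (hV.wt_le ν hν)
    exact ⟨n, ν, hν, hn⟩
  obtain ⟨μ, hμ, hn⟩ := Nat.find_spec hQ
  refine ⟨μ, hμ, fun y hy v hv => ?_⟩
  by_contra hne
  obtain ⟨β, hβ, hβ0, hw⟩ := curPos_mem_wtSpace hy hv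
  have hw' : wtSpace A H V (μ + β) ≠ ⊥ := (Submodule.ne_bot_iff _).mpr ⟨_, hw, hne⟩
  obtain ⟨m, hm, -⟩ := exists_ht b (hV.wt_le _ hw')
  obtain ⟨k, hk, hk0⟩ := exists_ht b hβ
  have h1 : Nat.find hQ ≤ m := Nat.find_min' hQ ⟨_, hw', hm⟩
  have h2 : lam.1 - μ = (lam.1 - (μ + β)) + β := by abel
  rw [h2, map_add, hm, hk] at hn
  have h3 : m + k = Nat.find hQ := by exact_mod_cast hn
  have h4 : k ≠ 0 := fun h0 => hβ0 (hk0 h0)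
  omega

/-- The `U(𝔥 ⊗ A)`-module structure on a weight space. -/
abbrev wtModule (μ : Dual ℂ H) : Module (U (A ⊗[ℂ] H)) (wtSpace A H V μ) where
  smul y v := ⟨inclU A H y • v.1, wtSpace_stable A y v.2⟩
  one_smul v := Subtype.ext (by
    change inclU A H 1 • v.1 = v.1; rw [map_one, one_smul])
  mul_smul y z v := Subtype.ext (by
    change inclU A H (y * z) • v.1 = inclU A H y • inclU A H z • v.1
    rw [map_mul, mul_smul])
  smul_zero y := Subtype.ext (smul_zero (inclU A H y))
  smul_add y v v' := Subtype.ext (smul_add (inclU A H y) _ _)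
  add_smul y z v := Subtype.ext (by
    change inclU A H (y + z) • v.1 = inclU A H y • v.1 + inclU A H z • v.1
    rw [map_add, add_smul])
  zero_smul v := Subtype.ext (by
    change inclU A H 0 • v.1 = 0
    rw [map_zero, zero_smul])

variable [Algebra.FiniteType ℂ A]

/-- An irreducible object of `𝓘_A^λ` has a highest weight vector. -/
theorem exists_curHW [IsSimpleModule (U (A ⊗[ℂ] g)) V] (hV : IsObj A b lam V) :
    ∃ (v : V) (φ : A ⊗[ℂ] H →ₗ[ℂ] ℂ), CurHW b v fun a => φ ∘ₗ TensorProduct.mk ℂ A H a := by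
  have := IsSimpleModule.nontrivial (U (A ⊗[ℂ] g)) V
  obtain ⟨μ, hμ, hpos⟩ := exists_max_weight hV
  obtain ⟨v, hv, h0⟩ := (Submodule.ne_bot_iff _).mp hμ
  let _ : Module (U (A ⊗[ℂ] H)) (wtSpace A H V μ) := wtModule μ
  have hsm : ∀ (y : U (A ⊗[ℂ] H)) (v : wtSpace A H V μ), ((y • v : wtSpace A H V μ) : V) =
      inclU A H y • (v : V) := fun _ _ => rfl
  have _ : IsScalarTower ℂ (U (A ⊗[ℂ] H)) (wtSpace A H V μ) := ⟨fun c y v => Subtype.ext (by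
    rw [hsm, map_smul, smul_assoc]; rfl)⟩
  have _ : Nontrivial (wtSpace A H V μ) := (Submodule.nontrivial_iff_ne_bot).mpr hμ
  have _ : IsSimpleModule (U (A ⊗[ℂ] H)) (wtSpace A H V μ) := by
    refine (isSimpleModule_iff _ _).mpr
      { eq_bot_or_eq_top := fun N => or_iff_not_imp_left.mpr fun hN => ?_ }
    obtain ⟨u, hu, hu0⟩ := (Submodule.ne_bot_iff _).mp hN
    have h1 := wtSpace_le_of_primitive (b := b) (μ := μ)
      (X := (N.restrictScalars ℂ).map (wtSpace A H V μ).subtype)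
      (Submodule.map_subtype_le _ _)
      (fun y hy w hw => hpos y hy w (Submodule.map_subtype_le _ _ hw)) ?_
      ⟨u, hu, rfl⟩ (fun h => hu0 (Subtype.ext h))
    · rw [eq_top_iff]
      intro x _
      obtain ⟨x', hx', hxx⟩ := h1 x.2
      rw [← show x' = x from Subtype.ext hxx]
      exact hx'
    · rintro a h _ ⟨w, hw, rfl⟩
      refine ⟨(iota (a ⊗ₜ[ℂ] h) : U (A ⊗[ℂ] H)) • w, N.smul_mem _ hw, ?_⟩
      rw [← inclU_iota]
      rfl
  -- A finitely generated `A` has countable dimension, hence so has `U(𝔥 ⊗ A)`; Schur's lemma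
  -- applies although the weight space is not yet known to be finite-dimensional.
  have hscal := exists_scalar_of_comm (M := wtSpace A H V μ) (cartanU_comm A (H := H))
    (countable_span_U (countable_span_tensor (A := A) (L := H)))
  let F : A ⊗[ℂ] H →ₗ[ℂ] V := (LinearMap.applyₗ v) ∘ₗ
    (actU (A ⊗[ℂ] g) V).toLinearMap ∘ₗ (inclCartan A H).toLinearMap
  obtain ⟨φ, hφ⟩ := exists_linear_of_scalar v F h0 fun y => by
    obtain ⟨c, hc⟩ := hscal (iota y)
    refine ⟨c, ?_⟩
    have := congrArg Subtype.val (hc ⟨v, hv⟩)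
    rw [hsm, mapU_iota] at this
    exact this
  exact ⟨v, φ, h0, fun y hy => hpos y hy v hv, fun a h => hφ (a ⊗ₜ h)⟩

end Irreducible

/-! ### Classification of the irreducible objects -/

section Roots

variable {g : Type v} [LieRing g] [LieAlgebra ℂ g] [FiniteDimensional ℂ g] [IsSimple ℂ g]
  {H : LieSubalgebra ℂ g} [H.IsCartanSubalgebra] (b : (rootSystem H).Base)

/-- If `α - α_i` were a negative root `-β`, then `α_i = α + β` would be a sum of two positive roots,
impossible for height `1`. -/
theorem lie_pos_fVec {α i : H.root} (hα : b.IsPos α) (hi : i ∈ b.support) (hne : α ≠ i) {x : g}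
    (hx : x ∈ rootSpace H (α.1 : H → ℂ)) : ⁅x, fVec i⁆ = 0 ∨ ⁅x, fVec i⁆ ∈ posSet b := by
  refine or_iff_not_imp_left.mpr fun h0 => ?_
  have h1 := LieAlgebra.lie_mem_genWeightSpace_of_mem_genWeightSpace hx (fVec_mem i)
  have h2 : LieModule.genWeightSpace g ((α.1 : H → ℂ) + -(i.1 : H → ℂ)) ≠ ⊥ := fun h => h0 (by
    rw [h] at h1; exact h1)
  let χ : LieModule.Weight ℂ H g := ⟨_, h2⟩
  have hχ0 : χ.IsNonZero := fun hz => hne (Subtype.ext (DFunLike.ext _ _ fun k => by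
    have := congrFun hz k
    exact add_neg_eq_zero.mp this))
  let γ : H.root := ⟨χ, by simpa using hχ0⟩
  have hγ : (γ.1 : H → ℂ) = (α.1 : H → ℂ) + -(i.1 : H → ℂ) := rfl
  rcases pos_or_neg b γ with hp | ⟨β, hβ, hγβ⟩
  · exact ⟨γ, hp, h1⟩
  exfalso
  have h3 : (rootSystem H).root i = (rootSystem H).root α + (rootSystem H).root β := by
    ext k
    have h4 := congrFun (hγ.symm.trans hγβ) k
    change α.1 k + -i.1 k = -β.1 k at h4
    change i.1 k = α.1 k + β.1 k
    linear_combination -h4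
  obtain ⟨m, hm, hm0⟩ := exists_ht b (root_mem_posCone b hα)
  obtain ⟨n, hn, hn0⟩ := exists_ht b (root_mem_posCone b hβ)
  have h5 := congrArg (ht b) h3
  rw [ht_root b hi, map_add, hm, hn] at h5
  have h6 : 1 = m + n := by exact_mod_cast h5
  have h7 : m ≠ 0 := fun h => (rootSystem H).ne_zero α (hm0 h)
  have h8 : n ≠ 0 := fun h => (rootSystem H).ne_zero β (hn0 h)
  omega

end Roots

section Classification

variable {A : Type u} [CommRing A] [Algebra ℂ A]
variable {g : Type v} [LieRing g] [LieAlgebra ℂ g] [FiniteDimensional ℂ g] [IsSimple ℂ g]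
  {H : LieSubalgebra ℂ g} [H.IsCartanSubalgebra] {b : (rootSystem H).Base} {lam : domWeights b}
variable {V : Type w} [AddCommGroup V] [Module ℂ V] [Module (U (A ⊗[ℂ] g)) V]
  [IsScalarTower ℂ (U (A ⊗[ℂ] g)) V]

variable (A V) in
/-- The operators `x ⊗ a` on a module, as a function of `a`. -/
def curOp (x : g) : A →ₗ[ℂ] Module.End ℂ V :=
  (actU (A ⊗[ℂ] g) V).toLinearMap ∘ₗ (TensorProduct.mk ℂ A g).flip x

theorem curOp_apply (x : g) (a : A) (u : V) :
    curOp A V x a u = (iota (a ⊗ₜ[ℂ] x) : U (A ⊗[ℂ] g)) • u := rfl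

theorem curOp_lie (x y : g) (a c : A) (u : V) :
    curOp A V x a (curOp A V y c u) = curOp A V y c (curOp A V x a u) +
      curOp A V ⁅x, y⁆ (a * c) u := by
  have h1 := rep_lie (actU (A ⊗[ℂ] g) V) (a ⊗ₜ[ℂ] x) (c ⊗ₜ[ℂ] y) u
  rw [ExtendScalars.bracket_tmul] at h1
  change _ = _ + actU (A ⊗[ℂ] g) V ((a * c) ⊗ₜ[ℂ] ⁅x, y⁆) u
  rw [h1]
  change actU (A ⊗[ℂ] g) V (a ⊗ₜ[ℂ] x) (actU (A ⊗[ℂ] g) V (c ⊗ₜ[ℂ] y) u) =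
    actU (A ⊗[ℂ] g) V (c ⊗ₜ[ℂ] y) (actU (A ⊗[ℂ] g) V (a ⊗ₜ[ℂ] x) u) + _
  abel

theorem curOp_zero (a : A) (u : V) : curOp A V (0 : g) a u = 0 := by
  rw [curOp_apply, TensorProduct.tmul_zero, map_zero, zero_smul]

theorem curOp_smul (c : ℂ) (x : g) (a : A) (u : V) : curOp A V (c • x) a u = c • curOp A V x a u := by
  rw [curOp_apply, TensorProduct.tmul_smul, map_smul, smul_assoc, curOp_apply]

variable {v : V} {φ : A ⊗[ℂ] H →ₗ[ℂ] ℂ}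
  (hv : CurHW b v fun a => φ ∘ₗ TensorProduct.mk ℂ A H a)

include hv in
/-- In an irreducible module, `(x_i⁻ ⊗ c) v = 0` as soon as it is killed by `x_i⁺ ⊗ A`. -/
theorem fVec_smul_eq_zero [IsSimpleModule (U (A ⊗[ℂ] g)) V] {i : H.root} (hi : i ∈ b.support) {c : A}
    (hc : ∀ a, φ ((c * a) ⊗ₜ coroot i.1) = 0) : curOp A V (fVec i) c v = 0 := by
  by_contra h0
  set μ : Dual ℂ H := φ ∘ₗ TensorProduct.mk ℂ A H 1 with hμ
  have hvμ : v ∈ wtSpace A H V μ := hv.mem_wtSpace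
  have hu : curOp A V (fVec i) c v ∈ wtSpace A H V (μ - (rootSystem H).root i) := by
    rw [sub_eq_add_neg]
    exact rep_mem_wt (ρ := actU (A ⊗[ℂ] g) V) (η := curEta A H) (β := -(rootSystem H).root i)
      (curEta_lie A (lie_h_fVec i) c) hvμ
  -- For `α = α_i` the bracket is a multiple of `h_i ⊗ ac`, on which `φ` vanishes by hypothesis. For
  -- any other positive `α` it is zero or a positive root vector, so it kills `v`.
  have hpos : ∀ (α : H.root), b.IsPos α → ∀ x ∈ rootSpace H (α.1 : H → ℂ), ∀ a,
      curOp A V x a (curOp A V (fVec i) c v) = 0 := by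
    intro α hα x hx a
    rw [curOp_lie, show curOp A V x a v = 0 from hv.pos _ ⟨a, x, ⟨α, hα, hx⟩, rfl⟩, map_zero, zero_add]
    by_cases hne : α = i
    · subst hne
      obtain ⟨d, rfl⟩ := exists_smul_eVec hx
      rw [smul_lie, (triple α).lie_e_f, curOp_smul, curOp_apply, hv.cartan]
      have : (φ ∘ₗ TensorProduct.mk ℂ A H (a * c)) (coroot α.1) = 0 := by
        rw [mul_comm]; exact hc a
      rw [this, zero_smul, smul_zero]
    · rcases lie_pos_fVec b hα hi hne hx with h | h
      · rw [h, curOp_zero]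
      · exact hv.pos _ ⟨a * c, _, h, rfl⟩
  -- All primitive vectors of weight `μ - α_i` together form an `𝔥 ⊗ A`-stable space. Were it
  -- nonzero, it would generate `V` and every weight would lie below `μ - α_i`, which fails for `μ`
  -- itself.
  let X : Submodule ℂ V := wtSpace A H V (μ - (rootSystem H).root i) ⊓
    ⨅ (α : {α : H.root // b.IsPos α}) (x : rootSpace H (α.1.1 : H → ℂ)) (a : A),
      LinearMap.ker (curOp A V (x : g) a)
  have hX : ∀ w, w ∈ X ↔ w ∈ wtSpace A H V (μ - (rootSystem H).root i) ∧
      ∀ (α : H.root), b.IsPos α → ∀ x ∈ rootSpace H (α.1 : H → ℂ), ∀ a, curOp A V x a w = 0 := by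
    intro w
    simp only [X, Submodule.mem_inf, Submodule.mem_iInf, LinearMap.mem_ker, Subtype.forall]
  have h1 := sub_mem_of_primitive (b := b) (X := X) inf_le_left
    (by
      rintro _ ⟨a, x, ⟨α, hα, hx⟩, rfl⟩ w hw
      exact ((hX w).mp hw).2 α hα x hx a)
    (by
      intro a h w hw
      rw [hX] at hw ⊢
      refine ⟨?_, fun α hα x hx a' => ?_⟩
      · rw [← inclU_iota]; exact wtSpace_stable A _ hw.1
      · have h2 := hw.2 α hα
        change curOp A V x a' (curOp A V (h : g) a w) = 0
        rw [curOp_lie, h2 x hx, map_zero, zero_add, ← lie_skew,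
          show ⁅(h : g), x⁆ = α.1 h • x from lie_eq_smul_of_mem_rootSpace hx h, ← neg_smul, curOp_smul, h2 x hx, smul_zero])
    ((hX _).mpr ⟨hu, hpos⟩) h0 ((Submodule.ne_bot_iff _).mpr ⟨v, hvμ, hv.ne_zero⟩)
  refine (rootSystem H).ne_zero i (posCone_pointed b (root_mem_posCone b
    (RootPairing.Base.isPos_of_mem_support hi)) ?_)
  rwa [sub_sub_cancel_left] at h1

variable [Algebra.FiniteType ℂ A]

-- The operators of the simple root `i` satisfy the relations of `𝔰𝔩₂ ⊗ A`; local finiteness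
-- supplies the nilpotency and irreducibility the nondegeneracy of `φ`.
include hv in
theorem exists_sum_ev [IsSimpleModule (U (A ⊗[ℂ] g)) V] (hV : IsLocFin A (g := g) V) {i : H.root}
    (hi : i ∈ b.support) : ∃ k : MaximalSpectrum A →₀ ℕ,
      ∀ a, φ (a ⊗ₜ coroot i.1) = k.sum fun S m => (m : ℂ) * ev S a := by
  have he : ∀ a, curOp A V (eVec i) a v = 0 := fun a => hv.pos _ ⟨a, _,
    ⟨i, RootPairing.Base.isPos_of_mem_support hi, eVec_mem i⟩, rfl⟩
  obtain ⟨n, hn⟩ := dominant_of_locFin hV hv.ne_zero hv.mem_wtSpace i (he 1)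
  have t : CurrentSl2 (curOp A V (eVec i)) (curOp A V (fVec i)) (curOp A V (coroot i.1 : g)) v
      (φ ∘ₗ (TensorProduct.mk ℂ A H).flip (coroot i.1)) n :=
    { ef := fun a c u => by rw [curOp_lie, (triple i).lie_e_f]
      hf := fun a c u => by
        rw [curOp_lie, (triple i).lie_lie_smul_f ℂ, ← neg_smul, curOp_smul, neg_smul, sub_eq_add_neg]
      ff := fun a c u => by rw [curOp_lie, lie_self, curOp_zero, add_zero]
      ne_zero := hv.ne_zero
      ev := he
      hv := fun a => hv.cartan a (coroot i.1)
      pow := by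
        have h1 := sl2_pow_zero A V hV (triple i) v n (by rw [← hn]; exact hv.cartan 1 (coroot i.1))
          (he 1)
        have h2 : ∀ k : ℕ, ((curOp A V (fVec i) 1) ^ k) v =
            (iota (oneTensor A (fVec i)) : U (A ⊗[ℂ] g)) ^ k • v := by
          intro k
          induction k with
          | zero => simp
          | succ k ih => rw [pow_succ', Module.End.mul_apply, ih, pow_succ', mul_smul]; rfl
        rw [h2, h1] }
  exact t.exists_eq_sum_ev fun c hc => fVec_smul_eq_zero hv hi hc

-- The multiplicities of a point `S`, one for each simple root, are the values of a dominant weight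
-- `ξ(S)` at the simple coroots. Both characters agree at these coroots, and the coroots span `𝔥`.
include hv in
theorem exists_xiChar [IsSimpleModule (U (A ⊗[ℂ] g)) V] (hV : IsLocFin A (g := g) V) :
    ∃ ξ : Xi A b, ∀ a, xiChar ξ a = φ ∘ₗ TensorProduct.mk ℂ A H a := by
  classical
  choose k hk using fun i : b.support => exists_sum_ev hv hV i.2
  choose η hη using fun S => exists_domWeight b fun i => k i S
  let s : Finset (MaximalSpectrum A) := Finset.univ.biUnion fun i => (k i).support
  have hs : ∀ S, η S ≠ 0 → S ∈ s := by
    intro S hS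
    by_contra hS'
    refine hS (Subtype.ext (dual_ext b fun i hi => ?_))
    have h1 : k ⟨i, hi⟩ S = 0 := by
      by_contra h
      exact hS' (Finset.mem_biUnion.mpr ⟨⟨i, hi⟩, Finset.mem_univ _, Finsupp.mem_support_iff.mpr h⟩)
    rw [hη S ⟨i, hi⟩, h1, Nat.cast_zero]
    rfl
  refine ⟨Finsupp.onFinset s η hs, fun a => dual_ext b fun i hi => ?_⟩
  rw [xiChar, Finsupp.onFinset_sum (g := fun S (μ : domWeights b) => ev S a • μ.1) _
    fun S => smul_zero _, LinearMap.sum_apply]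
  refine Eq.trans ?_ (hk ⟨i, hi⟩ a).symm
  rw [Finsupp.sum_of_support_subset (s := s) _
    (Finset.subset_biUnion_of_mem (fun i => (k i).support) (Finset.mem_univ (⟨i, hi⟩ : b.support)))
    _ (fun S _ => by rw [Nat.cast_zero, zero_mul])]
  refine Finset.sum_congr rfl fun S _ => ?_
  rw [LinearMap.smul_apply, hη S ⟨i, hi⟩, smul_eq_mul, mul_comm]

/-- Every irreducible object of `𝓘_A^λ` is isomorphic to some `V_ξ`. -/
theorem exists_xi [IsSimpleModule (U (A ⊗[ℂ] g)) V] (hV : IsObj A b lam V) :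
    ∃ ξ : Xi A b, lam.1 - ξ.wt.1 ∈ posCone b ∧ Nonempty (V ≃ₗ[U (A ⊗[ℂ] g)] TensEval ξ) := by
  obtain ⟨v, φ, hv⟩ := exists_curHW hV
  obtain ⟨ξ, hξ⟩ := exists_xiChar hv hV.locFin
  refine ⟨ξ, ?_, hv.nonempty_equiv (tensGen_curHW ξ) fun a h => by rw [hξ]⟩
  rw [← xiChar_one, hξ]
  exact hV.wt_le _ ((Submodule.ne_bot_iff _).mpr ⟨v, hv.mem_wtSpace, hv.ne_zero⟩)

/-- Every irreducible object of `𝓘_A^λ` of highest weight `λ` is isomorphic to some `V_ξ` with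
`wt ξ = λ`. -/
theorem exists_xiLam [IsSimpleModule (U (A ⊗[ℂ] g)) V] (hV : IsObj A b lam V)
    (hlam : wtSpace A H V lam.1 ≠ ⊥) :
    ∃ ξ : XiLam A b lam, Nonempty (V ≃ₗ[U (A ⊗[ℂ] g)] TensEval ξ.1) := by
  obtain ⟨ξ, hξ, ⟨e⟩⟩ := exists_xi hV
  refine ⟨⟨ξ, Subtype.ext ?_⟩, ⟨e⟩⟩
  obtain ⟨u, hu, hu0⟩ := (Submodule.ne_bot_iff _).mp hlam
  have h1 : e u ∈ wtSpace A H (TensEval ξ) lam.1 := CurHW.map_mem_wtSpace e.toLinearMap hu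
  have h2 := (tensGen_curHW ξ).wt_le
    ((Submodule.ne_bot_iff _).mpr ⟨_, h1, e.map_ne_zero_iff.mpr hu0⟩)
  rw [xiChar_one] at h2
  exact sub_eq_zero.mp (posCone_pointed b h2 (by rwa [neg_sub]))

end Classification

/-! ### Global Weyl modules are objects of `𝓘_A^λ` -/

section LocFin

variable {A : Type u} [CommRing A] [Algebra ℂ A]
variable {g : Type v} [LieRing g] [LieAlgebra ℂ g]
variable {V : Type*} [AddCommGroup V] [Module ℂ V] [Module (U (A ⊗[ℂ] g)) V]
  [IsScalarTower ℂ (U (A ⊗[ℂ] g)) V]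
variable {V' : Type*} [AddCommGroup V'] [Module ℂ V'] [Module (U (A ⊗[ℂ] g)) V']
  [IsScalarTower ℂ (U (A ⊗[ℂ] g)) V']

variable (A g V) in
/-- The vectors lying in a finite-dimensional `𝔤`-submodule. -/
def locFinVec : Submodule ℂ V where
  carrier := {v | ∃ N : Submodule ℂ V, v ∈ N ∧ FiniteDimensional ℂ N ∧
    ∀ x : g, ∀ n ∈ N, (iota (oneTensor A x) : U (A ⊗[ℂ] g)) • n ∈ N}
  zero_mem' := ⟨⊥, zero_mem _, inferInstance, fun x n hn => by
    rw [(Submodule.mem_bot ℂ).mp hn, smul_zero]; exact zero_mem _⟩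
  add_mem' := by
    rintro v v' ⟨N, hv, _, hN⟩ ⟨N', hv', _, hN'⟩
    refine ⟨N ⊔ N', Submodule.add_mem_sup hv hv', inferInstance, fun x n hn => ?_⟩
    obtain ⟨y, hy, z, hz, rfl⟩ := Submodule.mem_sup.mp hn
    rw [smul_add]
    exact Submodule.add_mem_sup (hN x y hy) (hN' x z hz)
  smul_mem' := by
    rintro c v ⟨N, hv, hf, hN⟩
    exact ⟨N, N.smul_mem c hv, hf, hN⟩

variable [FiniteDimensional ℂ g]

/-- For a finite-dimensional `𝔤`-submodule `N`, the span of all `(x ⊗ a) n` with `x ∈ 𝔤`, `n ∈ N` is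
finite-dimensional because `𝔤` is, and it is `𝔤`-stable since `[z ⊗ 1, x ⊗ a] = [z, x] ⊗ a`. -/
theorem smul_mem_locFinVec (y : A ⊗[ℂ] g) {v : V} (hv : v ∈ locFinVec A g V) :
    (iota y : U (A ⊗[ℂ] g)) • v ∈ locFinVec A g V := by
  induction y using TensorProduct.induction_on with
  | zero => rw [map_zero, zero_smul]; exact zero_mem _
  | add x y hx hy => rw [map_add, add_smul]; exact add_mem hx hy
  | tmul a x =>
    obtain ⟨N, hvN, hf, hN⟩ := hv
    let f : g →ₗ[ℂ] V →ₗ[ℂ] V := (actU (A ⊗[ℂ] g) V).toLinearMap ∘ₗ TensorProduct.mk ℂ A g a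
    have hmem : ∀ (x : g), ∀ n ∈ N, f x n ∈ Submodule.map₂ f ⊤ N := fun x n hn =>
      Submodule.apply_mem_map₂ f (Submodule.mem_top (x := x)) hn
    refine ⟨Submodule.map₂ f ⊤ N, hmem x v hvN, ?_, fun z n hn => ?_⟩
    · have h1 : (⊤ : Submodule ℂ g).FG := Module.Finite.fg_top
      have h2 : N.FG := Module.Finite.iff_fg.mp hf
      exact Module.Finite.iff_fg.mpr (h1.map₂ f h2)
    · have hle : Submodule.map₂ f ⊤ N ≤ (Submodule.map₂ f ⊤ N).comap
          (actU (A ⊗[ℂ] g) V (oneTensor A z)) := by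
        rw [Submodule.map₂_le]
        intro x _ n hn
        have h1 := rep_lie (actU (A ⊗[ℂ] g) V) (oneTensor A z) (a ⊗ₜ[ℂ] x) n
        have h2 : ⁅oneTensor A z, a ⊗ₜ[ℂ] x⁆ = a ⊗ₜ[ℂ] ⁅z, x⁆ := by
          change ⁅(1 : A) ⊗ₜ[ℂ] z, a ⊗ₜ[ℂ] x⁆ = _
          rw [ExtendScalars.bracket_tmul, one_mul]
        rw [h2] at h1
        rw [Submodule.mem_comap]
        change actU (A ⊗[ℂ] g) V (oneTensor A z) (actU (A ⊗[ℂ] g) V (a ⊗ₜ x) n) ∈ _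
        rw [sub_eq_iff_eq_add.mp h1.symm]
        exact add_mem (hmem ⁅z, x⁆ n hn) (hmem x _ (hN z n hn))
      exact hle hn

theorem isLocFin_of_span {X : Set V} (hX : X ⊆ locFinVec A g V)
    (hspan : Submodule.span (U (A ⊗[ℂ] g)) X = ⊤) : IsLocFin A (g := g) V := by
  intro v
  have h1 : Submodule.span (U (A ⊗[ℂ] g)) X ≤
      toUSub (locFinVec A g V) (fun y v hv => smul_mem_locFinVec y hv) :=
    Submodule.span_le.mpr hX
  rw [hspan] at h1
  exact h1 (Submodule.mem_top (x := v))

omit [FiniteDimensional ℂ g] in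
theorem IsLocFin.of_surjective (hV : IsLocFin A (g := g) V) (f : V →ₗ[U (A ⊗[ℂ] g)] V')
    (hf : Function.Surjective f) : IsLocFin A (g := g) V' := by
  intro v'
  obtain ⟨v, rfl⟩ := hf v'
  obtain ⟨N, hvN, hfin, hN⟩ := hV v
  refine ⟨N.map (f.restrictScalars ℂ), ⟨v, hvN, rfl⟩, inferInstance, ?_⟩
  rintro x _ ⟨n, hn, rfl⟩
  exact ⟨_, hN x n hn, map_smul f _ n⟩

end LocFin

/-! ### Modules spanned by weight vectors -/

section WeightModules

variable {A : Type u} [CommRing A] [Algebra ℂ A]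
variable {g : Type v} [LieRing g] [LieAlgebra ℂ g] [FiniteDimensional ℂ g] [IsSimple ℂ g]
  {H : LieSubalgebra ℂ g} [H.IsCartanSubalgebra] {b : (rootSystem H).Base} {lam : domWeights b}
variable {V : Type*} [AddCommGroup V] [Module ℂ V] [Module (U (A ⊗[ℂ] g)) V]
  [IsScalarTower ℂ (U (A ⊗[ℂ] g)) V]
variable {V' : Type*} [AddCommGroup V'] [Module ℂ V'] [Module (U (A ⊗[ℂ] g)) V']
  [IsScalarTower ℂ (U (A ⊗[ℂ] g)) V']

variable (A H V) in
/-- The span of the weight vectors with weights in `Ω`. -/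
abbrev curWtSum (Ω : Set (Dual ℂ H)) : Submodule ℂ V :=
  wtSum ((actU (A ⊗[ℂ] g) V).toLinearMap ∘ₗ curEta A H) Ω

theorem curWtSum_map_le (f : V →ₗ[U (A ⊗[ℂ] g)] V') (Ω : Set (Dual ℂ H)) :
    curWtSum A H V Ω ≤ (curWtSum A H V' Ω).comap (f.restrictScalars ℂ) :=
  iSup₂_le fun _ hν _ hu => wt_le_wtSum hν (CurHW.map_mem_wtSpace (H := H) f hu)

theorem top_le_curWtSum_of_surjective (f : V →ₗ[U (A ⊗[ℂ] g)] V') (hf : Function.Surjective f)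
    {Ω : Set (Dual ℂ H)} (h : (⊤ : Submodule ℂ V) ≤ curWtSum A H V Ω) :
    (⊤ : Submodule ℂ V') ≤ curWtSum A H V' Ω := by
  intro v' _
  obtain ⟨v, rfl⟩ := hf v'
  exact curWtSum_map_le f Ω (h trivial)

theorem isObj_of_top_le (hV : IsLocFin A (g := g) V)
    (h : (⊤ : Submodule ℂ V) ≤ curWtSum A H V {ν | lam.1 - ν ∈ posCone b}) : IsObj A b lam V where
  locFin := hV
  wt_le μ hμ := by
    obtain ⟨u, hu, h0⟩ := (Submodule.ne_bot_iff _).mp hμ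
    exact mem_of_mem_wtSum (h (Submodule.mem_top (x := u))) hu h0

theorem smul_mem_curWtSum_univ (b : (rootSystem H).Base) (y : A ⊗[ℂ] g) {v : V} (hv : v ∈ curWtSum A H V Set.univ) :
    (iota y : U (A ⊗[ℂ] g)) • v ∈ curWtSum A H V Set.univ := by
  have key : ∀ y ∈ curNeg A b ∪ (curPos A b ∪ curCartan A H), ∃ β : Dual ℂ H,
      ∀ h, ⁅curEta A H h, y⁆ = β h • y := by
    rintro y (hy | hy | ⟨a, k, rfl⟩)
    · obtain ⟨β, -, -, h⟩ := curNeg_lie A b y hy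
      exact ⟨-β, h⟩
    · obtain ⟨β, -, -, h⟩ := curPos_lie A b y hy
      exact ⟨β, h⟩
    · refine ⟨0, curEta_lie A (fun h => ?_) a⟩
      have := congrArg Subtype.val (trivial_lie_zero H H h k)
      rw [LinearMap.zero_apply, zero_smul]
      exact this
  have hy : y ∈ Submodule.span ℂ (curNeg A b ∪ (curPos A b ∪ curCartan A H)) := by
    rw [cur_span]; trivial
  induction hy using Submodule.span_induction with
  | mem y hy =>
    obtain ⟨β, hβ⟩ := key y hy
    refine (iSup₂_le fun ν _ u hu => ?_ : curWtSum A H V Set.univ ≤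
      (curWtSum A H V Set.univ).comap (actU (A ⊗[ℂ] g) V y)) hv
    exact wt_le_wtSum (Set.mem_univ _) (rep_mem_wt (ρ := actU (A ⊗[ℂ] g) V) hβ hu)
  | zero => rw [map_zero, zero_smul]; exact zero_mem _
  | add x y _ _ hx hy => rw [map_add, add_smul]; exact add_mem hx hy
  | smul c x _ hx => rw [map_smul, smul_assoc]; exact Submodule.smul_mem _ c hx

theorem top_le_curWtSum_univ (b : (rootSystem H).Base) {v : V} {μ : Dual ℂ H} (hv : v ∈ wtSpace A H V μ)
    (hspan : Submodule.span (U (A ⊗[ℂ] g)) {v} = ⊤) :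
    (⊤ : Submodule ℂ V) ≤ curWtSum A H V Set.univ := by
  intro u _
  have h1 : Submodule.span (U (A ⊗[ℂ] g)) {v} ≤ toUSub (curWtSum A H V Set.univ)
      (fun y v hv => smul_mem_curWtSum_univ b y hv) :=
    (Submodule.span_singleton_le_iff_mem _ _).mpr (wt_le_wtSum (Set.mem_univ μ) hv)
  rw [hspan] at h1
  exact h1 (Submodule.mem_top (x := u))

end WeightModules

section GlobalWeylModules

variable (A : Type u) [CommRing A] [Algebra ℂ A]
variable {g : Type v} [LieRing g] [LieAlgebra ℂ g] [FiniteDimensional ℂ g] [IsSimple ℂ g]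
  {H : LieSubalgebra ℂ g} [H.IsCartanSubalgebra] (b : (rootSystem H).Base) (lam : domWeights b)

/-- The map `V(λ) → P_A(V(λ))`, `v ↦ 1 ⊗ v`. -/
def inducedIncl : SimpleMod b lam →ₗ[ℂ] Induced A b lam :=
  ((inducedRel A b lam).mkQ.restrictScalars ℂ) ∘ₗ TensorProduct.mk ℂ _ _ 1

theorem inducedIncl_smul (y : U g) (v : SimpleMod b lam) :
    inducedIncl A b lam (y • v) = mapU (oneTensor A) y • inducedIncl A b lam v := by
  have h1 : (1 * mapU (oneTensor A) y) ⊗ₜ[ℂ] v - 1 ⊗ₜ[ℂ] (y • v) ∈ inducedRel A b lam :=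
    Submodule.subset_span ⟨1, y, v, rfl⟩
  have h2 := (Submodule.Quotient.eq _).mpr h1
  rw [one_mul, ← mul_one (mapU (oneTensor A) y), ← smul_eq_mul, ← TensorProduct.smul_tmul'] at h2
  exact h2.symm

theorem inducedIncl_span :
    Submodule.span (U (A ⊗[ℂ] g)) {inducedIncl A b lam (simpleGen b lam)} = ⊤ := by
  rw [eq_top_iff]
  intro p _
  obtain ⟨t, rfl⟩ := Submodule.Quotient.mk_surjective _ p
  induction t using TensorProduct.induction_on with
  | zero => exact zero_mem _
  | add x y hx hy => exact add_mem (hx trivial) (hy trivial)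
  | tmul x v =>
    obtain ⟨y, rfl⟩ := Submodule.Quotient.mk_surjective _ v
    have h1 : (Submodule.Quotient.mk y : SimpleMod b lam) = y • simpleGen b lam := by
      rw [simpleGen, ← Submodule.Quotient.mk_smul, smul_eq_mul, mul_one]
    have h2 : (Submodule.Quotient.mk (x ⊗ₜ Submodule.Quotient.mk y) : Induced A b lam) =
        x • inducedIncl A b lam (Submodule.Quotient.mk y) := by
      change _ = Submodule.Quotient.mk (x • ((1 : U (A ⊗[ℂ] g)) ⊗ₜ[ℂ] _))
      rw [TensorProduct.smul_tmul', smul_eq_mul, mul_one]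
    rw [h2, h1, inducedIncl_smul, ← mul_smul]
    exact Submodule.smul_mem _ _ (Submodule.mem_span_singleton_self _)

theorem inducedIncl_mem_wtSpace :
    inducedIncl A b lam (simpleGen b lam) ∈ wtSpace A H (Induced A b lam) lam.1 := by
  intro h
  rw [← mapU_iota, ← inducedIncl_smul, ← map_smul]
  congr 1
  refine (Submodule.Quotient.eq _).mpr (Submodule.subset_span (Or.inl (Or.inr ⟨h, ?_⟩)))
  change iota (h : g) * 1 - lam.1 h • (1 : U g) = _
  rw [mul_one, Algebra.algebraMap_eq_smul_one]

theorem induced_locFin : IsLocFin A (g := g) (Induced A b lam) := by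
  refine isLocFin_of_span (Set.singleton_subset_iff.mpr ?_) (inducedIncl_span A b lam)
  refine ⟨LinearMap.range (inducedIncl A b lam), ⟨_, rfl⟩, inferInstance, ?_⟩
  rintro x _ ⟨v, rfl⟩
  exact ⟨iota x • v, by rw [inducedIncl_smul, mapU_iota]⟩

theorem weylGen_mem_wtSpace :
    weylGen A b lam ∈ wtSpace A H (GlobalWeyl A b lam) lam.1 :=
  CurHW.map_mem_wtSpace (truncRel A b lam).mkQ (inducedIncl_mem_wtSpace A b lam)

theorem weylGen_span : Submodule.span (U (A ⊗[ℂ] g)) {weylGen A b lam} = ⊤ := by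
  have h1 : ({weylGen A b lam} : Set (GlobalWeyl A b lam)) =
      (truncRel A b lam).mkQ '' {inducedIncl A b lam (simpleGen b lam)} := by
    rw [Set.image_singleton]; rfl
  rw [h1, Submodule.span_image, inducedIncl_span, Submodule.map_top, Submodule.range_mkQ]

/-- The induced module is spanned by weight vectors, and those of weight outside `λ - Q⁺` die in the
truncation. A spanning statement is needed to exclude new weights in the quotient. -/
theorem top_le_curWtSum_weyl : (⊤ : Submodule ℂ (GlobalWeyl A b lam)) ≤
    curWtSum A H (GlobalWeyl A b lam) {ν | lam.1 - ν ∈ posCone b} := by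
  intro w _
  obtain ⟨p, rfl⟩ := Submodule.Quotient.mk_surjective _ w
  refine (iSup₂_le fun ν _ u hu => ?_ : curWtSum A H (Induced A b lam) Set.univ ≤
    (curWtSum A H (GlobalWeyl A b lam) {ν | lam.1 - ν ∈ posCone b}).comap
      ((truncRel A b lam).mkQ.restrictScalars ℂ))
    (top_le_curWtSum_univ b (inducedIncl_mem_wtSpace A b lam) (inducedIncl_span A b lam)
      (Submodule.mem_top (x := p)))
  by_cases hν : lam.1 - ν ∈ posCone b
  · exact wt_le_wtSum (Ω := {ν | lam.1 - ν ∈ posCone b}) hν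
      (CurHW.map_mem_wtSpace (H := H) (truncRel A b lam).mkQ hu)
  · have h1 : (truncRel A b lam).mkQ u = 0 :=
      (Submodule.Quotient.mk_eq_zero _).mpr (Submodule.subset_span ⟨ν, hν, hu⟩)
    rw [Submodule.mem_comap, LinearMap.restrictScalars_apply, h1]
    exact zero_mem _

theorem globalWeyl_isObj : IsObj A b lam (GlobalWeyl A b lam) :=
  isObj_of_top_le ((induced_locFin A b lam).of_surjective (truncRel A b lam).mkQ
    (Submodule.mkQ_surjective _)) (top_le_curWtSum_weyl A b lam)

end GlobalWeylModules

/-! ### Irreducible modules over `𝐀_λ` -/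

section AlamModules

variable {A : Type u} [CommRing A] [Algebra ℂ A]
variable {g : Type v} [LieRing g] [LieAlgebra ℂ g] [FiniteDimensional ℂ g] [IsSimple ℂ g]
  {H : LieSubalgebra ℂ g} [H.IsCartanSubalgebra] {b : (rootSystem H).Base} {lam : domWeights b}

theorem curPos_smul_eq_zero {V : Type*} [AddCommGroup V] [Module ℂ V] [Module (U (A ⊗[ℂ] g)) V]
    [IsScalarTower ℂ (U (A ⊗[ℂ] g)) V] (hV : IsObj A b lam V) {y : A ⊗[ℂ] g} (hy : y ∈ curPos A b)
    {v : V} (hv : v ∈ wtSpace A H V lam.1) : (iota y : U (A ⊗[ℂ] g)) • v = 0 := by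
  obtain ⟨β, hβ, hβ0, hw⟩ := curPos_mem_wtSpace hy hv
  by_contra hne
  refine hβ0 (posCone_pointed b hβ ?_)
  have := hV.wt_le _ ((Submodule.ne_bot_iff _).mpr ⟨_, hw, hne⟩)
  rwa [sub_add_cancel_left] at this

variable (A b lam) in
/-- The map `y ↦ y w_λ` on `U(𝔥 ⊗ A)`. -/
def weylCartan : U (A ⊗[ℂ] H) →ₗ[ℂ] GlobalWeyl A b lam :=
  (LinearMap.toSpanSingleton (U (A ⊗[ℂ] g)) _ (weylGen A b lam)).restrictScalars ℂ ∘ₗ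
    (inclU A H).toLinearMap

theorem weylCartan_apply (y : U (A ⊗[ℂ] H)) :
    weylCartan A b lam y = inclU A H y • weylGen A b lam := rfl

theorem weylCartan_mem (y : U (A ⊗[ℂ] H)) :
    weylCartan A b lam y ∈ wtSpace A H (GlobalWeyl A b lam) lam.1 :=
  wtSpace_stable A y (weylGen_mem_wtSpace A b lam)

/-- A proper ideal of `𝐀_λ` generates a proper submodule of `W_A(λ)`. -/
theorem weylGen_notMem_span {I : Ideal (Alam A b lam)} (hI : I ≠ ⊤) :
    weylGen A b lam ∉ Submodule.span (U (A ⊗[ℂ] g))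
      (weylCartan A b lam '' {y | Ideal.Quotient.mk (annIdeal A b lam) y ∈ I}) := by
  intro hmem
  let J : Submodule ℂ (U (A ⊗[ℂ] H)) :=
    (I.comap (Ideal.Quotient.mk (annIdeal A b lam))).restrictScalars ℂ
  have h1 := span_le_repSpan _ hmem
  -- The subspace `J w_λ` is stable under `𝔥 ⊗ A` and killed by `𝔫⁺ ⊗ A`, so what it generates has
  -- weight-`λ` part equal to itself. If `w_λ` belonged to it, then `w_λ = y w_λ` with `y ∈ J`, and
  -- `1` would lie in `I`.
  have h2 : repSpan (actU (A ⊗[ℂ] g) (GlobalWeyl A b lam)) (J.map (weylCartan A b lam)) ≤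
      J.map (weylCartan A b lam) ⊔ curWtSum A H _ (below (posCone b) lam.1) := by
    refine repSpan_le_sup (fun x hx hx' => posCone_pointed b hx hx') (cur_span A b)
      (curNeg_lie A b) ?_ ?_
    · rintro x (hx | ⟨a, h, rfl⟩) _ ⟨y, hy, rfl⟩
      · rw [actU_apply, curPos_smul_eq_zero (globalWeyl_isObj A b lam) hx (weylCartan_mem y)]
        exact zero_mem _
      · refine ⟨iota (a ⊗ₜ[ℂ] h) * y, Ideal.mul_mem_left _ _ hy, ?_⟩
        rw [weylCartan_apply, map_mul, mul_smul, inclU_iota]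
        rfl
    · rintro _ ⟨y, hy, rfl⟩
      exact weylCartan_mem y
  obtain ⟨_, ⟨y, hy, rfl⟩, z, hz, hsum⟩ := Submodule.mem_sup.mp (h2 h1)
  have hz' : z ∈ wtSpace A H (GlobalWeyl A b lam) lam.1 := by
    rw [eq_sub_of_add_eq' hsum]
    exact sub_mem (weylGen_mem_wtSpace A b lam) (weylCartan_mem y)
  by_cases hz0 : z = 0
  · rw [hz0, add_zero] at hsum
    refine hI ((Ideal.eq_top_iff_one _).mpr ?_)
    have h3 : (1 : U (A ⊗[ℂ] H)) - y ∈ annIdeal A b lam := by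
      change inclU A H (1 - y) • weylGen A b lam = 0
      rw [map_sub, map_one, sub_smul, one_smul, ← weylCartan_apply, hsum, sub_self]
    have h4 : Ideal.Quotient.mk (annIdeal A b lam) 1 = Ideal.Quotient.mk (annIdeal A b lam) y :=
      Ideal.Quotient.eq.mpr h3
    rw [← map_one (Ideal.Quotient.mk (annIdeal A b lam)), h4]
    exact hy
  · exact (mem_of_mem_wtSum hz hz' hz0).2 rfl

theorem rfun_smul_coe {V : Type*} [AddCommGroup V] [Module ℂ V] [Module (U (A ⊗[ℂ] g)) V]
    [IsScalarTower ℂ (U (A ⊗[ℂ] g)) V] (hV : IsObj A b lam V) (y : U (A ⊗[ℂ] H))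
    (m : RFun A b lam hV) :
    (Ideal.Quotient.mk (annIdeal A b lam) y • m).1 = inclU A H y • m.1 := rfl

variable [Algebra.FiniteType ℂ A]

theorem xiLam_isObj (ξ : XiLam A b lam) : IsObj A b lam (TensEval ξ.1) :=
  tensEval_isObj ξ.1 (by rw [ξ.2, sub_self]; exact zero_mem _)

theorem xiLam_char_one (ξ : XiLam A b lam) : xiChar ξ.1 1 = lam.1 := by rw [xiChar_one, ξ.2]

theorem tensGen_mem_wtSpace (ξ : XiLam A b lam) :
    tensGen ξ.1 ∈ wtSpace A H (TensEval ξ.1) lam.1 := by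
  rw [← xiLam_char_one ξ]; exact (tensGen_curHW ξ.1).mem_wtSpace

/-- The generator of the one-dimensional module `M_ξ`. -/
def rfunGen (ξ : XiLam A b lam) : RFun A b lam (xiLam_isObj ξ) :=
  ⟨tensGen ξ.1, tensGen_mem_wtSpace ξ⟩

theorem rfunGen_ne_zero (ξ : XiLam A b lam) : rfunGen ξ ≠ 0 :=
  fun h => tensGen_ne_zero ξ.1 (congrArg Subtype.val h)

theorem exists_smul_rfunGen (ξ : XiLam A b lam) (m : RFun A b lam (xiLam_isObj ξ)) :
    ∃ c : ℂ, m = c • rfunGen ξ := by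
  obtain ⟨c, hc⟩ := (tensGen_curHW ξ.1).mem_span (u := m.1) (by
    rw [xiLam_char_one]; exact m.2)
  exact ⟨c, Subtype.ext hc⟩

theorem iota_smul_rfunGen (ξ : XiLam A b lam) (a : A) (h : H) :
    Ideal.Quotient.mk (annIdeal A b lam) (iota (a ⊗ₜ[ℂ] h)) • rfunGen ξ =
      xiChar ξ.1 a h • rfunGen ξ := by
  refine Subtype.ext ?_
  rw [rfun_smul_coe, inclU_iota]
  exact (tensGen_curHW ξ.1).cartan a h

theorem rfun_isSimple (ξ : XiLam A b lam) :
    IsSimpleModule (Alam A b lam) (RFun A b lam (xiLam_isObj ξ)) := by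
  have : Nontrivial (RFun A b lam (xiLam_isObj ξ)) := ⟨_, _, rfunGen_ne_zero ξ⟩
  refine (isSimpleModule_iff _ _).mpr
    { eq_bot_or_eq_top := fun N => or_iff_not_imp_left.mpr fun hN => ?_ }
  obtain ⟨u, hu, hu0⟩ := (Submodule.ne_bot_iff _).mp hN
  obtain ⟨c, rfl⟩ := exists_smul_rfunGen ξ u
  have hc : c ≠ 0 := fun h => hu0 (by rw [h, zero_smul])
  rw [eq_top_iff]
  intro m _
  obtain ⟨d, rfl⟩ := exists_smul_rfunGen ξ m
  have := N.smul_of_tower_mem (d * c⁻¹) hu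
  rwa [smul_smul, mul_assoc, inv_mul_cancel₀ hc, mul_one] at this

theorem xi_eq_of_rfun_equiv {ξ ξ' : XiLam A b lam}
    (f : RFun A b lam (xiLam_isObj ξ) ≃ₗ[Alam A b lam] RFun A b lam (xiLam_isObj ξ')) : ξ = ξ' := by
  refine Subtype.ext (xiChar_injective fun a => LinearMap.ext fun h => ?_)
  have h0 : f (rfunGen ξ) ≠ 0 := f.map_ne_zero_iff.mpr (rfunGen_ne_zero ξ)
  obtain ⟨c, hc⟩ := exists_smul_rfunGen ξ' (f (rfunGen ξ))
  refine smul_left_injective ℂ h0 ?_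
  change xiChar ξ.1 a h • f (rfunGen ξ) = xiChar ξ'.1 a h • f (rfunGen ξ)
  have h1 := congrArg f (iota_smul_rfunGen ξ a h)
  rw [map_smul] at h1
  have h2 : f (xiChar ξ.1 a h • rfunGen ξ) = xiChar ξ.1 a h • f (rfunGen ξ) :=
    LinearMap.map_smul_of_tower f.toLinearMap _ _
  rw [← h2, ← h1, hc, smul_comm, iota_smul_rfunGen, smul_comm]

/-- Write `M = 𝐀_λ / I`. The submodule generated by `I w_λ` is proper and `W_A(λ)` is cyclic, so it
lies in a maximal submodule. The irreducible quotient is some `V_ξ`, where the image of `w_λ` is a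
nonzero vector of `M_ξ` annihilated by `I`. -/
theorem exists_xi_of_isSimple (M : Type w) [AddCommGroup M] [Module (Alam A b lam) M]
    [hM : IsSimpleModule (Alam A b lam) M] :
    ∃ ξ : XiLam A b lam, Nonempty (M ≃ₗ[Alam A b lam] RFun A b lam (xiLam_isObj ξ)) := by
  obtain ⟨I, hI, ⟨e⟩⟩ := isSimpleModule_iff_quot_maximal.mp hM
  have hw := weylGen_notMem_span hI.ne_top
  set N₀ := Submodule.span (U (A ⊗[ℂ] g))
    (weylCartan A b lam '' {y | Ideal.Quotient.mk (annIdeal A b lam) y ∈ I})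
  have : Module.Finite (U (A ⊗[ℂ] g)) (GlobalWeyl A b lam) :=
    ⟨⟨{weylGen A b lam}, by rw [Finset.coe_singleton]; exact weylGen_span A b lam⟩⟩
  obtain ⟨N, hN, hN₀⟩ := (eq_top_or_exists_le_coatom N₀).resolve_left fun h => hw (by
    rw [h]; trivial)
  have _ : IsSimpleModule (U (A ⊗[ℂ] g)) (GlobalWeyl A b lam ⧸ N) :=
    isSimpleModule_iff_isCoatom.mpr hN
  have hobj : IsObj A b lam (GlobalWeyl A b lam ⧸ N) :=
    isObj_of_top_le ((globalWeyl_isObj A b lam).locFin.of_surjective N.mkQ N.mkQ_surjective)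
      (top_le_curWtSum_of_surjective N.mkQ N.mkQ_surjective (top_le_curWtSum_weyl A b lam))
  have hq : N.mkQ (weylGen A b lam) ∈ wtSpace A H (GlobalWeyl A b lam ⧸ N) lam.1 :=
    CurHW.map_mem_wtSpace N.mkQ (weylGen_mem_wtSpace A b lam)
  have hq0 : N.mkQ (weylGen A b lam) ≠ 0 := fun h => hN.1 (by
    rw [eq_top_iff, ← weylGen_span A b lam, Submodule.span_singleton_le_iff_mem]
    exact (Submodule.Quotient.mk_eq_zero _).mp h)
  obtain ⟨ξ, ⟨f⟩⟩ := exists_xiLam hobj ((Submodule.ne_bot_iff _).mpr ⟨_, hq, hq0⟩)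
  have := rfun_isSimple ξ
  have _ : IsSimpleModule (Alam A b lam) (Alam A b lam ⧸ I) :=
    isSimpleModule_iff_isCoatom.mpr hI.out
  let m : RFun A b lam (xiLam_isObj ξ) :=
    ⟨f (N.mkQ (weylGen A b lam)), CurHW.map_mem_wtSpace f.toLinearMap hq⟩
  have hm : m ≠ 0 := fun h => hq0 (f.map_eq_zero_iff.mp (congrArg Subtype.val h))
  -- A nonzero homomorphism between the irreducible modules `𝐀_λ / I` and `M_ξ` is bijective.
  let F := I.liftQ (LinearMap.toSpanSingleton (Alam A b lam) _ m) (by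
    intro r hr
    obtain ⟨y, rfl⟩ := Ideal.Quotient.mk_surjective r
    refine Subtype.ext ?_
    change inclU A H y • f (N.mkQ (weylGen A b lam)) = 0
    rw [← map_smul, ← map_smul, f.map_eq_zero_iff]
    exact (Submodule.Quotient.mk_eq_zero _).mpr (hN₀ (Submodule.subset_span ⟨y, hr, rfl⟩)))
  have hF : F ≠ 0 := fun h => hm (by
    have h1 : F (Submodule.Quotient.mk 1) = m := by
      change (1 : Alam A b lam) • m = m
      rw [one_smul]
    rw [← h1, h]; rfl)
  exact ⟨ξ, ⟨e.trans (LinearEquiv.ofBijective F (LinearMap.bijective_of_ne_zero hF))⟩⟩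

end AlamModules

/-! ### The functor `𝐕_A^λ` -/

section HighestWeightQuotient

variable {A : Type u} [CommRing A] [Algebra ℂ A]
variable {g : Type v} [LieRing g] [LieAlgebra ℂ g] [FiniteDimensional ℂ g] [IsSimple ℂ g]
  {H : LieSubalgebra ℂ g} [H.IsCartanSubalgebra] {b : (rootSystem H).Base}
variable {V : Type*} [AddCommGroup V] [Module ℂ V] [Module (U (A ⊗[ℂ] g)) V]
  [IsScalarTower ℂ (U (A ⊗[ℂ] g)) V]
variable {V' : Type*} [AddCommGroup V'] [Module ℂ V'] [Module (U (A ⊗[ℂ] g)) V']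
  [IsScalarTower ℂ (U (A ⊗[ℂ] g)) V'] {v : V} {Λ : A → Dual ℂ H}

/-- The proper submodules of a highest weight module lie in the kernel of a nonzero homomorphism to
an irreducible module. -/
theorem CurHW.le_ker_of_ne_top [IsSimpleModule (U (A ⊗[ℂ] g)) V'] (hv : CurHW b v Λ)
    (hspan : Submodule.span (U (A ⊗[ℂ] g)) {v} = ⊤) (F : V →ₗ[U (A ⊗[ℂ] g)] V') (hF : F v ≠ 0)
    {N : Submodule (U (A ⊗[ℂ] g)) V} (hN : N ≠ ⊤) : N ≤ LinearMap.ker F := by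
  by_contra hNF
  have h1 : N.map F = ⊤ := (eq_bot_or_eq_top _).resolve_left fun h =>
    hNF ((Submodule.map_le_iff_le_comap).mp h.le)
  obtain ⟨n, hn, hFn⟩ : F v ∈ N.map F := by rw [h1]; trivial
  obtain ⟨x, hx, z, hz, rfl⟩ := Submodule.mem_sup.mp
    (hv.le_sup_of_span hspan (Submodule.mem_top (x := n)))
  have hnot : Λ 1 ∉ below (posCone b) (Λ 1) := fun h => h.2 rfl
  obtain ⟨c, rfl⟩ := Submodule.mem_span_singleton.mp hx
  have h2 : c • v ∈ N.restrictScalars ℂ := component_mem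
    (τ := (actU (A ⊗[ℂ] g) V).toLinearMap ∘ₗ curEta A H)
    (N.restrictScalars ℂ) (fun h v hv => N.smul_mem _ hv) hnot
    ((wtSpace A H V (Λ 1)).smul_mem c hv.mem_wtSpace) hz hn
  -- If `c = 0`, the nonzero vector `F v` of weight `Λ 1` would be the image of a sum of vectors of
  -- strictly lower weights. If `c ≠ 0`, then `N` contains the generator `v`.
  by_cases hc : c = 0
  · rw [hc, zero_smul, zero_add] at hFn
    have h3 : F z ∈ curWtSum A H V' (below (posCone b) (Λ 1)) := curWtSum_map_le F _ hz
    rw [hFn] at h3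
    exact hnot (mem_of_mem_wtSum h3 (CurHW.map_mem_wtSpace F hv.mem_wtSpace) hF)
  · have h3 := (N.restrictScalars ℂ).smul_mem c⁻¹ h2
    rw [smul_smul, inv_mul_cancel₀ hc, one_smul] at h3
    refine hN (eq_top_iff.mpr ?_)
    rw [← hspan, Submodule.span_singleton_le_iff_mem]
    exact h3

end HighestWeightQuotient

section VFunctor

variable {A : Type u} [CommRing A] [Algebra ℂ A] [Algebra.FiniteType ℂ A]
variable {g : Type v} [LieRing g] [LieAlgebra ℂ g] [FiniteDimensional ℂ g] [IsSimple ℂ g]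
  {H : LieSubalgebra ℂ g} [H.IsCartanSubalgebra] {b : (rootSystem H).Base} {lam : domWeights b}
  (ξ : XiLam A b lam)

/-- The `𝐀_λ`-module `M_ξ`. -/
abbrev rfunXi : Type (max u v) := RFun A b lam (xiLam_isObj ξ)

/-- The generator of `𝐖_A^λ M_ξ`. -/
def wfunGen : WFun A b lam (rfunXi ξ) := (weylRel A b lam (rfunXi ξ)).mkQ
  (weylGen A b lam ⊗ₜ[ℂ] rfunGen ξ)

theorem wfunGen_span : Submodule.span (U (A ⊗[ℂ] g)) {wfunGen ξ} = ⊤ := by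
  rw [eq_top_iff]
  intro p _
  obtain ⟨t, rfl⟩ := Submodule.Quotient.mk_surjective _ p
  induction t using TensorProduct.induction_on with
  | zero => exact zero_mem _
  | add x y hx hy => exact add_mem (hx trivial) (hy trivial)
  | tmul w m =>
    have hw : w ∈ Submodule.span (U (A ⊗[ℂ] g)) {weylGen A b lam} := by
      rw [weylGen_span]; trivial
    obtain ⟨x, rfl⟩ := Submodule.mem_span_singleton.mp hw
    obtain ⟨c, rfl⟩ := exists_smul_rfunGen ξ m
    refine Submodule.mem_span_singleton.mpr ⟨c • x, ?_⟩
    rw [wfunGen, ← map_smul, smul_assoc, TensorProduct.smul_tmul', ← TensorProduct.tmul_smul]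
    rfl

/-- The homomorphism `W_A(λ) → V_ξ` is multiplied by the coordinate `φ` on the line `M_ξ`. The
result is balanced over `𝐀_λ` because `M_ξ` is the `λ`-weight space of `V_ξ`, with the same action
of `U(𝔥 ⊗ A)`. -/
theorem exists_wfun_hom : ∃ F : WFun A b lam (rfunXi ξ) →ₗ[U (A ⊗[ℂ] g)] TensEval ξ.1,
    F (wfunGen ξ) = tensGen ξ.1 := by
  obtain ⟨f, hf⟩ := exists_hom (xiLam_isObj ξ) (tensGen_mem_wtSpace ξ)
  obtain ⟨φ, hφ⟩ := exists_linear_of_scalar (rfunGen ξ) LinearMap.id (rfunGen_ne_zero ξ)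
    (exists_smul_rfunGen ξ)
  have hφ' : ∀ m : rfunXi ξ, m.1 = φ m • tensGen ξ.1 := fun m => congrArg Subtype.val (hφ m)
  let B : GlobalWeyl A b lam →ₗ[U (A ⊗[ℂ] g)] rfunXi ξ →ₗ[ℂ] TensEval ξ.1 :=
    { toFun := fun w => φ.smulRight (f w)
      map_add' := fun w w' => LinearMap.ext fun m => by
        change φ m • f (w + w') = φ m • f w + φ m • f w'
        rw [map_add, smul_add]
      map_smul' := fun y w => LinearMap.ext fun m => by
        change φ m • f (y • w) = y • φ m • f w
        rw [map_smul, smul_comm] }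
  let Φ := TensorProduct.AlgebraTensorModule.lift B
  have hΦ : ∀ w m, Φ (w ⊗ₜ m) = φ m • f w := fun _ _ => rfl
  have hle : weylRel A b lam (rfunXi ξ) ≤ LinearMap.ker Φ := by
    refine Submodule.span_le.mpr ?_
    rintro t ⟨x, y, m, rfl⟩
    change Φ _ = 0
    have h1 : φ (Ideal.Quotient.mk (annIdeal A b lam) y • m) • tensGen ξ.1 =
        φ m • inclU A H y • tensGen ξ.1 := by
      rw [← hφ', rfun_smul_coe, hφ' m, smul_comm]
    rw [map_sub, hΦ, hΦ, map_smul f, map_smul f, hf, mul_smul, smul_comm (φ m) x,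
      smul_comm (φ _) x (tensGen ξ.1), h1, sub_self]
  refine ⟨(weylRel A b lam (rfunXi ξ)).liftQ Φ hle, ?_⟩
  change Φ (weylGen A b lam ⊗ₜ rfunGen ξ) = _
  rw [hΦ, hf, ← hφ']
  rfl

theorem wfunGen_curHW : CurHW b (wfunGen ξ) (xiChar ξ.1) where
  ne_zero h := by
    obtain ⟨F, hF⟩ := exists_wfun_hom ξ
    rw [h, map_zero] at hF
    exact tensGen_ne_zero ξ.1 hF.symm
  pos y hy := by
    rw [wfunGen, ← map_smul, TensorProduct.smul_tmul',
      curPos_smul_eq_zero (globalWeyl_isObj A b lam) hy (weylGen_mem_wtSpace A b lam),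
      TensorProduct.zero_tmul, map_zero]
  cartan a h := by
    have h1 : ((1 * inclU A H (iota (a ⊗ₜ[ℂ] h))) • weylGen A b lam) ⊗ₜ[ℂ] rfunGen ξ -
        ((1 : U (A ⊗[ℂ] g)) • weylGen A b lam) ⊗ₜ[ℂ]
          (Ideal.Quotient.mk (annIdeal A b lam) (iota (a ⊗ₜ[ℂ] h)) • rfunGen ξ) ∈
        weylRel A b lam (rfunXi ξ) := Submodule.subset_span ⟨_, _, _, rfl⟩
    rw [one_mul, one_smul, iota_smul_rfunGen, inclU_iota, ← TensorProduct.smul_tmul',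
      TensorProduct.tmul_smul] at h1
    exact (Submodule.Quotient.eq _).mpr h1

/-- The kernel of the surjection onto `V_ξ` is a proper submodule containing all the others, so it
is the sum of the proper submodules. -/
theorem nonempty_vfun_equiv : Nonempty (TensEval ξ.1 ≃ₗ[U (A ⊗[ℂ] g)] VFun A b lam (rfunXi ξ)) := by
  obtain ⟨F, hF⟩ := exists_wfun_hom ξ
  have hF0 : F (wfunGen ξ) ≠ 0 := by rw [hF]; exact tensGen_ne_zero ξ.1
  have hsurj : Function.Surjective F := by
    rw [← LinearMap.range_eq_top]
    refine (eq_bot_or_eq_top _).resolve_left fun h => hF0 ?_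
    rw [← Submodule.mem_bot (U (A ⊗[ℂ] g)), ← h]
    exact ⟨_, rfl⟩
  have hne : LinearMap.ker F ≠ ⊤ := fun h => hF0 (by rw [← LinearMap.mem_ker, h]; trivial)
  have hs : sSup {N : Submodule (U (A ⊗[ℂ] g)) (WFun A b lam (rfunXi ξ)) | N ≠ ⊤} =
      LinearMap.ker F := le_antisymm
    (sSup_le fun N hN => (wfunGen_curHW ξ).le_ker_of_ne_top (wfunGen_span ξ) F hF0 hN)
    (le_sSup hne)
  exact ⟨((Submodule.quotEquivOfEq _ _ hs).trans (F.quotKerEquivOfSurjective hsurj)).symm⟩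

end VFunctor

end WeylFunctor

end

open WeylFunctor

theorem mainTheorem7
    {A : Type u} [CommRing A] [Algebra ℂ A] [Algebra.FiniteType ℂ A]
    {g : Type v} [LieRing g] [LieAlgebra ℂ g] [FiniteDimensional ℂ g] [LieAlgebra.IsSimple ℂ g]
    {H : LieSubalgebra ℂ g} [H.IsCartanSubalgebra]
    (b : (LieAlgebra.IsKilling.rootSystem H).Base) (lam : domWeights b) :
    -- each `V_ξ`, `ξ ∈ Ξ_λ`, is an object of `𝓘_A^λ`, so that `M_ξ = 𝐑_A^λ V_ξ` makes sense
    ∃ hobj : ∀ ξ : XiLam A b lam, IsObj A b lam (TensEval ξ.1),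
      -- `ξ ↦ M_ξ` is a bijection from `Ξ_λ` to isomorphism classes of irreducible `𝐀_λ`-modules
      ((∀ ξ : XiLam A b lam, IsSimpleModule (Alam A b lam) (RFun A b lam (hobj ξ))) ∧
        (∀ ξ ξ' : XiLam A b lam,
          Nonempty (RFun A b lam (hobj ξ) ≃ₗ[Alam A b lam] RFun A b lam (hobj ξ')) → ξ = ξ') ∧
        (∀ (M : Type w) [AddCommGroup M] [Module (Alam A b lam) M],
          IsSimpleModule (Alam A b lam) M →
            ∃ ξ : XiLam A b lam, Nonempty (M ≃ₗ[Alam A b lam] RFun A b lam (hobj ξ)))) ∧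
      -- `ξ ↦ V_ξ` is a bijection from `Ξ_λ` to isomorphism classes of irreducible objects `V` of
      -- `𝓘_A^λ` with `V_λ ≠ 0`
      ((∀ ξ : XiLam A b lam, IsSimpleModule (U (A ⊗[ℂ] g)) (TensEval ξ.1) ∧
          wtSpace A H (TensEval ξ.1) lam.1 ≠ ⊥) ∧
        (∀ ξ ξ' : XiLam A b lam,
          Nonempty (TensEval ξ.1 ≃ₗ[U (A ⊗[ℂ] g)] TensEval ξ'.1) → ξ = ξ') ∧
        (∀ (V : Type w) [AddCommGroup V] [Module ℂ V] [Module (U (A ⊗[ℂ] g)) V]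
          [IsScalarTower ℂ (U (A ⊗[ℂ] g)) V],
          IsObj A b lam V → IsSimpleModule (U (A ⊗[ℂ] g)) V → wtSpace A H V lam.1 ≠ ⊥ →
            ∃ ξ : XiLam A b lam, Nonempty (V ≃ₗ[U (A ⊗[ℂ] g)] TensEval ξ.1))) ∧
      -- `ξ ↦ V_ξ` is a bijection from `{ξ ∈ Ξ | wt ξ ≤ λ}` to isomorphism classes of all
      -- irreducible objects of `𝓘_A^λ`
      ((∀ ξ : Xi A b, lam.1 - ξ.wt.1 ∈ posCone b →
          IsObj A b lam (TensEval ξ) ∧ IsSimpleModule (U (A ⊗[ℂ] g)) (TensEval ξ)) ∧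
        (∀ ξ ξ' : Xi A b, lam.1 - ξ.wt.1 ∈ posCone b → lam.1 - ξ'.wt.1 ∈ posCone b →
          Nonempty (TensEval ξ ≃ₗ[U (A ⊗[ℂ] g)] TensEval ξ') → ξ = ξ') ∧
        (∀ (V : Type w) [AddCommGroup V] [Module ℂ V] [Module (U (A ⊗[ℂ] g)) V]
          [IsScalarTower ℂ (U (A ⊗[ℂ] g)) V],
          IsObj A b lam V → IsSimpleModule (U (A ⊗[ℂ] g)) V →
            ∃ ξ : Xi A b, lam.1 - ξ.wt.1 ∈ posCone b ∧
              Nonempty (V ≃ₗ[U (A ⊗[ℂ] g)] TensEval ξ))) ∧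
      -- compatibility with the functor `𝐕_A^λ`
      (∀ ξ : XiLam A b lam,
        Nonempty (TensEval ξ.1 ≃ₗ[U (A ⊗[ℂ] g)] VFun A b lam (RFun A b lam (hobj ξ)))) := by
  refine ⟨xiLam_isObj, ⟨rfun_isSimple, fun ξ ξ' ⟨f⟩ => xi_eq_of_rfun_equiv f, ?_⟩, ⟨?_, ?_, ?_⟩,
    ⟨?_, ?_, ?_⟩, nonempty_vfun_equiv⟩
  · intro M _ _ hM
    exact exists_xi_of_isSimple M
  · exact fun ξ => ⟨inferInstance,
      (Submodule.ne_bot_iff _).mpr ⟨_, tensGen_mem_wtSpace ξ, tensGen_ne_zero ξ.1⟩⟩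
  · exact fun ξ ξ' ⟨e⟩ => Subtype.ext (xi_eq_of_equiv e)
  · intro V _ _ _ _ hV _ hlam
    exact exists_xiLam hV hlam
  · exact fun ξ hξ => ⟨tensEval_isObj ξ hξ, inferInstance⟩
  · exact fun ξ ξ' _ _ ⟨e⟩ => xi_eq_of_equiv e
  · intro V _ _ _ _ hV _
    exact exists_xi hV
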